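/- Let $\Bbbk$ be a commutative ring, $R$ an associative $\Bbbk$-algebra, and $M$ a left $R$-module. Fix a projective resolution $P\to M$ and, for every $R$-module $N$, a projective resolution $Q=Q^N\to N$. For $n\ge 0$ write $\Omega^nM=\operatorname{Coker}(P_{n+1}\to P_n)$ and $\Omega^nN=\operatorname{Coker}(Q_{n+1}\to Q_n)$; for $n<0$ put $\Omega^n=0$ and $Q_n=0$. A *cohomological functor* is a family $T=(T^i)_{i\in\mathbb Z}$ of additive functors from $R$-modules to $\Bbbk$-modules together with connecting homomorphisms $T^i(N_3)\to T^{i+1}(N_1)$ for all short exact sequences $0\to N_1\to N_2\to N_3\to 0$, natural in the sequence, that make the long sequences exact. A morphism of cohomological functors is a family of natural transformations compatible with the connecting homomorphisms. Consider the following families. * *Stable cohomology:* $\widehat{\operatorname{Ext}}{}^i_{\mathrm{stable}}(M,N)=H_{-i}\bigl(\operatorname{Hom}_R(P,Q)/\overline{\operatorname{Hom}}_R(P,Q)\bigr)$, where $\overline{\operatorname{Hom}}_R(P,Q)_j=\coprod_n\operatorname{Hom}_R(P_n,Q_{n+j})$ inside $\operatorname{Hom}_R(P,Q)_j=\prod_n\operatorname{Hom}_R(P_n,Q_{n+j})$.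 The connecting homomorphism of a short exact sequence is the snake map given by a short exact sequence of projective resolutions over it. * *Benson–Carlson cohomology:* $\widehat{\operatorname{Ext}}{}^i_{\mathrm{B\&C}}(M,N)=\operatorname{colim}_{k\ge 0}\underline{\operatorname{Hom}}_R(\Omega^kM,\Omega^{k-i}N)$, where $\underline{\operatorname{Hom}}_R$ denotes homomorphisms modulo those that factor through a projective module. The transition map sends $[f]$ to $[h]$ where $(h,g,f)$ is a morphism from $0\to\Omega^{k+1}M\to P_k\to\Omega^kM\to0$ to $0\to\Omega^{n+1}N\to Q_n\to\Omega^nN\to 0$, with $n=k-i\ge0$. For $0\to N_1\to N_2\to N_3\to0$, and a short exact sequence of projective resolutions over it with the chosen resolutions of $N_1$ and $N_3$ as outer terms, the connecting homomorphism sends the class of $f\colon\Omega^kM\to\Omega^{n}N_3$, with $n=k-i\ge 0$, to the class of $(-1)^kh\colon\Omega^{k+1}M\to\Omega^nN_1$, where $(h,g,f)$ is a morphism from $0\to\Omega^{k+1}M\to P_k\to\Omega^kM\to0$ to the induced short exact sequence of $n$-th syzygies. * *The functor* $\operatorname{Ext}_R(M,-)=(\operatorname{Ext}^i_R(M,-))_{i\in\mathbb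 Z}$, zero for $i<0$, with its connecting homomorphisms, and its left satellites $\operatorname S_k\operatorname{Ext}^{j}_R(M,N)=\operatorname{Ker}\bigl(\operatorname{Ext}^{j}_R(M,\Omega^kN)\to\operatorname{Ext}^{j}_R(M,Q_{k-1})\bigr)$, with $Q_{-1}=0$. The connecting homomorphisms of $0\to\Omega^{k+1}N\to Q_k\to\Omega^kN\to0$ induce maps $\operatorname S_k\operatorname{Ext}_R^{k+i}(M,N)\to\operatorname S_{k+1}\operatorname{Ext}_R^{k+1+i}(M,N)$. A *P-completion* of a cohomological functor $T$ is a morphism $\tau\colon T\to\widehat T$ of cohomological functors such that $\widehat T$ vanishes on all projective modules, and every morphism from $T$ to a cohomological functor that vanishes on all projective modules factors uniquely through $\tau$. **Theorem.** 1. $\widehat{\operatorname{Ext}}_{\mathrm{stable}}(M,-)$ and $\widehat{\operatorname{Ext}}_{\mathrm{B\&C}}(M,-)$ are cohomological functors. 2. There is a morphism $\mu\colon\widehat{\operatorname{Ext}}_{\mathrm{stable}}(M,-)\to\widehat{\operatorname{Ext}}_{\mathrm{B\&C}}(M,-)$ of cohomological functors such that every $\mu^N_i$ is an isomorphism. It can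 be chosen such that it is given as follows: let $\varphi=(\varphi_n\colon P_n\to Q_{n-i})_n$ represent a class $\widehat\varphi\in\widehat{\operatorname{Ext}}{}^i_{\mathrm{stable}}(M,N)$, let $k\ge\max(0,i)$ be such that $\partial\varphi_{n+1}=(-1)^i\varphi_{n}\partial$ for all $n\ge k$, and let $\widetilde\varphi_k\colon\Omega^kM\to\Omega^{k-i}N$ be the homomorphism induced by $\varphi_k$; then $\mu^N_i(\widehat\varphi)$ is the class of $(-1)^{ik}\,\widetilde\varphi_k$ in the colimit. 3. Stable cohomology is the P-completion of $\operatorname{Ext}_R(M,-)$: there is a P-completion $\tau\colon\operatorname{Ext}_R(M,-)\to\widehat{\operatorname{Ext}}_{\mathrm{stable}}(M,-)$. Moreover, for every $i\in\mathbb Z$ there is an isomorphism, natural in $N$, $$\theta_i\colon\widehat{\operatorname{Ext}}{}^i_{\mathrm{stable}}(M,N)\;\cong\;\operatorname{colim}_{k\ge0}\operatorname S_k\operatorname{Ext}^{k+i}_R(M,N),$$ such that for all $k\ge 0$ the composite of $\operatorname S_k\operatorname{Ext}^{k+i}_R(M,N)\to\operatorname{colim}$, $\theta_i^{-1}$ and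 the iterated connecting homomorphism $\widehat{\operatorname{Ext}}{}^i_{\mathrm{stable}}(M,N)\cong\widehat{\operatorname{Ext}}{}^i_{\mathrm{stable}}(M,\Omega^0N)\to\cdots\to\widehat{\operatorname{Ext}}{}^{k+i}_{\mathrm{stable}}(M,\Omega^kN)$ is the inclusion $\operatorname S_k\operatorname{Ext}^{k+i}_R(M,N)\subseteq\operatorname{Ext}_R^{k+i}(M,\Omega^kN)$ followed by $\tau$. -/

import Mathlib

open CategoryTheory Limits CochainComplex.HomComplex

universe t v u

-- For an algebra `R` over a commutative ring `𝕜`, the category of `R`-modules is `𝕜`-linear.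
attribute [instance] ModuleCat.Algebra.instLinear

namespace StableCohomology

noncomputable section StableHom

variable (𝕜 : Type t) [CommRing 𝕜] {C : Type u} [Category.{v} C] [Preadditive C] [Linear 𝕜 C]

/-- The submodule `∐ₚ Hom(Fᵖ, Gᵖ⁺ⁿ)` of `∏ₚ Hom(Fᵖ, Gᵖ⁺ⁿ)`: cochains with only finitely many
nonzero components. -/
def boundedCochain (F G : CochainComplex C ℤ) (n : ℤ) : Submodule 𝕜 (Cochain F G n) where
  carrier := {z | {p : ℤ | ∃ (q : ℤ) (h : p + n = q), z.v p q h ≠ 0}.Finite}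
  zero_mem' := by simp
  add_mem' {x y} hx hy := (hx.union hy).subset fun p hp => by
    obtain ⟨q, h, hq⟩ := hp
    by_contra h'
    simp only [Set.mem_union, Set.mem_ofPred_eq, not_or, not_exists, not_not] at h'
    exact hq (by simp [h'.1 q h, h'.2 q h])
  smul_mem' c x hx := hx.subset fun p ⟨q, h, hq⟩ => ⟨q, h, fun h0 => hq (by simp [h0])⟩

variable {𝕜}

lemma mem_boundedCochain {F G : CochainComplex C ℤ} {n : ℤ} {z : Cochain F G n} :
    z ∈ boundedCochain 𝕜 F G n ↔
      {p : ℤ | ∃ (q : ℤ) (h : p + n = q), z.v p q h ≠ 0}.Finite := Iff.rfl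

lemma comp_mem_boundedCochain {F G K : CochainComplex C ℤ} {n m l : ℤ} (h : n + m = l)
    {z : Cochain F G n} (hz : z ∈ boundedCochain 𝕜 F G n) (y : Cochain G K m) :
    z.comp y h ∈ boundedCochain 𝕜 F K l := by
  rw [mem_boundedCochain] at hz ⊢
  refine hz.subset fun p ⟨q, hq, hp⟩ => ⟨p + n, rfl, fun h0 => hp ?_⟩
  rw [Cochain.comp_v z y h p (p + n) q rfl (by lia), h0, zero_comp]

lemma δ_mem_boundedCochain {F G : CochainComplex C ℤ} {n m : ℤ}
    {z : Cochain F G n} (hz : z ∈ boundedCochain 𝕜 F G n) :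
    δ n m z ∈ boundedCochain 𝕜 F G m := by
  by_cases hnm : n + 1 = m
  · rw [mem_boundedCochain] at hz ⊢
    refine (hz.union (hz.preimage (f := fun p => p + 1) (add_left_injective 1).injOn)).subset ?_
    rintro p ⟨q, hq, hp⟩
    by_contra h
    simp only [Set.mem_union, Set.mem_ofPred_eq, not_or, not_exists, not_not,
      Set.mem_preimage] at h
    refine hp ?_
    rw [δ_v n m hnm z p q hq (q - 1) (p + 1) rfl rfl, h.1 _ (by lia), h.2 q (by lia)]
    simp
  · rw [δ_shape _ _ hnm]
    exact zero_mem _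

variable (𝕜)

/-- Right composition with a fixed cochain, as a linear map. -/
def postcompCochain (F : CochainComplex C ℤ) {G K : CochainComplex C ℤ} {m : ℤ}
    (y : Cochain G K m) (n l : ℤ) (h : n + m = l) : Cochain F G n →ₗ[𝕜] Cochain F K l where
  toFun z := z.comp y h
  map_add' _ _ := by simp
  map_smul' _ _ := by simp

@[simp] lemma postcompCochain_apply (F : CochainComplex C ℤ) {G K : CochainComplex C ℤ} {m : ℤ}
    (y : Cochain G K m) {n l : ℤ} (h : n + m = l) (z : Cochain F G n) :
    postcompCochain 𝕜 F y n l h z = z.comp y h := rfl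

/-- The term of degree `n` of the quotient complex `Hom(F, G) / Hom̄(F, G)`. -/
abbrev StableCochain (F G : CochainComplex C ℤ) (n : ℤ) : Type v :=
  Cochain F G n ⧸ boundedCochain 𝕜 F G n

/-- The quotient complex `Hom(F, G) / Hom̄(F, G)`, in cohomological grading. -/
def stableHomComplex (F G : CochainComplex C ℤ) : CochainComplex (ModuleCat.{v} 𝕜) ℤ where
  X n := ModuleCat.of 𝕜 (StableCochain 𝕜 F G n)
  d n m := ModuleCat.ofHom (Submodule.mapQ _ _ (δ_hom 𝕜 F G n m)
    fun _ hz => δ_mem_boundedCochain hz)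
  shape n m h := by
    apply ModuleCat.hom_ext
    apply Submodule.linearMap_qext
    ext z
    exact (congrArg (Submodule.Quotient.mk (p := boundedCochain 𝕜 F G m)) (δ_shape n m h z)).trans
      rfl
  d_comp_d' n m l _ _ := by
    apply ModuleCat.hom_ext
    apply Submodule.linearMap_qext
    ext z
    exact (congrArg (Submodule.Quotient.mk (p := boundedCochain 𝕜 F G l)) (δ_δ n m l z)).trans
      rfl

/-- The class of a cochain in `Hom(F, G) / Hom̄(F, G)`. -/
def stableHomMk {F G : CochainComplex C ℤ} {n : ℤ} (z : Cochain F G n) :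
    (stableHomComplex 𝕜 F G).X n :=
  (boundedCochain 𝕜 F G n).mkQ z

lemma stableHomMk_surjective {F G : CochainComplex C ℤ} {n : ℤ} :
    Function.Surjective (stableHomMk 𝕜 : Cochain F G n → _) :=
  Submodule.mkQ_surjective _

lemma stableHomComplex_hom_ext {F G : CochainComplex C ℤ} {n : ℤ} {A : ModuleCat.{v} 𝕜}
    {f g : (stableHomComplex 𝕜 F G).X n ⟶ A}
    (h : ∀ z : Cochain F G n, f (stableHomMk 𝕜 z) = g (stableHomMk 𝕜 z)) : f = g := by
  ext x
  obtain ⟨z, rfl⟩ := stableHomMk_surjective 𝕜 x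
  exact h z

lemma stableHomMk_eq_zero_iff {F G : CochainComplex C ℤ} {n : ℤ} (z : Cochain F G n) :
    stableHomMk 𝕜 z = 0 ↔ z ∈ boundedCochain 𝕜 F G n :=
  Submodule.Quotient.mk_eq_zero _

lemma stableHomMk_add {F G : CochainComplex C ℤ} {n : ℤ} (z z' : Cochain F G n) :
    stableHomMk 𝕜 (z + z') = stableHomMk 𝕜 z + stableHomMk 𝕜 z' := rfl

lemma stableHomMk_zero {F G : CochainComplex C ℤ} {n : ℤ} :
    stableHomMk 𝕜 (0 : Cochain F G n) = 0 := rfl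

@[simp] lemma stableHomComplex_d_mk {F G : CochainComplex C ℤ} {n m : ℤ} (z : Cochain F G n) :
    (stableHomComplex 𝕜 F G).d n m (stableHomMk 𝕜 z) = stableHomMk 𝕜 (δ n m z) := rfl

/-- The map on the terms of the quotient complexes induced by right composition with a cochain. -/
def stablePostcomp (F : CochainComplex C ℤ) {G K : CochainComplex C ℤ} {m : ℤ}
    (y : Cochain G K m) (n l : ℤ) (h : n + m = l) :
    (stableHomComplex 𝕜 F G).X n ⟶ (stableHomComplex 𝕜 F K).X l :=
  ModuleCat.ofHom (Submodule.mapQ (boundedCochain 𝕜 F G n) (boundedCochain 𝕜 F K l)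
    (postcompCochain 𝕜 F y n l h) fun _ hz => comp_mem_boundedCochain h hz y)

@[simp] lemma stablePostcomp_mk (F : CochainComplex C ℤ) {G K : CochainComplex C ℤ} {m : ℤ}
    (y : Cochain G K m) {n l : ℤ} (h : n + m = l) (z : Cochain F G n) :
    stablePostcomp 𝕜 F y n l h (stableHomMk 𝕜 z) = stableHomMk 𝕜 (z.comp y h) := rfl

/-- The chain map `Hom(F, G) / Hom̄(F, G) ⟶ Hom(F, G') / Hom̄(F, G')` induced by `g : G ⟶ G'`. -/
def stableHomMap (F : CochainComplex C ℤ) {G G' : CochainComplex C ℤ} (g : G ⟶ G') :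
    stableHomComplex 𝕜 F G ⟶ stableHomComplex 𝕜 F G' where
  f n := stablePostcomp 𝕜 F (Cochain.ofHom g) n n (add_zero n)
  comm' _ m _ := stableHomComplex_hom_ext 𝕜 fun z =>
    congrArg (stableHomMk 𝕜) (δ_comp_ofHom z g m)

@[simp] lemma stableHomMap_f_mk (F : CochainComplex C ℤ) {G G' : CochainComplex C ℤ} (g : G ⟶ G')
    {n : ℤ} (z : Cochain F G n) : (stableHomMap 𝕜 F g).f n (stableHomMk 𝕜 z) =
      stableHomMk 𝕜 (z.comp (Cochain.ofHom g) (add_zero n)) := rfl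

lemma stableHomMap_id (F G : CochainComplex C ℤ) :
    stableHomMap 𝕜 F (𝟙 G) = 𝟙 (stableHomComplex 𝕜 F G) := by
  ext n : 1
  refine stableHomComplex_hom_ext 𝕜 fun z => congrArg (stableHomMk 𝕜) ?_
  change z.comp (Cochain.ofHom (𝟙 G)) (add_zero n) = z
  exact z.comp_id

lemma stableHomMap_comp (F : CochainComplex C ℤ) {G G' G'' : CochainComplex C ℤ} (g : G ⟶ G')
    (g' : G' ⟶ G'') :
    stableHomMap 𝕜 F (g ≫ g') = stableHomMap 𝕜 F g ≫ stableHomMap 𝕜 F g' := by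
  ext n : 1
  refine stableHomComplex_hom_ext 𝕜 fun z => congrArg (stableHomMk 𝕜) ?_
  change z.comp (Cochain.ofHom (g ≫ g')) (add_zero n) =
    (z.comp (Cochain.ofHom g) (add_zero n)).comp (Cochain.ofHom g') (add_zero n)
  ext
  simp

lemma stableHomMap_zero (F G G' : CochainComplex C ℤ) :
    stableHomMap 𝕜 F (0 : G ⟶ G') = 0 := by
  ext n : 1
  refine stableHomComplex_hom_ext 𝕜 fun z => ?_
  change stableHomMk 𝕜 (z.comp (Cochain.ofHom 0) (add_zero n)) = 0
  simp [stableHomMk_zero]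

/-- Homotopic chain maps induce homotopic maps on the quotient complexes. -/
def stableHomHomotopy (F : CochainComplex C ℤ) {G G' : CochainComplex C ℤ} {g g' : G ⟶ G'}
    (h : Homotopy g g') : Homotopy (stableHomMap 𝕜 F g) (stableHomMap 𝕜 F g') where
  hom n m := if hnm : n + (-1) = m then stablePostcomp 𝕜 F (Cochain.ofHomotopy h) n m hnm else 0
  zero n m hnm := dif_neg (by simp at hnm; lia)
  comm n := by
    rw [dNext_eq _ (show (ComplexShape.up ℤ).Rel n (n + 1) by simp),
      prevD_eq _ (show (ComplexShape.up ℤ).Rel (n - 1) n by simp), dif_pos (by lia),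
      dif_pos (by lia)]
    refine stableHomComplex_hom_ext 𝕜 fun z => congrArg (stableHomMk 𝕜) ?_
    change z.comp (Cochain.ofHom g) (add_zero n) =
      (δ n (n + 1) z).comp (Cochain.ofHomotopy h) (by lia) +
      δ (n - 1) n (z.comp (Cochain.ofHomotopy h) (by lia)) +
      z.comp (Cochain.ofHom g') (add_zero n)
    rw [δ_comp z (Cochain.ofHomotopy h) (show n + (-1) = n - 1 by lia) (n + 1) 0 n (by lia) rfl
      (by lia)]
    simp

/-- The short complex `Hom(F, T) / Hom̄(F, T)` attached to a short complex `T` of complexes. -/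
def stableHomShortComplex (F : CochainComplex C ℤ) (T : ShortComplex (CochainComplex C ℤ)) :
    ShortComplex (CochainComplex (ModuleCat.{v} 𝕜) ℤ) :=
  ShortComplex.mk (stableHomMap 𝕜 F T.f) (stableHomMap 𝕜 F T.g) (by
    rw [← stableHomMap_comp, T.zero, stableHomMap_zero])

lemma stableHomShortComplex_shortExact (F : CochainComplex C ℤ)
    (T : ShortComplex (CochainComplex C ℤ))
    (σ : ∀ n, (T.map (HomologicalComplex.eval C (ComplexShape.up ℤ) n)).Splitting) :
    (stableHomShortComplex 𝕜 F T).ShortExact := by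
  let r : Cochain T.X₂ T.X₁ 0 := Cochain.ofHoms fun n => (σ n).r
  let s : Cochain T.X₃ T.X₂ 0 := Cochain.ofHoms fun n => (σ n).s
  have hr (n : ℤ) : r.v n n (add_zero n) = (σ n).r := Cochain.ofHoms_v _ _
  have hs (n : ℤ) : s.v n n (add_zero n) = (σ n).s := Cochain.ofHoms_v _ _
  have fr : (Cochain.ofHom T.f).comp r (add_zero 0) = Cochain.ofHom (𝟙 _) := by
    ext n
    rw [Cochain.comp_zero_cochain_v, Cochain.ofHom_v, Cochain.ofHom_v, hr]
    exact (σ n).f_r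
  have sg : s.comp (Cochain.ofHom T.g) (add_zero 0) = Cochain.ofHom (𝟙 _) := by
    ext n
    rw [Cochain.comp_zero_cochain_v, Cochain.ofHom_v, Cochain.ofHom_v, hs]
    exact (σ n).s_g
  have idd : r.comp (Cochain.ofHom T.f) (add_zero 0) +
      (Cochain.ofHom T.g).comp s (add_zero 0) = Cochain.ofHom (𝟙 _) := by
    ext n
    rw [Cochain.add_v, Cochain.comp_zero_cochain_v, Cochain.comp_zero_cochain_v, Cochain.ofHom_v,
      Cochain.ofHom_v, Cochain.ofHom_v, hr, hs]
    exact (σ n).id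
  refine HomologicalComplex.shortExact_of_degreewise_shortExact _ fun n => ?_
  refine { exact := ?_, mono_f := ?_, epi_g := ?_ }
  · rw [ShortComplex.moduleCat_exact_iff]
    intro x hx
    obtain ⟨z, rfl⟩ := stableHomMk_surjective 𝕜 x
    have hz : z.comp (Cochain.ofHom T.g) (add_zero n) ∈ boundedCochain 𝕜 F T.X₃ n :=
      (stableHomMk_eq_zero_iff 𝕜 _).1 hx
    refine ⟨stableHomMk 𝕜 (z.comp r (add_zero n)), ?_⟩
    change stableHomMk 𝕜 ((z.comp r (add_zero n)).comp (Cochain.ofHom T.f) (add_zero n)) = _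
    have h1 := (stableHomMk_eq_zero_iff 𝕜 _).2 (comp_mem_boundedCochain (add_zero n) hz s)
    rw [← add_zero (stableHomMk 𝕜 _), ← h1, ← stableHomMk_add]
    congr 1
    rw [Cochain.comp_assoc_of_third_is_zero_cochain, Cochain.comp_assoc_of_third_is_zero_cochain,
      ← Cochain.comp_add, idd, Cochain.comp_id]
  · rw [ModuleCat.mono_iff_injective, injective_iff_map_eq_zero]
    intro x hx
    obtain ⟨z, rfl⟩ := stableHomMk_surjective 𝕜 x
    have hz : z.comp (Cochain.ofHom T.f) (add_zero n) ∈ boundedCochain 𝕜 F T.X₂ n :=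
      (stableHomMk_eq_zero_iff 𝕜 _).1 hx
    have h1 := comp_mem_boundedCochain (add_zero n) hz r
    rw [Cochain.comp_assoc_of_third_is_zero_cochain, fr, Cochain.comp_id] at h1
    exact (stableHomMk_eq_zero_iff 𝕜 _).2 h1
  · rw [ModuleCat.epi_iff_surjective]
    intro x
    obtain ⟨z, rfl⟩ := stableHomMk_surjective 𝕜 x
    refine ⟨stableHomMk 𝕜 (z.comp s (add_zero n)), ?_⟩
    change stableHomMk 𝕜 ((z.comp s (add_zero n)).comp (Cochain.ofHom T.g) (add_zero n)) = _
    rw [Cochain.comp_assoc_of_third_is_zero_cochain, sg, Cochain.comp_id]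

end StableHom

noncomputable section Resolutions

variable {C : Type u} [Category.{v} C] [Abelian C]

/-- The augmentation `Q₀ ⟶ Z` of a projective resolution. -/
def aug {Z : C} (Q : ProjectiveResolution Z) : Q.complex.X 0 ⟶ Z := Q.π.f 0

instance {Z : C} (Q : ProjectiveResolution Z) : Epi (aug Q) :=
  inferInstanceAs (Epi (Q.π.f 0))

@[simp] lemma d_aug {Z : C} (Q : ProjectiveResolution Z) : Q.complex.d 1 0 ≫ aug Q = 0 :=
  Q.complex_d_comp_π_f_zero

@[simp] lemma d_aug_assoc {Z W : C} (Q : ProjectiveResolution Z) (h : Z ⟶ W) :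
    Q.complex.d 1 0 ≫ aug Q ≫ h = 0 ≫ h := by
  rw [← Category.assoc, d_aug]

lemma exact_aug {Z : C} (Q : ProjectiveResolution Z) :
    (ShortComplex.mk (Q.complex.d 1 0) (aug Q) (d_aug Q)).Exact := Q.exact₀

/-- A short exact sequence of projective resolutions lying over a short exact sequence `S`, with
prescribed resolutions of the two outer terms. -/
structure Horseshoe (S : ShortComplex C) (Q₁ : ProjectiveResolution S.X₁)
    (Q₃ : ProjectiveResolution S.X₃) where
  /-- the resolution of the middle term -/
  mid : ProjectiveResolution S.X₂
  /-- the chain map over `S.f` -/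
  f : Q₁.complex ⟶ mid.complex
  /-- the chain map over `S.g` -/
  g : mid.complex ⟶ Q₃.complex
  zero : f ≫ g = 0
  shortExact : (ShortComplex.mk f g zero).ShortExact
  f_aug : f.f 0 ≫ aug mid = aug Q₁ ≫ S.f
  g_aug : g.f 0 ≫ aug Q₃ = aug mid ≫ S.g

section Existence

variable {S : ShortComplex C}

lemma exists_twist (hS : S.ShortExact) (Q₁ : ProjectiveResolution S.X₁)
    (Q₃ : ProjectiveResolution S.X₃) :
    ∃ (s : Q₃.complex.X 0 ⟶ S.X₂) (χ : ∀ n, Q₃.complex.X (n + 1) ⟶ Q₁.complex.X n),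
    s ≫ S.g = aug Q₃ ∧ χ 0 ≫ aug Q₁ ≫ S.f + Q₃.complex.d 1 0 ≫ s = 0 ∧
    ∀ n, χ (n + 1) ≫ Q₁.complex.d (n + 1) n + Q₃.complex.d (n + 2) (n + 1) ≫ χ n = 0 := by
  have := hS.epi_g
  have := hS.mono_f
  let s : Q₃.complex.X 0 ⟶ S.X₂ := Projective.factorThru (aug Q₃) S.g
  have hs : s ≫ S.g = aug Q₃ := Projective.factorThru_comp _ _
  let out : ∀ n, Σ A : C, (Q₁.complex.X n ⟶ A) := fun n => match n with
    | 0 => ⟨S.X₁, aug Q₁⟩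
    | n + 1 => ⟨_, Q₁.complex.d (n + 1) n⟩
  have hex : ∀ n (y : Q₃.complex.X (n + 2) ⟶ Q₁.complex.X n), y ≫ (out n).2 = 0 →
      ∃ x : Q₃.complex.X (n + 2) ⟶ Q₁.complex.X (n + 1), x ≫ Q₁.complex.d (n + 1) n = y := by
    intro n y hy
    match n, y, hy with
    | 0, y, hy => exact ⟨(exact_aug Q₁).liftFromProjective y hy, (exact_aug Q₁).liftFromProjective_comp y hy⟩
    | n + 1, y, hy => exact ⟨(Q₁.exact_succ n).liftFromProjective y hy,
        (Q₁.exact_succ n).liftFromProjective_comp y hy⟩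
  let t : Q₃.complex.X 1 ⟶ S.X₁ := hS.exact.lift (-(Q₃.complex.d 1 0 ≫ s)) (by simp [hs])
  have ht : t ≫ S.f = -(Q₃.complex.d 1 0 ≫ s) := hS.exact.lift_f _ _
  let χ₀ : Q₃.complex.X 1 ⟶ Q₁.complex.X 0 :=
    Projective.factorThru t (aug Q₁)
  have hχ₀ : χ₀ ≫ aug Q₁ = t := Projective.factorThru_comp _ _
  have h0 : Q₃.complex.d 2 1 ≫ χ₀ ≫ (out 0).2 = 0 := by
    change Q₃.complex.d 2 1 ≫ χ₀ ≫ aug Q₁ = 0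
    rw [hχ₀, ← cancel_mono S.f, Category.assoc, ht]
    simp
  have step : ∀ n (x : {x : Q₃.complex.X (n + 1) ⟶ Q₁.complex.X n //
      Q₃.complex.d (n + 2) (n + 1) ≫ x ≫ (out n).2 = 0}), ∃ y : {y : Q₃.complex.X (n + 2) ⟶
        Q₁.complex.X (n + 1) // Q₃.complex.d (n + 3) (n + 2) ≫ y ≫ (out (n + 1)).2 = 0},
      y.1 ≫ Q₁.complex.d (n + 1) n = -(Q₃.complex.d (n + 2) (n + 1) ≫ x.1) := by
    rintro n ⟨x, hx⟩
    obtain ⟨y, hy⟩ := hex n (-(Q₃.complex.d (n + 2) (n + 1) ≫ x)) (by simp [hx])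
    refine ⟨⟨y, ?_⟩, hy⟩
    change _ ≫ y ≫ Q₁.complex.d (n + 1) n = 0
    rw [hy]
    simp
  choose next hnext using step
  let χ : ∀ n, {x : Q₃.complex.X (n + 1) ⟶ Q₁.complex.X n //
      Q₃.complex.d (n + 2) (n + 1) ≫ x ≫ (out n).2 = 0} :=
    fun n => Nat.rec ⟨χ₀, h0⟩ (fun n x => next n x) n
  refine ⟨s, fun n => (χ n).1, hs, ?_, fun n => ?_⟩
  · change χ₀ ≫ aug Q₁ ≫ S.f + _ = 0
    have : χ₀ ≫ aug Q₁ ≫ S.f = t ≫ S.f := by rw [← hχ₀, Category.assoc]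
    rw [this, ht]
    simp
  · rw [show (χ (n + 1)).1 ≫ Q₁.complex.d (n + 1) n = _ from hnext n (χ n)]
    simp

/-- The horseshoe lemma. -/
theorem nonempty_horseshoe (hS : S.ShortExact) (Q₁ : ProjectiveResolution S.X₁)
    (Q₃ : ProjectiveResolution S.X₃) :
    Nonempty (Horseshoe S Q₁ Q₃) := by
  obtain ⟨s, χ, hs, h0, hχ⟩ := exists_twist hS Q₁ Q₃
  let E : ChainComplex C ℕ := ChainComplex.of (fun n => Q₁.complex.X n ⊞ Q₃.complex.X n)
    (fun n => biprod.desc (Q₁.complex.d (n + 1) n ≫ biprod.inl)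
      (χ n ≫ biprod.inl + Q₃.complex.d (n + 1) n ≫ biprod.inr)) (fun n => by
        apply biprod.hom_ext'
        · simp
        · simp only [biprod.inr_desc_assoc, Preadditive.add_comp, Category.assoc,
            biprod.inl_desc, biprod.inr_desc, Preadditive.comp_add, comp_zero]
          rw [← Category.assoc, ← add_assoc, ← Category.assoc _ (χ n), ← Preadditive.add_comp, hχ]
          simp)
  have hEd : ∀ n, E.d (n + 1) n = biprod.desc (Q₁.complex.d (n + 1) n ≫ biprod.inl)
      (χ n ≫ biprod.inl + Q₃.complex.d (n + 1) n ≫ biprod.inr) := fun n => by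
    dsimp only [E]
    rw [ChainComplex.of_d]
  let f : Q₁.complex ⟶ E :=
    { f := fun n => (biprod.inl : _ ⟶ Q₁.complex.X n ⊞ Q₃.complex.X n)
      comm' := by
        rintro _ j rfl
        rw [hEd]
        exact biprod.inl_desc _ _ }
  let g : E ⟶ Q₃.complex :=
    { f := fun n => (biprod.snd : Q₁.complex.X n ⊞ Q₃.complex.X n ⟶ _)
      comm' := by
        rintro _ j rfl
        rw [hEd]
        apply biprod.hom_ext' <;> simp }
  have fg : f ≫ g = 0 := by
    ext n
    exact biprod.inl_snd
  let π : E ⟶ (ChainComplex.single₀ C).obj S.X₂ := (ChainComplex.toSingle₀Equiv _ _).symm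
    ⟨biprod.desc (aug Q₁ ≫ S.f) s, by
      rw [hEd]
      apply biprod.hom_ext'
      · rw [biprod.inl_desc_assoc, Category.assoc, biprod.inl_desc,
          d_aug_assoc, zero_comp, comp_zero]
      · rw [biprod.inr_desc_assoc, Preadditive.add_comp, Category.assoc, Category.assoc,
          biprod.inl_desc, biprod.inr_desc, comp_zero]
        exact h0⟩
  have hπ : π.f 0 = biprod.desc (aug Q₁ ≫ S.f) s :=
    ChainComplex.toSingle₀Equiv_symm_apply_f_zero _ _
  have hse : (ShortComplex.mk f g fg).ShortExact := by
    refine HomologicalComplex.shortExact_of_degreewise_shortExact _ fun n => ?_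
    refine ShortComplex.Splitting.shortExact
      { r := (biprod.fst : Q₁.complex.X n ⊞ Q₃.complex.X n ⟶ _)
        s := (biprod.inr : _ ⟶ Q₁.complex.X n ⊞ Q₃.complex.X n)
        f_r := biprod.inl_fst
        s_g := biprod.inr_snd
        id := biprod.total }
  have fπ : f.f 0 ≫ π.f 0 = aug Q₁ ≫ S.f := by
    rw [hπ]
    exact biprod.inl_desc _ _
  have gπ : g.f 0 ≫ aug Q₃ = π.f 0 ≫ S.g := by
    rw [hπ]
    apply biprod.hom_ext'
    · change biprod.inl ≫ biprod.snd ≫ aug Q₃ = biprod.inl ≫ biprod.desc (aug Q₁ ≫ S.f) s ≫ S.g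
      simp
    · change biprod.inr ≫ biprod.snd ≫ aug Q₃ = biprod.inr ≫ biprod.desc (aug Q₁ ≫ S.f) s ≫ S.g
      simp [hs]
  have : QuasiIso π := by
    refine ⟨fun n => ?_⟩
    match n with
    | 0 =>
      rw [quasiIsoAt_iff_isIso_homologyMap]
      let T : ShortComplex (ChainComplex C ℕ) := ShortComplex.mk f g fg
      let T' : ShortComplex (ChainComplex C ℕ) := S.map (ChainComplex.single₀ C)
      let φ : T ⟶ T' :=
        { τ₁ := Q₁.π, τ₂ := π, τ₃ := Q₃.π
          comm₁₂ := by
            apply HomologicalComplex.to_single_hom_ext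
            change aug Q₁ ≫ ((ChainComplex.single₀ C).map S.f).f 0 = f.f 0 ≫ π.f 0
            rw [ChainComplex.single₀_map_f_zero]
            exact fπ.symm
          comm₂₃ := by
            apply HomologicalComplex.to_single_hom_ext
            change π.f 0 ≫ ((ChainComplex.single₀ C).map S.g).f 0 = g.f 0 ≫ aug Q₃
            rw [ChainComplex.single₀_map_f_zero]
            exact gπ.symm }
      have hT : T.ShortExact := hse
      have hT' : T'.ShortExact := hS.map_of_exact (ChainComplex.single₀ C)
      let ψ := (HomologicalComplex.homologyFunctor C (ComplexShape.down ℕ) 0).mapShortComplex.map φ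
      have : IsIso ψ.τ₁ := inferInstanceAs (IsIso (HomologicalComplex.homologyMap Q₁.π 0))
      have : IsIso ψ.τ₃ := inferInstanceAs (IsIso (HomologicalComplex.homologyMap Q₃.π 0))
      have e1 : Epi (HomologicalComplex.homologyMap T.g 0) := by
        have := hT.epi_g
        exact HomologicalComplex.epi_homologyMap_of_epi_of_not_rel _ _ (by simp)
      have e2 : Mono (HomologicalComplex.homologyMap T'.f 0) := by
        have := hS.mono_f
        have : Mono ((HomologicalComplex.single C (ComplexShape.down ℕ) 0 ⋙
            HomologicalComplex.homologyFunctor C (ComplexShape.down ℕ) 0).map S.f) := by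
          rw [← NatIso.naturality_2 (HomologicalComplex.homologyFunctorSingleIso C
            (ComplexShape.down ℕ) 0) S.f]
          dsimp only [Functor.id_map, Functor.id_obj]
          infer_instance
        exact this
      have : Mono ψ.τ₂ := ShortComplex.mono_of_mono_of_mono_of_mono ψ (hT.homology_exact₂ 0) e2
        inferInstance inferInstance
      have : Epi ψ.τ₂ := ShortComplex.epi_of_epi_of_epi_of_epi ψ (hT'.homology_exact₂ 0) e1
        inferInstance inferInstance
      exact isIso_of_mono_of_epi ψ.τ₂
    | n + 1 =>
      rw [quasiIsoAt_iff_exactAt' _ _ (ChainComplex.exactAt_succ_single_obj _ _)]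
      exact hse.exactAt_X₂ _ (Q₁.complex_exactAt_succ n) (Q₃.complex_exactAt_succ n)
  exact ⟨{ mid := { complex := E
                    projective := fun n => by
                      change Projective (Q₁.complex.X n ⊞ Q₃.complex.X n)
                      infer_instance
                    π := π }
           f := f, g := g, zero := fg, shortExact := hse, f_aug := fπ, g_aug := gπ }⟩

end Existence
end Resolutions

noncomputable section Resolutions2

variable {C : Type u} [Category.{v} C] [Abelian C]

/-- The chain map, as a map of cochain complexes indexed by `ℤ`, lifting `f` to the chosen
projective resolutions. -/
def liftRes (Q : ∀ N : C, ProjectiveResolution N) {N N' : C} (f : N ⟶ N') :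
    (Q N).cochainComplex ⟶ (Q N').cochainComplex :=
  HomologicalComplex.extendMap (ProjectiveResolution.lift f (Q N) (Q N')) _

lemma homotopy_liftRes_id (Q : ∀ N : C, ProjectiveResolution N) (N : C) :
    Nonempty (Homotopy (liftRes Q (𝟙 N)) (𝟙 _)) :=
  ⟨((ProjectiveResolution.liftIdHomotopy N (Q N)).extend _).trans
    (Homotopy.ofEq (HomologicalComplex.extendMap_id _ _))⟩

lemma homotopy_liftRes_comp (Q : ∀ N : C, ProjectiveResolution N) {N N' N'' : C} (f : N ⟶ N')
    (f' : N' ⟶ N'') :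
    Nonempty (Homotopy (liftRes Q (f ≫ f')) (liftRes Q f ≫ liftRes Q f')) :=
  ⟨((ProjectiveResolution.liftCompHomotopy f f' (Q N) (Q N') (Q N'')).extend _).trans
    (Homotopy.ofEq (HomologicalComplex.extendMap_comp _ _ _))⟩

/-- A construction which is functorial for chain maps between the chosen projective resolutions
and takes homotopic chain maps to the same map, regarded as a functor of the resolved object. -/
def resolutionFunctor {D : Type*} [Category* D] (Q : ∀ N : C, ProjectiveResolution N)
    (obj : C → D)
    (map : ∀ {N N' : C}, ((Q N).cochainComplex ⟶ (Q N').cochainComplex) → (obj N ⟶ obj N'))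
    (map_id : ∀ N, map (𝟙 (Q N).cochainComplex) = 𝟙 (obj N))
    (map_comp : ∀ {N N' N'' : C} (g : (Q N).cochainComplex ⟶ (Q N').cochainComplex)
      (g' : (Q N').cochainComplex ⟶ (Q N'').cochainComplex), map (g ≫ g') = map g ≫ map g')
    (map_homotopy : ∀ {N N' : C} (g g' : (Q N).cochainComplex ⟶ (Q N').cochainComplex),
      Homotopy g g' → map g = map g') : C ⥤ D where
  obj := obj
  map f := map (liftRes Q f)
  map_id N := by
    obtain ⟨h⟩ := homotopy_liftRes_id Q N
    rw [map_homotopy _ _ h, map_id]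
  map_comp f f' := by
    obtain ⟨h⟩ := homotopy_liftRes_comp Q f f'
    rw [map_homotopy _ _ h, map_comp]

/-- The short exact sequence of cochain complexes indexed by `ℤ` underlying a short exact sequence
of projective resolutions. -/
def Horseshoe.shortComplex {S : ShortComplex C} {Q₁ : ProjectiveResolution S.X₁}
    {Q₃ : ProjectiveResolution S.X₃} (H : Horseshoe S Q₁ Q₃) :
    ShortComplex (CochainComplex C ℤ) :=
  ShortComplex.mk (X₁ := Q₁.cochainComplex) (X₂ := H.mid.cochainComplex)
    (X₃ := Q₃.cochainComplex) (HomologicalComplex.extendMap H.f _)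
    (HomologicalComplex.extendMap H.g _)
    ((HomologicalComplex.extendMap_comp _ _ _).symm.trans (by
      rw [H.zero]
      exact HomologicalComplex.extendMap_zero _ _ _))

lemma Horseshoe.shortComplex_shortExact {S : ShortComplex C} {Q₁ : ProjectiveResolution S.X₁}
    {Q₃ : ProjectiveResolution S.X₃} (H : Horseshoe S Q₁ Q₃) : H.shortComplex.ShortExact := by
  refine HomologicalComplex.shortExact_of_degreewise_shortExact _ fun n => ?_
  by_cases hn : n ≤ 0
  · obtain ⟨k, rfl⟩ := Int.exists_eq_neg_ofNat hn
    have h := H.shortExact.map_of_exact (HomologicalComplex.eval C (ComplexShape.down ℕ) k)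
    refine ShortComplex.shortExact_of_iso (ShortComplex.isoMk
      (Q₁.cochainComplexXIso (-k) k).symm (H.mid.cochainComplexXIso (-k) k).symm
      (Q₃.cochainComplexXIso (-k) k).symm ?_ ?_) h
    · change (Q₁.cochainComplexXIso (-k) k).inv ≫ (HomologicalComplex.extendMap H.f _).f (-(k : ℤ)) =
        H.f.f k ≫ (H.mid.cochainComplexXIso (-k) k).inv
      rw [HomologicalComplex.extendMap_f _ _ (show ComplexShape.embeddingDownNat.f k = -(k : ℤ) from rfl)]
      exact Iso.inv_hom_id_assoc _ _
    · change (H.mid.cochainComplexXIso (-k) k).inv ≫ (HomologicalComplex.extendMap H.g _).f (-(k : ℤ)) =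
        H.g.f k ≫ (Q₃.cochainComplexXIso (-k) k).inv
      rw [HomologicalComplex.extendMap_f _ _ (show ComplexShape.embeddingDownNat.f k = -(k : ℤ) from rfl)]
      exact Iso.inv_hom_id_assoc _ _
  · have h1 : IsZero (Q₁.cochainComplex.X n) := CochainComplex.isZero_of_isStrictlyLE _ 0 _
    have h2 : IsZero (H.mid.cochainComplex.X n) := CochainComplex.isZero_of_isStrictlyLE _ 0 _
    have h3 : IsZero (Q₃.cochainComplex.X n) := CochainComplex.isZero_of_isStrictlyLE _ 0 _
    exact { exact := ShortComplex.exact_of_isZero_X₂ _ h2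
            mono_f := ⟨fun _ _ _ => h1.eq_of_tgt _ _⟩
            epi_g := ⟨fun _ _ _ => h3.eq_of_src _ _⟩ }

/-- The `n`-th syzygy `Coker (Kₙ₊₁ ⟶ Kₙ)` where `Kₙ` denotes the object `K⁻ⁿ`. -/
def syz (K : CochainComplex C ℤ) (n : ℤ) : C := K.opcycles (-n)

/-- The projection of `Kₙ` onto the `n`-th syzygy. -/
def syzProj (K : CochainComplex C ℤ) (n : ℤ) : K.X (-n) ⟶ syz K n := K.pOpcycles (-n)

/-- The map from the `m`-th syzygy to `Kₙ`, where `m = n + 1`, induced by the differential. -/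
def syzIncl (K : CochainComplex C ℤ) (n m : ℤ) : syz K m ⟶ K.X (-n) := K.fromOpcycles (-m) (-n)

/-- The map on syzygies induced by a chain map. -/
def syzMap {K L : CochainComplex C ℤ} (g : K ⟶ L) (n : ℤ) : syz K n ⟶ syz L n :=
  HomologicalComplex.opcyclesMap g (-n)

instance (K : CochainComplex C ℤ) (n : ℤ) : Epi (syzProj K n) :=
  inferInstanceAs (Epi (K.pOpcycles (-n)))

@[simp] lemma syzProj_syzIncl (K : CochainComplex C ℤ) (n m : ℤ) :
    syzProj K m ≫ syzIncl K n m = K.d (-m) (-n) := K.p_fromOpcycles _ _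

@[simp] lemma syzProj_syzIncl_assoc (K : CochainComplex C ℤ) (n m : ℤ) {A : C}
    (h : K.X (-n) ⟶ A) : syzProj K m ≫ syzIncl K n m ≫ h = K.d (-m) (-n) ≫ h := by
  rw [← Category.assoc, syzProj_syzIncl]

@[simp] lemma d_syzProj (K : CochainComplex C ℤ) (n m : ℤ) :
    K.d (-m) (-n) ≫ syzProj K n = 0 := K.d_pOpcycles _ _

@[simp] lemma syzIncl_syzProj (K : CochainComplex C ℤ) (n m : ℤ) :
    syzIncl K n m ≫ syzProj K n = 0 := by
  rw [← cancel_epi (syzProj K m), syzProj_syzIncl_assoc, d_syzProj, comp_zero]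

@[simp] lemma syzIncl_syzProj_assoc (K : CochainComplex C ℤ) (n m : ℤ) {A : C}
    (h : syz K n ⟶ A) : syzIncl K n m ≫ syzProj K n ≫ h = 0 := by
  rw [← Category.assoc, syzIncl_syzProj, zero_comp]

@[simp] lemma syzProj_syzMap {K L : CochainComplex C ℤ} (g : K ⟶ L) (n : ℤ) :
    syzProj K n ≫ syzMap g n = g.f (-n) ≫ syzProj L n :=
  HomologicalComplex.p_opcyclesMap _ _

@[simp] lemma syzProj_syzMap_assoc {K L : CochainComplex C ℤ} (g : K ⟶ L) (n : ℤ) {A : C}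
    (h : syz L n ⟶ A) : syzProj K n ≫ syzMap g n ≫ h = g.f (-n) ≫ syzProj L n ≫ h := by
  rw [← Category.assoc, syzProj_syzMap, Category.assoc]

lemma syzMap_syzIncl {K L : CochainComplex C ℤ} (g : K ⟶ L) (n m : ℤ) :
    syzMap g m ≫ syzIncl L n m = syzIncl K n m ≫ g.f (-n) := by
  rw [← cancel_epi (syzProj K m), syzProj_syzMap_assoc, syzProj_syzIncl, syzProj_syzIncl_assoc,
    g.comm]

lemma syzMap_id (K : CochainComplex C ℤ) (n : ℤ) : syzMap (𝟙 K) n = 𝟙 _ :=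
  HomologicalComplex.opcyclesMap_id _ _

lemma syzMap_comp {K L L' : CochainComplex C ℤ} (g : K ⟶ L) (g' : L ⟶ L') (n : ℤ) :
    syzMap (g ≫ g') n = syzMap g n ≫ syzMap g' n :=
  HomologicalComplex.opcyclesMap_comp _ _ _

lemma syzMap_zero (K L : CochainComplex C ℤ) (n : ℤ) : syzMap (0 : K ⟶ L) n = 0 :=
  HomologicalComplex.opcyclesMap_zero _ _ _

/-- The difference of the maps induced on syzygies by two homotopic chain maps. -/
lemma syzMap_eq_of_homotopy {K L : CochainComplex C ℤ} {g g' : K ⟶ L} (h : Homotopy g g') (n : ℤ) :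
    syzMap g n = syzIncl K (n - 1) n ≫ h.hom (-(n - 1)) (-n) ≫ syzProj L n + syzMap g' n := by
  rw [← cancel_epi (syzProj K n), Preadditive.comp_add, syzProj_syzMap, syzProj_syzMap,
    syzProj_syzIncl_assoc, h.comm, dNext_eq _ (show (ComplexShape.up ℤ).Rel (-n) (-(n - 1)) by
      simp; lia), prevD_eq _ (show (ComplexShape.up ℤ).Rel (-(n + 1)) (-n) by simp)]
  simp [Preadditive.add_comp]

/-- The sequence `0 ⟶ Ωᵐ ⟶ Kₙ ⟶ Ωⁿ ⟶ 0`, where `m = n + 1`. -/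
def syzSeq (K : CochainComplex C ℤ) (n m : ℤ) : ShortComplex C :=
  ShortComplex.mk (syzIncl K n m) (syzProj K n) (syzIncl_syzProj K n m)

lemma syzIncl_mono {Z : C} (Q : ProjectiveResolution Z) {n m : ℤ} (h : n + 1 = m) (hn : 0 ≤ n) :
    Mono (syzIncl Q.cochainComplex n m) := by
  have hex : Q.cochainComplex.ExactAt (-m) := CochainComplex.exactAt_of_isGE _ 0 _
  rw [HomologicalComplex.exactAt_iff_isZero_homology] at hex
  refine Preadditive.mono_of_isZero_kernel' _
    (Q.cochainComplex.homologyIsKernel (-m) (-n) (by simp; lia)) hex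

lemma syzSeq_shortExact {Z : C} (Q : ProjectiveResolution Z) {n m : ℤ} (h : n + 1 = m)
    (hn : 0 ≤ n) : (syzSeq Q.cochainComplex n m).ShortExact := by
  have := syzIncl_mono Q h hn
  refine { exact := ?_, mono_f := this, epi_g := inferInstanceAs (Epi (syzProj _ _)) }
  have hd : (ShortComplex.mk _ _ (d_syzProj Q.cochainComplex n m)).Exact :=
    ShortComplex.exact_of_g_is_cokernel _
      (Q.cochainComplex.opcyclesIsCokernel (-m) (-n) (by simp; lia))
  rw [ShortComplex.exact_iff_exact_up_to_refinements] at hd ⊢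
  intro A x hx
  obtain ⟨A', π, hπ, y, hy⟩ := hd x hx
  exact ⟨A', π, hπ, (y ≫ syzProj Q.cochainComplex m : A' ⟶ syz Q.cochainComplex m), by
    change _ = (y ≫ syzProj Q.cochainComplex m) ≫ syzIncl Q.cochainComplex n m
    rw [Category.assoc, syzProj_syzIncl]
    exact hy⟩

/-- The map from the zeroth syzygy of a projective resolution to the resolved object. -/
def augSyz {Z : C} (Q : ProjectiveResolution Z) : syz Q.cochainComplex 0 ⟶ Z :=
  Q.cochainComplex.descOpcycles (i := -0) ((Q.cochainComplexXIso (-0) 0).hom ≫ aug Q) (-1) (by simp)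
    (by rw [Q.cochainComplex_d (-1) (-0) 1 0]; simp)

@[simp] lemma syzProj_augSyz {Z : C} (Q : ProjectiveResolution Z) :
    syzProj Q.cochainComplex 0 ≫ augSyz Q = (Q.cochainComplexXIso (-0) 0).hom ≫ aug Q :=
  HomologicalComplex.p_descOpcycles _ _ _ _ _

instance {Z : C} (Q : ProjectiveResolution Z) : Mono (augSyz Q) := by
  refine Preadditive.mono_of_cancel_zero _ fun {A} x hx => ?_
  obtain ⟨A', π, hπ, y, hy⟩ := surjective_up_to_refinements_of_epi (syzProj Q.cochainComplex 0) x
  have h1 : (y ≫ (Q.cochainComplexXIso (-0) 0).hom) ≫ aug Q = 0 := by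
    rw [Category.assoc, ← syzProj_augSyz, ← Category.assoc, ← hy, Category.assoc, hx, comp_zero]
  obtain ⟨A'', π', hπ', z, hz⟩ := (exact_aug Q).exact_up_to_refinements _ h1
  have h2 : π' ≫ y = (z ≫ (Q.cochainComplexXIso (-1) 1).inv) ≫ Q.cochainComplex.d (-1) (-0) := by
    rw [Q.cochainComplex_d (-1) (-0) 1 0, Category.assoc, Iso.inv_hom_id_assoc,
      ← cancel_mono (Q.cochainComplexXIso (-0) 0).hom]
    simpa using hz
  rw [← cancel_epi π, ← cancel_epi π', hy, ← Category.assoc, h2, comp_zero, comp_zero,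
    Category.assoc]
  exact (congrArg _ (d_syzProj _ 0 1)).trans comp_zero

instance {Z : C} (Q : ProjectiveResolution Z) : Epi (augSyz Q) := by
  have : Epi (syzProj Q.cochainComplex 0 ≫ augSyz Q) := by
    rw [syzProj_augSyz]
    exact epi_comp _ _
  exact epi_of_epi (syzProj _ _) _

instance {Z : C} (Q : ProjectiveResolution Z) : IsIso (augSyz Q) := isIso_of_mono_of_epi _

/-- The sequence of `n`-th syzygies of a short complex of complexes. -/
def syzShortComplex (T : ShortComplex (CochainComplex C ℤ)) (n : ℤ) : ShortComplex C :=
  ShortComplex.mk (syzMap T.f n) (syzMap T.g n) (by rw [← syzMap_comp, T.zero, syzMap_zero])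

lemma Horseshoe.syzShortComplex_shortExact {S : ShortComplex C} (hS : S.ShortExact)
    {Q₁ : ProjectiveResolution S.X₁} {Q₃ : ProjectiveResolution S.X₃} (H : Horseshoe S Q₁ Q₃)
    {n : ℤ} (hn : 0 ≤ n) : (syzShortComplex H.shortComplex n).ShortExact := by
  have hT := H.shortComplex_shortExact
  have := hT.epi_g
  refine { exact := HomologicalComplex.opcycles_right_exact _ hT.exact (-n), mono_f := ?_,
           epi_g := inferInstanceAs (Epi (HomologicalComplex.opcyclesMap _ _)) }
  change Mono (syzMap H.shortComplex.f n)
  obtain rfl | hn := hn.eq_or_lt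
  · let F : Q₁.cochainComplex ⟶ H.mid.cochainComplex := HomologicalComplex.extendMap H.f _
    have h : syzMap F 0 ≫ augSyz H.mid = augSyz Q₁ ≫ S.f := by
      rw [← cancel_epi (syzProj _ 0), syzProj_syzMap_assoc, syzProj_augSyz, ← Category.assoc,
        ← Category.assoc (syzProj _ 0), syzProj_augSyz, Category.assoc, Category.assoc, ← H.f_aug,
        ← Category.assoc, ← Category.assoc]
      congr 1
      have h1 : F.f (-0) = (Q₁.cochainComplexXIso (-0) 0).hom ≫ H.f.f 0 ≫
          (H.mid.cochainComplexXIso (-0) 0).inv :=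
        HomologicalComplex.extendMap_f _ _
          (show ComplexShape.embeddingDownNat.f 0 = -0 from rfl)
      rw [h1, Category.assoc, Category.assoc, Iso.inv_hom_id, Category.comp_id]
    have := hS.mono_f
    have : Mono (syzMap F 0 ≫ augSyz H.mid) := by
      rw [h]; exact mono_comp _ _
    have : Mono (syzMap F 0) := mono_of_mono _ (augSyz H.mid)
    exact this
  · have h := syzMap_syzIncl H.shortComplex.f (n - 1) n
    have h1 : Mono (syzIncl H.shortComplex.X₁ (n - 1) n) :=
      syzIncl_mono Q₁ (by lia) (by lia)
    have h2 : Mono (H.shortComplex.f.f (-(n - 1))) := by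
      have := hT.mono_f
      infer_instance
    have : Mono (syzMap H.shortComplex.f n ≫ syzIncl H.shortComplex.X₂ (n - 1) n) := by
      rw [h]; exact mono_comp _ _
    exact mono_of_mono _ (syzIncl H.shortComplex.X₂ (n - 1) n)

end Resolutions2

noncomputable section Families

variable (𝕜 : Type t) [CommRing 𝕜] (C : Type u) [Category.{v} C] [Abelian C]

/-- A `ℤ`-graded family of functors with values in `𝕜`-modules, together with connecting maps for
all short exact sequences. The axioms of a cohomological functor are in `IsCohomological`. -/
structure ConnectedFamily where
  /-- the functor in degree `i` -/
  F : ℤ → C ⥤ ModuleCat.{v} 𝕜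
  /-- the connecting homomorphism from degree `i` to degree `j = i + 1` -/
  δ : ∀ i j : ℤ, i + 1 = j → ∀ S : ShortComplex C, S.ShortExact →
    ((F i).obj S.X₃ ⟶ (F j).obj S.X₁)

namespace ConnectedFamily

variable {𝕜 C}

/-- A cohomological functor: additive functors, natural connecting homomorphisms, and a long exact
sequence for every short exact sequence. -/
structure IsCohomological (T : ConnectedFamily 𝕜 C) : Prop where
  additive : ∀ i, (T.F i).Additive
  δ_naturality : ∀ (i j : ℤ) (hij : i + 1 = j) (S S' : ShortComplex C) (hS : S.ShortExact)
    (hS' : S'.ShortExact) (φ : S ⟶ S'),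
    T.δ i j hij S hS ≫ (T.F j).map φ.τ₁ = (T.F i).map φ.τ₃ ≫ T.δ i j hij S' hS'
  exact₁ : ∀ (i j : ℤ) (hij : i + 1 = j) (S : ShortComplex C) (hS : S.ShortExact),
    Function.Exact (T.δ i j hij S hS) ((T.F j).map S.f)
  exact₂ : ∀ (i : ℤ) (S : ShortComplex C), S.ShortExact →
    Function.Exact ((T.F i).map S.f) ((T.F i).map S.g)
  exact₃ : ∀ (i j : ℤ) (hij : i + 1 = j) (S : ShortComplex C) (hS : S.ShortExact),
    Function.Exact ((T.F i).map S.g) (T.δ i j hij S hS)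

/-- A morphism of families: natural transformations compatible with the connecting maps. -/
@[ext]
structure Hom (T U : ConnectedFamily 𝕜 C) where
  /-- the component in degree `i` -/
  app : ∀ i, T.F i ⟶ U.F i
  comm : ∀ (i j : ℤ) (hij : i + 1 = j) (S : ShortComplex C) (hS : S.ShortExact),
    T.δ i j hij S hS ≫ (app j).app S.X₁ = (app i).app S.X₃ ≫ U.δ i j hij S hS

/-- Composition of morphisms of families. -/
def Hom.comp {T U V : ConnectedFamily 𝕜 C} (τ : T.Hom U) (σ : U.Hom V) : T.Hom V where
  app i := τ.app i ≫ σ.app i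
  comm i j hij S hS := by
    rw [NatTrans.comp_app, NatTrans.comp_app, ← Category.assoc, τ.comm, Category.assoc, σ.comm,
      Category.assoc]

/-- All components of the family vanish on projective objects. -/
def VanishesOnProjectives (T : ConnectedFamily 𝕜 C) : Prop :=
  ∀ (i : ℤ) (N : C), Projective N → IsZero ((T.F i).obj N)

/-- `τ : T ⟶ U` is a P-completion of `T`: the target is a cohomological functor which vanishes on
projective objects, and `τ` is universal among the morphisms to such cohomological functors. -/
structure IsPCompletion {T U : ConnectedFamily 𝕜 C} (τ : T.Hom U) : Prop where
  isCohomological : U.IsCohomological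
  vanishes : U.VanishesOnProjectives
  existsUnique : ∀ V : ConnectedFamily 𝕜 C, V.IsCohomological → V.VanishesOnProjectives →
    ∀ υ : T.Hom V, ∃! σ : U.Hom V, τ.comp σ = υ

end ConnectedFamily
end Families

noncomputable section StableExt

variable (𝕜 : Type t) [CommRing 𝕜] {C : Type u} [Category.{v} C] [Abelian C] [Linear 𝕜 C]

/-- The connecting map of stable cohomology defined by a short exact sequence of projective
resolutions: the snake map of the short exact sequence of quotient complexes. -/
def stableδ (F : CochainComplex C ℤ) {S : ShortComplex C} {Q₁ : ProjectiveResolution S.X₁}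
    {Q₃ : ProjectiveResolution S.X₃} (H : Horseshoe S Q₁ Q₃) (i j : ℤ) (hij : i + 1 = j) :
    (stableHomComplex 𝕜 F Q₃.cochainComplex).homology i ⟶
      (stableHomComplex 𝕜 F Q₁.cochainComplex).homology j :=
  have h : (stableHomShortComplex 𝕜 F H.shortComplex).ShortExact :=
    stableHomShortComplex_shortExact 𝕜 F H.shortComplex fun n =>
      have : Projective (H.shortComplex.map
          (HomologicalComplex.eval C (ComplexShape.up ℤ) n)).X₃ :=
        inferInstanceAs (Projective (Q₃.cochainComplex.X n))
      (H.shortComplex_shortExact.map_of_exact _).splittingOfProjective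
  h.δ i j hij

/-- Vogel's stable cohomology of `M`, the cohomology of the complexes `Hom(P, Q) / Hom̄(P, Q)`, as a
family of functors with connecting maps. -/
def stableExt {M : C} (P : ProjectiveResolution M) (Q : ∀ N : C, ProjectiveResolution N) :
    ConnectedFamily 𝕜 C where
  F i := resolutionFunctor Q
    (fun N => (stableHomComplex 𝕜 P.cochainComplex (Q N).cochainComplex).homology i)
    (fun g => HomologicalComplex.homologyMap (stableHomMap 𝕜 P.cochainComplex g) i)
    (fun N => by rw [stableHomMap_id, HomologicalComplex.homologyMap_id])
    (fun g g' => by rw [stableHomMap_comp, HomologicalComplex.homologyMap_comp])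
    (fun _ _ h => (stableHomHomotopy 𝕜 P.cochainComplex h).homologyMap_eq i)
  δ i j hij S hS := stableδ 𝕜 P.cochainComplex
    (Classical.choice (nonempty_horseshoe hS (Q S.X₁) (Q S.X₃))) i j hij

end StableExt

noncomputable section StableHomModules

variable (𝕜 : Type t) [CommRing 𝕜] {C : Type u} [Category.{v} C] [Abelian C] [Linear 𝕜 C]

/-- The submodule of the morphisms `A ⟶ B` that factor through a projective object. -/
def projFactor (A B : C) : Submodule 𝕜 (A ⟶ B) where
  carrier := {f | ∃ (L : C) (_ : Projective L) (a : A ⟶ L) (b : L ⟶ B), a ≫ b = f}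
  zero_mem' := by
    obtain ⟨Z, hZ⟩ := HasZeroObject.zero (C := C)
    exact ⟨Z, ⟨fun _ _ _ => ⟨0, hZ.eq_of_src _ _⟩⟩, 0, 0, comp_zero⟩
  add_mem' := by
    rintro _ _ ⟨L, hL, a, b, rfl⟩ ⟨L', hL', a', b', rfl⟩
    exact ⟨L ⊞ L', inferInstance, biprod.lift a a', biprod.desc b b', biprod.lift_desc⟩
  smul_mem' := by
    rintro c _ ⟨L, hL, a, b, rfl⟩
    exact ⟨L, hL, a, c • b, Linear.comp_smul _ _ _ _ _ _⟩

variable {𝕜}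

lemma mem_projFactor {A B : C} {f : A ⟶ B} : f ∈ projFactor 𝕜 A B ↔
    ∃ (L : C) (_ : Projective L) (a : A ⟶ L) (b : L ⟶ B), a ≫ b = f := Iff.rfl

lemma comp_mem_projFactor {A B B' : C} {f : A ⟶ B} (hf : f ∈ projFactor 𝕜 A B) (g : B ⟶ B') :
    f ≫ g ∈ projFactor 𝕜 A B' := by
  obtain ⟨L, hL, a, b, rfl⟩ := hf
  exact ⟨L, hL, a, b ≫ g, (Category.assoc _ _ _).symm⟩

variable (𝕜)

/-- The stable `Hom` module: morphisms modulo those which factor through a projective object. -/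
abbrev StableHom (A B : C) : Type v := (A ⟶ B) ⧸ projFactor 𝕜 A B

/-- The class of a morphism in the stable `Hom` module. -/
def StableHom.mk {A B : C} : (A ⟶ B) →ₗ[𝕜] StableHom 𝕜 A B := (projFactor 𝕜 A B).mkQ

variable {𝕜}

lemma StableHom.mk_eq_iff {A B : C} {f g : A ⟶ B} :
    StableHom.mk 𝕜 f = StableHom.mk 𝕜 g ↔ f - g ∈ projFactor 𝕜 A B :=
  Submodule.Quotient.eq _

lemma StableHom.mk_surjective {A B : C} :
    Function.Surjective (StableHom.mk 𝕜 : (A ⟶ B) →ₗ[𝕜] _) := Submodule.mkQ_surjective _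

lemma StableHom.hom_ext {A B : C} {E : ModuleCat.{v} 𝕜}
    {f g : ModuleCat.of 𝕜 (StableHom 𝕜 A B) ⟶ E}
    (h : ∀ a : A ⟶ B, f (StableHom.mk 𝕜 a) = g (StableHom.mk 𝕜 a)) : f = g := by
  apply ModuleCat.hom_ext
  apply Submodule.linearMap_qext
  ext a
  exact h a

variable (𝕜)

/-- Composition with `g : B ⟶ B'` on stable `Hom` modules. -/
def StableHom.postcomp (A : C) {B B' : C} (g : B ⟶ B') :
    ModuleCat.of 𝕜 (StableHom 𝕜 A B) ⟶ ModuleCat.of 𝕜 (StableHom 𝕜 A B') :=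
  ModuleCat.ofHom (Submodule.mapQ (projFactor 𝕜 A B) (projFactor 𝕜 A B')
    (Linear.rightComp 𝕜 A g) fun _ hf => comp_mem_projFactor hf g)

@[simp] lemma StableHom.postcomp_mk (A : C) {B B' : C} (g : B ⟶ B') (f : A ⟶ B) :
    StableHom.postcomp 𝕜 A g (StableHom.mk 𝕜 f) = StableHom.mk 𝕜 (f ≫ g) := rfl

section Connecting

variable {𝕜} (S T : ShortComplex C) [Projective S.X₂]

lemma exists_lift (hT : T.ShortExact) {A : C}
    (x : A ⟶ T.X₂) (hx : x ≫ T.g = 0) : ∃ y : A ⟶ T.X₁, y ≫ T.f = x :=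
  have := hT.mono_f
  ⟨hT.exact.lift x hx, hT.exact.lift_f x hx⟩

lemma exists_connecting (hT : T.ShortExact) (f : S.X₃ ⟶ T.X₃) : ∃ (g : S.X₂ ⟶ T.X₂) (h : S.X₁ ⟶ T.X₁),
    g ≫ T.g = S.g ≫ f ∧ S.f ≫ g = h ≫ T.f := by
  have := hT.epi_g
  have hg : Projective.factorThru (S.g ≫ f) T.g ≫ T.g = S.g ≫ f := Projective.factorThru_comp _ _
  obtain ⟨h, hh⟩ := exists_lift T hT (S.f ≫ Projective.factorThru (S.g ≫ f) T.g) (by simp)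
  exact ⟨_, h, hg, hh.symm⟩

/-- A choice of the middle component of a morphism from `S` to `T` extending `f`. -/
def midLift (hT : T.ShortExact) (f : S.X₃ ⟶ T.X₃) : S.X₂ ⟶ T.X₂ := (exists_connecting S T hT f).choose

/-- A choice of the left component of a morphism from `S` to `T` extending `f`. -/
def leftLift (hT : T.ShortExact) (f : S.X₃ ⟶ T.X₃) : S.X₁ ⟶ T.X₁ := (exists_connecting S T hT f).choose_spec.choose

lemma midLift_comp (hT : T.ShortExact) (f : S.X₃ ⟶ T.X₃) : midLift S T hT f ≫ T.g = S.g ≫ f :=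
  (exists_connecting S T hT f).choose_spec.choose_spec.1

lemma comp_midLift (hT : T.ShortExact) (f : S.X₃ ⟶ T.X₃) : S.f ≫ midLift S T hT f = leftLift S T hT f ≫ T.f :=
  (exists_connecting S T hT f).choose_spec.choose_spec.2

variable {S T}

lemma connecting_mem (hT : T.ShortExact)
    {f : S.X₃ ⟶ T.X₃} (hf : f ∈ projFactor 𝕜 S.X₃ T.X₃) {g : S.X₂ ⟶ T.X₂}
    {h : S.X₁ ⟶ T.X₁} (hg : g ≫ T.g = S.g ≫ f) (hh : S.f ≫ g = h ≫ T.f) :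
    h ∈ projFactor 𝕜 S.X₁ T.X₁ := by
  have := hT.epi_g
  have := hT.mono_f
  obtain ⟨L, hL, a, b, rfl⟩ := hf
  have hb : Projective.factorThru b T.g ≫ T.g = b := Projective.factorThru_comp _ _
  refine ⟨S.X₂, inferInstance, S.f, hT.exact.lift (g - S.g ≫ a ≫ Projective.factorThru b T.g)
    (by simp [hg, hb]), ?_⟩
  rw [← cancel_mono T.f, Category.assoc, hT.exact.lift_f, ← hh]
  simp

variable (𝕜)

/-- The connecting map `[f] ↦ [h]` of stable `Hom` modules, where `h` is part of a morphism
`(h, g, f)` from `S` to the short exact sequence `T`; here the middle term of `S` is projective. -/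
def connecting (hT : T.ShortExact) :
    ModuleCat.of 𝕜 (StableHom 𝕜 S.X₃ T.X₃) ⟶ ModuleCat.of 𝕜 (StableHom 𝕜 S.X₁ T.X₁) :=
  ModuleCat.ofHom ((projFactor 𝕜 S.X₃ T.X₃).liftQ
    { toFun := fun f => StableHom.mk 𝕜 (leftLift S T hT f)
      map_add' := fun f f' => by
        rw [← map_add, StableHom.mk_eq_iff]
        exact connecting_mem hT (S := S) (f := 0) (zero_mem _)
          (g := midLift S T hT (f + f') - (midLift S T hT f + midLift S T hT f'))
          (by simp [midLift_comp]) (by simp [comp_midLift])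
      map_smul' := fun c f => by
        rw [RingHom.id_apply, ← map_smul, StableHom.mk_eq_iff]
        exact connecting_mem hT (S := S) (f := 0) (zero_mem _)
          (g := midLift S T hT (c • f) - c • midLift S T hT f)
          (by simp [midLift_comp]) (by simp [comp_midLift]) }
    fun f hf => (Submodule.Quotient.mk_eq_zero _).2
      (connecting_mem hT hf (midLift_comp S T hT f) (comp_midLift S T hT f)))

lemma connecting_mk (hT : T.ShortExact) {f : S.X₃ ⟶ T.X₃}
    {g : S.X₂ ⟶ T.X₂} {h : S.X₁ ⟶ T.X₁}
    (hg : g ≫ T.g = S.g ≫ f) (hh : S.f ≫ g = h ≫ T.f) :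
    connecting 𝕜 hT (StableHom.mk 𝕜 f) = StableHom.mk 𝕜 h := by
  change StableHom.mk 𝕜 (leftLift S T hT f) = _
  rw [StableHom.mk_eq_iff]
  exact connecting_mem hT (S := S) (f := 0) (zero_mem _) (g := midLift S T hT f - g)
    (by simp [midLift_comp, hg]) (by simp [comp_midLift, hh])

lemma connecting_naturality (hT : T.ShortExact) {T' : ShortComplex C} (hT' : T'.ShortExact) (φ : T ⟶ T') :
    connecting 𝕜 (S := S) hT ≫ StableHom.postcomp 𝕜 S.X₁ φ.τ₁ =
      StableHom.postcomp 𝕜 S.X₃ φ.τ₃ ≫ connecting 𝕜 hT' := by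
  refine StableHom.hom_ext fun f => ?_
  obtain ⟨g, h, hg, hh⟩ := exists_connecting S T hT f
  change StableHom.postcomp 𝕜 S.X₁ φ.τ₁ (connecting 𝕜 hT (StableHom.mk 𝕜 f)) =
    connecting 𝕜 hT' (StableHom.mk 𝕜 (f ≫ φ.τ₃))
  rw [connecting_mk 𝕜 hT hg hh, connecting_mk 𝕜 hT' (g := g ≫ φ.τ₂) (h := h ≫ φ.τ₁)]
  · rfl
  · rw [Category.assoc, φ.comm₂₃, ← Category.assoc, hg, Category.assoc]
  · rw [← Category.assoc, hh, Category.assoc, Category.assoc, φ.comm₁₂]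

end Connecting

instance {Z : C} (P : ProjectiveResolution Z) (n m : ℤ) :
    Projective (syzSeq P.cochainComplex n m).X₂ :=
  inferInstanceAs (Projective (P.cochainComplex.X (-n)))

/-- The connecting maps defined by a short exact sequence of resolutions and those defined by
shifting syzygies anticommute. -/
lemma connecting_anticomm {M : C} (P : ProjectiveResolution M) {S : ShortComplex C}
    (hS : S.ShortExact) {Q₁ : ProjectiveResolution S.X₁} {Q₃ : ProjectiveResolution S.X₃}
    (H : Horseshoe S Q₁ Q₃) (k₀ k₁ k₂ n m : ℤ) (hn : 0 ≤ n) (hm : 0 ≤ m) (h : n + 1 = m)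
    (f : syz P.cochainComplex k₀ ⟶ syz Q₃.cochainComplex n) :
    connecting 𝕜 (S := syzSeq P.cochainComplex k₁ k₂) (H.syzShortComplex_shortExact hS hm)
      (connecting 𝕜 (S := syzSeq P.cochainComplex k₀ k₁) (syzSeq_shortExact Q₃ h hn)
        (StableHom.mk 𝕜 f)) =
    - connecting 𝕜 (S := syzSeq P.cochainComplex k₁ k₂) (syzSeq_shortExact Q₁ h hn)
      (connecting 𝕜 (S := syzSeq P.cochainComplex k₀ k₁) (H.syzShortComplex_shortExact hS hn)
        (StableHom.mk 𝕜 f)) := by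
  let F : Q₁.cochainComplex ⟶ H.mid.cochainComplex := H.shortComplex.f
  let G : H.mid.cochainComplex ⟶ Q₃.cochainComplex := H.shortComplex.g
  have hK := H.shortComplex_shortExact.map_of_exact (HomologicalComplex.eval C _ (-n))
  have hKm : Mono (F.f (-n)) := hK.mono_f
  have hKe : Epi (G.f (-n)) := hK.epi_g
  have hTn := H.syzShortComplex_shortExact hS hn
  have hTm := H.syzShortComplex_shortExact hS hm
  have hTnm : Mono (syzMap F n) := hTn.mono_f
  have hTme : Epi (syzMap G m) := hTm.epi_g
  have h1e := (syzSeq_shortExact Q₃ h hn)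
  have h1m : Mono (syzIncl Q₃.cochainComplex n m) := h1e.mono_f
  let p := syzProj P.cochainComplex k₀
  let ι := syzIncl P.cochainComplex k₀ k₁
  let p' := syzProj P.cochainComplex k₁
  let ι' := syzIncl P.cochainComplex k₁ k₂
  have hιp : ι ≫ p = 0 := syzIncl_syzProj _ _ _
  have hιp' : ι' ≫ p' = 0 := syzIncl_syzProj _ _ _
  let a : P.cochainComplex.X (-k₀) ⟶ H.mid.cochainComplex.X (-n) :=
    Projective.factorThru (p ≫ f) (G.f (-n) ≫ syzProj Q₃.cochainComplex n)
  have ha : a ≫ G.f (-n) ≫ syzProj Q₃.cochainComplex n = p ≫ f := Projective.factorThru_comp _ _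
  have zz : (ι ≫ a ≫ G.f (-n)) ≫ syzProj Q₃.cochainComplex n = 0 := by
    rw [Category.assoc, Category.assoc, ha, ← Category.assoc, hιp, zero_comp]
  obtain ⟨f₁, hf₁⟩ : ∃ f₁ : syz P.cochainComplex k₁ ⟶ syz Q₃.cochainComplex m,
      f₁ ≫ syzIncl Q₃.cochainComplex n m = ι ≫ a ≫ G.f (-n) := exists_lift _ h1e _ zz
  have zz' : (ι ≫ a ≫ syzProj H.mid.cochainComplex n) ≫ syzMap G n = 0 := by
    rw [Category.assoc, Category.assoc, syzProj_syzMap, ha, ← Category.assoc, hιp, zero_comp]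
  obtain ⟨e₁, he₁⟩ : ∃ e₁ : syz P.cochainComplex k₁ ⟶ syz Q₁.cochainComplex n,
      e₁ ≫ syzMap F n = ι ≫ a ≫ syzProj H.mid.cochainComplex n := exists_lift _ hTn _ zz'
  let b : P.cochainComplex.X (-k₁) ⟶ syz H.mid.cochainComplex m :=
    Projective.factorThru (p' ≫ f₁) (syzMap G m)
  have hb : b ≫ syzMap G m = p' ≫ f₁ := Projective.factorThru_comp _ _
  have zz'' : (ι' ≫ b) ≫ syzMap G m = 0 := by
    rw [Category.assoc, hb, ← Category.assoc, hιp', zero_comp]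
  obtain ⟨h₁, hh₁⟩ : ∃ h₁ : syz P.cochainComplex k₂ ⟶ syz Q₁.cochainComplex m,
      h₁ ≫ syzMap F m = ι' ≫ b := exists_lift _ hTm _ zz''
  let e : P.cochainComplex.X (-k₁) ⟶ H.mid.cochainComplex.X (-n) :=
    p' ≫ ι ≫ a - b ≫ syzIncl H.mid.cochainComplex n m
  have he : e ≫ G.f (-n) = 0 := by
    dsimp only [e]
    rw [Preadditive.sub_comp, Category.assoc b, ← syzMap_syzIncl, ← Category.assoc b, hb,
      Category.assoc, Category.assoc, Category.assoc, hf₁, sub_self]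
  obtain ⟨e', he'⟩ : ∃ e' : P.cochainComplex.X (-k₁) ⟶ Q₁.cochainComplex.X (-n),
      e' ≫ F.f (-n) = e := exists_lift _ hK _ he
  have c1 : connecting 𝕜 (S := syzSeq P.cochainComplex k₀ k₁) (syzSeq_shortExact Q₃ h hn)
      (StableHom.mk 𝕜 f) = StableHom.mk 𝕜 f₁ :=
    connecting_mk 𝕜 (S := syzSeq P.cochainComplex k₀ k₁) _ (g := a ≫ G.f (-n))
      ((Category.assoc _ _ _).trans ha) hf₁.symm
  have c2 : connecting 𝕜 (S := syzSeq P.cochainComplex k₁ k₂) hTm (StableHom.mk 𝕜 f₁) =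
      StableHom.mk 𝕜 h₁ :=
    connecting_mk 𝕜 (S := syzSeq P.cochainComplex k₁ k₂) hTm (g := b) hb hh₁.symm
  have c3 : connecting 𝕜 (S := syzSeq P.cochainComplex k₀ k₁) hTn (StableHom.mk 𝕜 f) =
      StableHom.mk 𝕜 e₁ :=
    connecting_mk 𝕜 (S := syzSeq P.cochainComplex k₀ k₁) hTn
      (g := a ≫ syzProj H.mid.cochainComplex n) (by
        change (a ≫ syzProj H.mid.cochainComplex n) ≫ syzMap G n = p ≫ f
        rw [Category.assoc, syzProj_syzMap, ha]) he₁.symm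
  have c4 : connecting 𝕜 (S := syzSeq P.cochainComplex k₁ k₂) (syzSeq_shortExact Q₁ h hn)
      (StableHom.mk 𝕜 e₁) = StableHom.mk 𝕜 (-h₁) := by
    refine connecting_mk 𝕜 (S := syzSeq P.cochainComplex k₁ k₂)
      (T := syzSeq Q₁.cochainComplex n m) _ (g := e') ?_ ?_
    · change e' ≫ syzProj Q₁.cochainComplex n = p' ≫ e₁
      rw [← cancel_mono (syzMap F n), Category.assoc, syzProj_syzMap, ← Category.assoc, he',
        Category.assoc, he₁]
      dsimp only [e]
      rw [Preadditive.sub_comp, Category.assoc b, syzIncl_syzProj, comp_zero, sub_zero]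
      simp only [Category.assoc]
    · change ι' ≫ e' = (-h₁) ≫ syzIncl Q₁.cochainComplex n m
      rw [← cancel_mono (F.f (-n)), Category.assoc, he', Category.assoc, ← syzMap_syzIncl,
        Preadditive.neg_comp, ← Category.assoc h₁, hh₁]
      dsimp only [e]
      rw [Preadditive.comp_sub, ← Category.assoc, hιp', zero_comp, zero_sub, Category.assoc]
  refine (congrArg _ c1).trans (c2.trans ?_)
  refine Eq.trans ?_ (congrArg Neg.neg ((congrArg _ c3).trans c4)).symm
  rw [map_neg]
  exact (neg_neg _).symm

end StableHomModules

noncomputable section BensonCarlson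

variable (𝕜 : Type t) [CommRing 𝕜] {C : Type u} [Category.{v} C] [Abelian C] [Linear 𝕜 C]
  {M : C} (P : ProjectiveResolution M)

/-- The stable `Hom` module of the `k`-th syzygy of `M` and the `n`-th syzygy of a complex. -/
abbrev bcObj (K : CochainComplex C ℤ) (k : ℕ) (n : ℤ) : ModuleCat.{v} 𝕜 :=
  ModuleCat.of 𝕜 (StableHom 𝕜 (syz P.cochainComplex k) (syz K n))

/-- The transition map from the stable `Hom` module of `Ωᵏ M` and `Ωⁿ N` to that of `Ωᵏ⁺¹ M` and
`Ωᵐ N`, where `m = n + 1`. (For `n < 0` the source vanishes.) -/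
def bcTrans {N : C} (Q : ProjectiveResolution N) (k : ℕ) (n m : ℤ) (h : n + 1 = m) :
    bcObj 𝕜 P Q.cochainComplex k n ⟶ bcObj 𝕜 P Q.cochainComplex (k + 1) m :=
  if hn : 0 ≤ n then connecting 𝕜 (S := syzSeq P.cochainComplex k (k + 1 : ℕ))
    (syzSeq_shortExact Q h hn) else 0

lemma bcTrans_of_nonneg {N : C} (Q : ProjectiveResolution N) (k : ℕ) (n m : ℤ) (h : n + 1 = m)
    (hn : 0 ≤ n) : bcTrans 𝕜 P Q k n m h =
      connecting 𝕜 (S := syzSeq P.cochainComplex k (k + 1 : ℕ)) (syzSeq_shortExact Q h hn) :=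
  dif_pos hn

lemma bcTrans_of_neg {N : C} (Q : ProjectiveResolution N) (k : ℕ) (n m : ℤ) (h : n + 1 = m)
    (hn : n < 0) : bcTrans 𝕜 P Q k n m h = 0 := dif_neg (by lia)

/-- The map of stable `Hom` modules induced by a chain map. -/
abbrev bcMap {K L : CochainComplex C ℤ} (g : K ⟶ L) (k : ℕ) (n : ℤ) :
    bcObj 𝕜 P K k n ⟶ bcObj 𝕜 P L k n :=
  StableHom.postcomp 𝕜 (syz P.cochainComplex k) (syzMap g n)

lemma bcTrans_naturality {N N' : C} (Q : ProjectiveResolution N) (Q' : ProjectiveResolution N')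
    (g : Q.cochainComplex ⟶ Q'.cochainComplex) (k : ℕ) (n m : ℤ) (h : n + 1 = m) :
    bcTrans 𝕜 P Q k n m h ≫ bcMap 𝕜 P g (k + 1) m =
      bcMap 𝕜 P g k n ≫ bcTrans 𝕜 P Q' k n m h := by
  by_cases hn : 0 ≤ n
  · rw [bcTrans_of_nonneg _ _ _ _ _ _ _ hn, bcTrans_of_nonneg _ _ _ _ _ _ _ hn]
    exact connecting_naturality 𝕜 (S := syzSeq P.cochainComplex k (k + 1 : ℕ))
      (syzSeq_shortExact Q h hn) (syzSeq_shortExact Q' h hn)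
      { τ₁ := syzMap g m, τ₂ := g.f (-n), τ₃ := syzMap g n
        comm₁₂ := syzMap_syzIncl g n m
        comm₂₃ := (syzProj_syzMap g n).symm }
  · rw [bcTrans_of_neg _ _ _ _ _ _ _ (by lia), bcTrans_of_neg _ _ _ _ _ _ _ (by lia), zero_comp,
      comp_zero]

lemma bcMap_eq_of_homotopy {N N' : C} (Q : ProjectiveResolution N) (Q' : ProjectiveResolution N')
    {g g' : Q.cochainComplex ⟶ Q'.cochainComplex} (h : Homotopy g g') (k : ℕ) (n : ℤ) :
    bcMap 𝕜 P g k n = bcMap 𝕜 P g' k n := by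
  refine StableHom.hom_ext fun f => ?_
  change StableHom.mk 𝕜 (f ≫ syzMap g n) = StableHom.mk 𝕜 (f ≫ syzMap g' n)
  rw [StableHom.mk_eq_iff, ← Preadditive.comp_sub, syzMap_eq_of_homotopy h, add_sub_cancel_right,
    mem_projFactor]
  exact ⟨Q.cochainComplex.X (-(n - 1)), inferInstance, f ≫ syzIncl Q.cochainComplex (n - 1) n,
    h.hom (-(n - 1)) (-n) ≫ syzProj Q'.cochainComplex n, Category.assoc _ _ _⟩

/-- The direct system of the stable `Hom` modules of `Ωᵏ M` and `Ωᵏ⁻ⁱ N`, for `k ≥ 0`. -/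
def bcSystem {N : C} (Q : ProjectiveResolution N) (i : ℤ) : ℕ ⥤ ModuleCat.{v} 𝕜 :=
  Functor.ofSequence (X := fun k : ℕ => bcObj 𝕜 P Q.cochainComplex k (k - i))
    fun k => bcTrans 𝕜 P Q k (k - i) ((k + 1 : ℕ) - i) (by push_cast; ring)

/-- The Benson-Carlson module `colimₖ Hom(Ωᵏ M, Ωᵏ⁻ⁱ N)`. -/
def bcColim {N : C} (Q : ProjectiveResolution N) (i : ℤ) : ModuleCat.{v} 𝕜 :=
  colimit (bcSystem 𝕜 P Q i)

/-- The structure maps of the colimit. -/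
def bcι {N : C} (Q : ProjectiveResolution N) (i : ℤ) (k : ℕ) :
    bcObj 𝕜 P Q.cochainComplex k (k - i) ⟶ bcColim 𝕜 P Q i :=
  colimit.ι (bcSystem 𝕜 P Q i) k

lemma bcTrans_bcι {N : C} (Q : ProjectiveResolution N) (i : ℤ) (k : ℕ) :
    bcTrans 𝕜 P Q k (k - i) ((k + 1 : ℕ) - i) (by push_cast; ring) ≫ bcι 𝕜 P Q i (k + 1) =
      bcι 𝕜 P Q i k := by
  have h := colimit.w (bcSystem 𝕜 P Q i) (homOfLE (Nat.le_add_right k 1))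
  rw [show (bcSystem 𝕜 P Q i).map (homOfLE (Nat.le_add_right k 1)) = _ from
    Functor.ofSequence_map_homOfLE_succ _ k] at h
  exact h

variable {𝕜 P}

lemma bcColim_hom_ext {N : C} {Q : ProjectiveResolution N} {i : ℤ} {A : ModuleCat.{v} 𝕜}
    {f g : bcColim 𝕜 P Q i ⟶ A} (h : ∀ k, bcι 𝕜 P Q i k ≫ f = bcι 𝕜 P Q i k ≫ g) : f = g :=
  colimit.hom_ext h

variable (𝕜 P)

/-- The morphism out of the colimit defined by a compatible family of morphisms. -/
def bcDesc {N : C} (Q : ProjectiveResolution N) (i : ℤ) {A : ModuleCat.{v} 𝕜}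
    (f : ∀ k : ℕ, bcObj 𝕜 P Q.cochainComplex k (k - i) ⟶ A)
    (hf : ∀ k : ℕ, bcTrans 𝕜 P Q k (k - i) ((k + 1 : ℕ) - i) (by push_cast; ring) ≫ f (k + 1) =
      f k) : bcColim 𝕜 P Q i ⟶ A :=
  colimit.desc (bcSystem 𝕜 P Q i) (Cocone.mk A (NatTrans.ofSequence
    (F := bcSystem 𝕜 P Q i) (G := (Functor.const ℕ).obj A) f fun k => by
      rw [show (bcSystem 𝕜 P Q i).map (homOfLE (Nat.le_add_right k 1)) = _ from
        Functor.ofSequence_map_homOfLE_succ _ k]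
      exact (hf k).trans (Category.comp_id _).symm))

@[simp] lemma bcι_bcDesc {N : C} (Q : ProjectiveResolution N) (i : ℤ) {A : ModuleCat.{v} 𝕜}
    (f : ∀ k : ℕ, bcObj 𝕜 P Q.cochainComplex k (k - i) ⟶ A)
    (hf : ∀ k : ℕ, bcTrans 𝕜 P Q k (k - i) ((k + 1 : ℕ) - i) (by push_cast; ring) ≫ f (k + 1) =
      f k) (k : ℕ) : bcι 𝕜 P Q i k ≫ bcDesc 𝕜 P Q i f hf = f k :=
  colimit.ι_desc _ _

/-- The map of Benson-Carlson modules induced by a chain map. -/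
def bcColimMap {N N' : C} (Q : ProjectiveResolution N) (Q' : ProjectiveResolution N')
    (g : Q.cochainComplex ⟶ Q'.cochainComplex) (i : ℤ) : bcColim 𝕜 P Q i ⟶ bcColim 𝕜 P Q' i :=
  bcDesc 𝕜 P Q i (fun k => bcMap 𝕜 P g k (k - i) ≫ bcι 𝕜 P Q' i k) fun k => by
    rw [← Category.assoc, bcTrans_naturality, Category.assoc, bcTrans_bcι]

/-- The connecting map `Hom(Ωᵏ M, Ωⁿ N₃) ⟶ Hom(Ωᵏ⁺¹ M, Ωⁿ N₁)` of stable `Hom` modules. -/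
def bcConn {S : ShortComplex C} (hS : S.ShortExact) {Q₁ : ProjectiveResolution S.X₁}
    {Q₃ : ProjectiveResolution S.X₃} (H : Horseshoe S Q₁ Q₃) (k : ℕ) (n : ℤ) (hn : 0 ≤ n) :
    bcObj 𝕜 P Q₃.cochainComplex k n ⟶ bcObj 𝕜 P Q₁.cochainComplex (k + 1) n :=
  connecting 𝕜 (S := syzSeq P.cochainComplex k (k + 1 : ℕ)) (H.syzShortComplex_shortExact hS hn)

lemma bcTrans_bcConn {S : ShortComplex C} (hS : S.ShortExact) {Q₁ : ProjectiveResolution S.X₁}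
    {Q₃ : ProjectiveResolution S.X₃} (H : Horseshoe S Q₁ Q₃) (k : ℕ) (n m : ℤ) (hn : 0 ≤ n)
    (hm : 0 ≤ m) (h : n + 1 = m) :
    bcTrans 𝕜 P Q₃ k n m h ≫ bcConn 𝕜 P hS H (k + 1) m hm =
      - (bcConn 𝕜 P hS H k n hn ≫ bcTrans 𝕜 P Q₁ (k + 1) n m h) := by
  rw [bcTrans_of_nonneg _ _ _ _ _ _ _ hn, bcTrans_of_nonneg _ _ _ _ _ _ _ hn]
  exact StableHom.hom_ext fun f =>
    connecting_anticomm 𝕜 P hS H k (k + 1 : ℕ) (k + 1 + 1 : ℕ) n m hn hm h f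

lemma bcι_bcColimMap {N N' : C} (Q : ProjectiveResolution N) (Q' : ProjectiveResolution N')
    (g : Q.cochainComplex ⟶ Q'.cochainComplex) (i : ℤ) (k : ℕ) :
    bcι 𝕜 P Q i k ≫ bcColimMap 𝕜 P Q Q' g i = bcMap 𝕜 P g k (k - i) ≫ bcι 𝕜 P Q' i k :=
  bcι_bcDesc _ _ _ _ _ _ _

lemma bcMap_id (K : CochainComplex C ℤ) (k : ℕ) (n : ℤ) : bcMap 𝕜 P (𝟙 K) k n = 𝟙 _ :=
  StableHom.hom_ext fun f => congrArg (StableHom.mk 𝕜)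
    ((congrArg (f ≫ ·) (syzMap_id K n)).trans (Category.comp_id f))

lemma bcMap_comp {K L L' : CochainComplex C ℤ} (g : K ⟶ L) (g' : L ⟶ L') (k : ℕ) (n : ℤ) :
    bcMap 𝕜 P (g ≫ g') k n = bcMap 𝕜 P g k n ≫ bcMap 𝕜 P g' k n :=
  StableHom.hom_ext fun f => congrArg (StableHom.mk 𝕜)
    ((congrArg (f ≫ ·) (syzMap_comp g g' n)).trans (Category.assoc _ _ _).symm)

lemma bcColimMap_id {N : C} (Q : ProjectiveResolution N) (i : ℤ) :
    bcColimMap 𝕜 P Q Q (𝟙 _) i = 𝟙 _ :=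
  bcColim_hom_ext fun k => by
    rw [bcι_bcColimMap, bcMap_id, Category.id_comp, Category.comp_id]

lemma bcColimMap_comp {N N' N'' : C} (Q : ProjectiveResolution N) (Q' : ProjectiveResolution N')
    (Q'' : ProjectiveResolution N'') (g : Q.cochainComplex ⟶ Q'.cochainComplex)
    (g' : Q'.cochainComplex ⟶ Q''.cochainComplex) (i : ℤ) :
    bcColimMap 𝕜 P Q Q'' (g ≫ g') i = bcColimMap 𝕜 P Q Q' g i ≫ bcColimMap 𝕜 P Q' Q'' g' i :=
  bcColim_hom_ext fun k => by
    rw [bcι_bcColimMap, bcMap_comp, ← Category.assoc, bcι_bcColimMap, Category.assoc,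
      Category.assoc, bcι_bcColimMap]

/-- In level `k`, the connecting map of Benson-Carlson cohomology is the connecting map
`Hom(Ωᵏ M, Ωⁿ N₃) ⟶ Hom(Ωᵏ⁺¹ M, Ωⁿ N₁)` of stable `Hom` modules, up to the sign `(-1)ᵏ` which makes
these maps compatible with the transition maps. (For `n < 0` the source vanishes.) -/
def bcδLevel {S : ShortComplex C} (hS : S.ShortExact) {Q₁ : ProjectiveResolution S.X₁}
    {Q₃ : ProjectiveResolution S.X₃} (H : Horseshoe S Q₁ Q₃) (k : ℕ) (n n' : ℤ) (h : n = n') :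
    bcObj 𝕜 P Q₃.cochainComplex k n ⟶ bcObj 𝕜 P Q₁.cochainComplex (k + 1) n' :=
  if hn : 0 ≤ n then
    ((-1) ^ k : ℤ) • (bcConn 𝕜 P hS H k n hn ≫ eqToHom (by rw [h]))
  else 0

lemma bcTrans_bcδLevel {S : ShortComplex C} (hS : S.ShortExact) {Q₁ : ProjectiveResolution S.X₁}
    {Q₃ : ProjectiveResolution S.X₃} (H : Horseshoe S Q₁ Q₃) (k : ℕ) (n n' m m' : ℤ) (h : n = n')
    (h' : m = m') (hnm : n + 1 = m) (hnm' : n' + 1 = m') :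
    bcTrans 𝕜 P Q₃ k n m hnm ≫ bcδLevel 𝕜 P hS H (k + 1) m m' h' =
      bcδLevel 𝕜 P hS H k n n' h ≫ bcTrans 𝕜 P Q₁ (k + 1) n' m' hnm' := by
  subst h h'
  by_cases hn : 0 ≤ n
  · have hm : 0 ≤ m := by lia
    rw [bcδLevel, bcδLevel, dif_pos hn, dif_pos hm, eqToHom_refl, eqToHom_refl, Category.comp_id,
      Category.comp_id, Preadditive.comp_zsmul, Preadditive.zsmul_comp,
      bcTrans_bcConn 𝕜 P hS H k n m hn hm, pow_succ, mul_neg_one, neg_smul, smul_neg, neg_neg]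
  · rw [bcTrans_of_neg _ _ _ _ _ _ _ (by lia), bcδLevel, bcδLevel, dif_neg hn, zero_comp,
      zero_comp]

/-- The connecting map of Benson-Carlson cohomology. -/
def bcδ {S : ShortComplex C} (hS : S.ShortExact) {Q₁ : ProjectiveResolution S.X₁}
    {Q₃ : ProjectiveResolution S.X₃} (H : Horseshoe S Q₁ Q₃) (i j : ℤ) (hij : i + 1 = j) :
    bcColim 𝕜 P Q₃ i ⟶ bcColim 𝕜 P Q₁ j :=
  bcDesc 𝕜 P Q₃ i (fun k => bcδLevel 𝕜 P hS H k (k - i) ((k + 1 : ℕ) - j) (by push_cast; lia) ≫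
    bcι 𝕜 P Q₁ j (k + 1)) fun k => by
    rw [← Category.assoc, bcTrans_bcδLevel 𝕜 P hS H k (k - i) ((k + 1 : ℕ) - j) _ _
      (by push_cast; lia) _ _ (by push_cast; lia), Category.assoc, bcTrans_bcι]

/-- Benson-Carlson cohomology of `M`, as a family of functors with connecting maps. -/
def bcExt (Q : ∀ N : C, ProjectiveResolution N) : ConnectedFamily 𝕜 C where
  F i := resolutionFunctor Q (fun N => bcColim 𝕜 P (Q N) i)
    (fun g => bcColimMap 𝕜 P _ _ g i)
    (fun N => bcColimMap_id 𝕜 P (Q N) i)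
    (fun g g' => bcColimMap_comp 𝕜 P _ _ _ g g' i)
    (fun g g' h => bcColim_hom_ext fun k => by
      rw [bcColimMap, bcColimMap, bcι_bcDesc, bcι_bcDesc, bcMap_eq_of_homotopy 𝕜 P _ _ h])
  δ i j hij S hS := bcδ 𝕜 P hS (Classical.choice (nonempty_horseshoe hS (Q S.X₁) (Q S.X₃))) i j hij

end BensonCarlson

noncomputable section ExtFamily

open Abelian

variable (𝕜 : Type t) [CommRing 𝕜] {C : Type u} [Category.{v} C] [Abelian C] [Linear 𝕜 C]
  [HasExt.{v} C] (M : C)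

/-- The functor `Extⁱ(M, -)`, which is zero for `i < 0`. -/
def extFunctor : ℤ → C ⥤ ModuleCat.{v} 𝕜
  | .ofNat n =>
    { obj := fun N => ModuleCat.of 𝕜 (Ext M N n)
      map := fun f => ModuleCat.ofHom ((Ext.mk₀ f).postcompOfLinear 𝕜 M (add_zero n))
      map_id := fun N => by
        ext x
        exact Ext.comp_mk₀_id x
      map_comp := fun f g => by
        ext x
        change x.comp (Ext.mk₀ (f ≫ g)) (add_zero n) =
          (x.comp (Ext.mk₀ f) (add_zero n)).comp (Ext.mk₀ g) (add_zero n)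
        rw [← Ext.mk₀_comp_mk₀]
        exact (Ext.comp_assoc_of_third_deg_zero _ _ _ _).symm }
  | .negSucc _ => (Functor.const C).obj (ModuleCat.of 𝕜 PUnit)

/-- The connecting homomorphisms of `Ext(M, -)`. -/
def extδ : ∀ i j : ℤ, i + 1 = j → ∀ S : ShortComplex C, S.ShortExact →
    ((extFunctor 𝕜 M i).obj S.X₃ ⟶ (extFunctor 𝕜 M j).obj S.X₁)
  | .ofNat n, .ofNat m, h, _, hS =>
    ModuleCat.ofHom (hS.extClass.postcompOfLinear 𝕜 M (Int.ofNat.inj h : n + 1 = m))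
  | _, _, _, _, _ => 0

/-- The cohomological functor `Ext(M, -)`. -/
def extFamily : ConnectedFamily 𝕜 C where
  F := extFunctor 𝕜 M
  δ := extδ 𝕜 M

lemma isZero_extFunctor_negSucc (n : ℕ) (N : C) : IsZero ((extFunctor 𝕜 M (.negSucc n)).obj N) :=
  ModuleCat.isZero_of_subsingleton (ModuleCat.of 𝕜 PUnit)

instance (n : ℕ) (N : C) : Subsingleton ((extFunctor 𝕜 M (.negSucc n)).obj N) :=
  inferInstanceAs (Subsingleton PUnit)

lemma extFamily_isCohomological : (extFamily 𝕜 M).IsCohomological where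
  additive i := by
    refine ⟨fun {X Y f g} => ?_⟩
    match i with
    | .ofNat n =>
      have key (x : Ext M X n) : x.comp (Ext.mk₀ (f + g)) (add_zero n) =
          x.comp (Ext.mk₀ f) (add_zero n) + x.comp (Ext.mk₀ g) (add_zero n) := by
        rw [Ext.mk₀_add, Ext.comp_add]
      exact ModuleCat.hom_ext (LinearMap.ext key)
    | .negSucc n => exact (isZero_extFunctor_negSucc 𝕜 M n X).eq_of_src _ _
  δ_naturality i j hij S S' hS hS' φ := by
    match i, j, hij with
    | .ofNat n, .ofNat m, h =>
      have h' : n + 1 = m := Int.ofNat.inj h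
      have key (x : Ext M S.X₃ n) : (x.comp hS.extClass h').comp (Ext.mk₀ φ.τ₁) (add_zero m) =
          (x.comp (Ext.mk₀ φ.τ₃) (add_zero n)).comp hS'.extClass h' := by
        rw [Ext.comp_assoc_of_third_deg_zero, ShortComplex.ShortExact.extClass_naturality hS hS' φ,
          Ext.comp_assoc_of_second_deg_zero]
      exact ModuleCat.hom_ext (LinearMap.ext key)
    | .negSucc n, j, h => exact (isZero_extFunctor_negSucc 𝕜 M n S.X₃).eq_of_src _ _
    | .ofNat n, .negSucc m, h => exact absurd h (by simp; lia)
  exact₁ i j hij S hS := by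
    match i, j, hij with
    | .ofNat n, .ofNat m, h =>
      have h' : n + 1 = m := Int.ofNat.inj h
      have key (y : Ext M S.X₃ n) :
          (y.comp hS.extClass h').comp (Ext.mk₀ S.f) (add_zero m) = 0 := by
        rw [Ext.comp_assoc_of_third_deg_zero, hS.extClass_comp, Ext.comp_zero]
      intro x
      refine ⟨fun hx => Ext.covariant_sequence_exact₁ M hS x hx h', ?_⟩
      rintro ⟨y, rfl⟩
      exact key y
    | .negSucc 0, .ofNat 0, h =>
      have hf := hS.mono_f
      have key (x : Ext M S.X₁ 0) (hx : x.comp (Ext.mk₀ S.f) (add_zero 0) = 0) : x = 0 := by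
        obtain ⟨x, rfl⟩ := (Ext.mk₀_bijective M S.X₁).2 x
        rw [Ext.mk₀_comp_mk₀, Ext.mk₀_eq_zero_iff] at hx
        rw [Ext.mk₀_eq_zero_iff]
        exact zero_of_comp_mono S.f hx
      intro x
      refine ⟨fun hx => ⟨0, (map_zero _).trans (key x hx).symm⟩, ?_⟩
      rintro ⟨y, rfl⟩
      exact map_zero _
    | .negSucc n, .negSucc m, h =>
      exact fun x => ⟨fun _ => ⟨0, Subsingleton.elim
        (α := (extFunctor 𝕜 M (.negSucc m)).obj S.X₁) _ _⟩, fun _ => Subsingleton.elim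
        (α := (extFunctor 𝕜 M (.negSucc m)).obj S.X₂) _ _⟩
    | .ofNat n, .negSucc m, h => exact absurd h (by simp; lia)
    | .negSucc (n + 1), .ofNat m, h => exact absurd h (by simp; lia)
    | .negSucc 0, .ofNat (m + 1), h => exact absurd h (by simp; lia)
  exact₂ i S hS := by
    match i with
    | .ofNat n =>
      have key (y : Ext M S.X₁ n) :
          (y.comp (Ext.mk₀ S.f) (add_zero n)).comp (Ext.mk₀ S.g) (add_zero n) = 0 := by
        rw [Ext.comp_assoc_of_third_deg_zero, Ext.mk₀_comp_mk₀, S.zero, Ext.mk₀_zero,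
          Ext.comp_zero]
      intro x
      refine ⟨fun hx => Ext.covariant_sequence_exact₂ M hS x hx, ?_⟩
      rintro ⟨y, rfl⟩
      exact key y
    | .negSucc n =>
      exact fun x => ⟨fun _ => ⟨0, Subsingleton.elim
        (α := (extFunctor 𝕜 M (.negSucc n)).obj S.X₂) _ _⟩, fun _ => Subsingleton.elim
        (α := (extFunctor 𝕜 M (.negSucc n)).obj S.X₃) _ _⟩
  exact₃ i j hij S hS := by
    match i, j, hij with
    | .ofNat n, .ofNat m, h =>
      have h' : n + 1 = m := Int.ofNat.inj h
      have key (y : Ext M S.X₂ n) :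
          (y.comp (Ext.mk₀ S.g) (add_zero n)).comp hS.extClass h' = 0 := by
        rw [Ext.comp_assoc_of_second_deg_zero, hS.comp_extClass, Ext.comp_zero]
      intro x
      refine ⟨fun hx => Ext.covariant_sequence_exact₃ M hS x h' hx, ?_⟩
      rintro ⟨y, rfl⟩
      exact key y
    | .negSucc n, j, h =>
      intro x
      refine ⟨fun _ => ⟨0, Subsingleton.elim
        (α := (extFunctor 𝕜 M (.negSucc n)).obj S.X₃) _ _⟩, fun _ => ?_⟩
      obtain rfl : x = 0 := Subsingleton.elim (α := (extFunctor 𝕜 M (.negSucc n)).obj S.X₃) x 0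
      exact map_zero _
    | .ofNat n, .negSucc m, h => exact absurd h (by simp; lia)

end ExtFamily

noncomputable section Satellites

variable {𝕜 : Type t} [CommRing 𝕜] {C : Type u} [Category.{v} C] [Abelian C]

/-- The left satellite `Sₖ Tᵏ⁺ⁱ (N) = Ker (Tᵏ⁺ⁱ(Ωᵏ N) ⟶ Tᵏ⁺ⁱ(Qₖ₋₁))`, where `Q` is the projective
resolution of `N` and `Q₋₁ = 0`. -/
def satellite (T : ConnectedFamily 𝕜 C) (K : CochainComplex C ℤ) (k : ℕ) (i : ℤ) :
    ModuleCat.{v} 𝕜 :=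
  kernel ((T.F (k + i)).map (syzIncl K (k - 1) k))

/-- The inclusion of the left satellite `Sₖ Tᵏ⁺ⁱ (N)` into `Tᵏ⁺ⁱ(Ωᵏ N)`. -/
def satelliteι (T : ConnectedFamily 𝕜 C) (K : CochainComplex C ℤ) (k : ℕ) (i : ℤ) :
    satellite T K k i ⟶ (T.F (k + i)).obj (syz K k) :=
  kernel.ι _

instance (T : ConnectedFamily 𝕜 C) (K : CochainComplex C ℤ) (k : ℕ) (i : ℤ) :
    Mono (satelliteι T K k i) := inferInstanceAs (Mono (kernel.ι _))

lemma satelliteι_comp (T : ConnectedFamily 𝕜 C) (K : CochainComplex C ℤ) (k : ℕ) (i : ℤ) :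
    satelliteι T K k i ≫ (T.F (k + i)).map (syzIncl K (k - 1) k) = 0 := kernel.condition _

/-- The morphism to a left satellite defined by a morphism to `Tᵏ⁺ⁱ(Ωᵏ N)`. -/
def satelliteLift (T : ConnectedFamily 𝕜 C) (K : CochainComplex C ℤ) (k : ℕ) (i : ℤ)
    {A : ModuleCat.{v} 𝕜} (x : A ⟶ (T.F (k + i)).obj (syz K k))
    (hx : x ≫ (T.F (k + i)).map (syzIncl K (k - 1) k) = 0) : A ⟶ satellite T K k i :=
  kernel.lift _ x hx

lemma satelliteLift_ι (T : ConnectedFamily 𝕜 C) (K : CochainComplex C ℤ) (k : ℕ) (i : ℤ)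
    {A : ModuleCat.{v} 𝕜} (x : A ⟶ (T.F (k + i)).obj (syz K k))
    (hx : x ≫ (T.F (k + i)).map (syzIncl K (k - 1) k) = 0) :
    satelliteLift T K k i x hx ≫ satelliteι T K k i = x := kernel.lift_ι _ _ _

lemma comp_syzIncl_eq_zero_of_eq (T : ConnectedFamily 𝕜 C) (K : CochainComplex C ℤ) (j n n' m : ℤ)
    (h : n = n') {A : ModuleCat.{v} 𝕜} (x : A ⟶ (T.F j).obj (syz K m))
    (hx : x ≫ (T.F j).map (syzIncl K n m) = 0) : x ≫ (T.F j).map (syzIncl K n' m) = 0 := by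
  subst h
  exact hx

variable {T : ConnectedFamily 𝕜 C}

lemma ConnectedFamily.IsCohomological.δ_comp (hT : T.IsCohomological)
    (i j : ℤ) (hij : i + 1 = j) (S : ShortComplex C)
    (hS : S.ShortExact) : T.δ i j hij S hS ≫ (T.F j).map S.f = 0 := by
  ext x
  exact (hT.exact₁ i j hij S hS _).2 ⟨x, rfl⟩

/-- The connecting map of `T` defined by `0 ⟶ Ωᵏ⁺¹ N ⟶ Qₖ ⟶ Ωᵏ N ⟶ 0`. -/
def syzδ (T : ConnectedFamily 𝕜 C) {N : C} (Q : ProjectiveResolution N) (k : ℕ) (i j : ℤ)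
    (hij : i + 1 = j) :
    (T.F i).obj (syz Q.cochainComplex k) ⟶ (T.F j).obj (syz Q.cochainComplex (k + 1 : ℕ)) :=
  T.δ i j hij (syzSeq Q.cochainComplex k (k + 1 : ℕ))
    (syzSeq_shortExact Q (by push_cast; ring) (by positivity))

/-- The transition map from `Sₖ Tᵏ⁺ⁱ (N)` to `Sₖ₊₁ Tᵏ⁺¹⁺ⁱ (N)`, induced by the connecting map. -/
def satelliteTrans (hT : T.IsCohomological) {N : C} (Q : ProjectiveResolution N) (k : ℕ) (i : ℤ) :
    satellite T Q.cochainComplex k i ⟶ satellite T Q.cochainComplex (k + 1) i :=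
  satelliteLift T Q.cochainComplex (k + 1) i
    (satelliteι T Q.cochainComplex k i ≫
      syzδ T Q k (k + i) ((k + 1 : ℕ) + i) (by push_cast; ring)) (by
    apply comp_syzIncl_eq_zero_of_eq T _ _ k _ _ (by push_cast; ring)
    rw [Category.assoc]
    exact (congrArg _ (hT.δ_comp _ _ _ (syzSeq Q.cochainComplex k (k + 1 : ℕ)) _)).trans comp_zero)

/-- The map on left satellites induced by a chain map. -/
def satelliteMap (T : ConnectedFamily 𝕜 C) {K L : CochainComplex C ℤ} (g : K ⟶ L) (k : ℕ) (i : ℤ) :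
    satellite T K k i ⟶ satellite T L k i :=
  satelliteLift T L k i (satelliteι T K k i ≫ (T.F (k + i)).map (syzMap g k)) (by
    rw [Category.assoc, ← Functor.map_comp, syzMap_syzIncl, Functor.map_comp, ← Category.assoc,
      satelliteι_comp, zero_comp])

lemma satelliteMap_ι (T : ConnectedFamily 𝕜 C) {K L : CochainComplex C ℤ} (g : K ⟶ L) (k : ℕ)
    (i : ℤ) : satelliteMap T g k i ≫ satelliteι T L k i =
      satelliteι T K k i ≫ (T.F (k + i)).map (syzMap g k) := satelliteLift_ι _ _ _ _ _ _

lemma satelliteMap_id (T : ConnectedFamily 𝕜 C) (K : CochainComplex C ℤ) (k : ℕ) (i : ℤ) :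
    satelliteMap T (𝟙 K) k i = 𝟙 _ := by
  rw [← cancel_mono (satelliteι T K k i), satelliteMap_ι, syzMap_id, CategoryTheory.Functor.map_id,
    Category.id_comp, Category.comp_id]

lemma satelliteMap_comp (T : ConnectedFamily 𝕜 C) {K L L' : CochainComplex C ℤ} (g : K ⟶ L)
    (g' : L ⟶ L') (k : ℕ) (i : ℤ) :
    satelliteMap T (g ≫ g') k i = satelliteMap T g k i ≫ satelliteMap T g' k i := by
  rw [← cancel_mono (satelliteι T L' k i), satelliteMap_ι, Category.assoc, satelliteMap_ι,
    ← Category.assoc, satelliteMap_ι, syzMap_comp, Functor.map_comp, Category.assoc]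

lemma satelliteMap_eq_of_homotopy (hT : T.IsCohomological) {K L : CochainComplex C ℤ}
    {g g' : K ⟶ L} (h : Homotopy g g')
    (k : ℕ) (i : ℤ) : satelliteMap T g k i = satelliteMap T g' k i := by
  have := hT.additive (k + i)
  rw [← cancel_mono (satelliteι T L k i), satelliteMap_ι, satelliteMap_ι, syzMap_eq_of_homotopy h,
    Functor.map_add, Functor.map_comp, Preadditive.comp_add, ← Category.assoc, satelliteι_comp,
    zero_comp, zero_add]

variable (hT : T.IsCohomological)

lemma satelliteTrans_ι {N : C} (Q : ProjectiveResolution N) (k : ℕ) (i : ℤ) :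
    satelliteTrans hT Q k i ≫ satelliteι T Q.cochainComplex (k + 1) i =
      satelliteι T Q.cochainComplex k i ≫
        syzδ T Q k (k + i) ((k + 1 : ℕ) + i) (by push_cast; ring) :=
  satelliteLift_ι _ _ _ _ _ _

lemma satelliteTrans_naturality {N N' : C} (Q : ProjectiveResolution N)
    (Q' : ProjectiveResolution N') (g : Q.cochainComplex ⟶ Q'.cochainComplex) (k : ℕ) (i : ℤ) :
    satelliteTrans hT Q k i ≫ satelliteMap T g (k + 1) i =
      satelliteMap T g k i ≫ satelliteTrans hT Q' k i := by
  have h := hT.δ_naturality (k + i) ((k + 1 : ℕ) + i) (by push_cast; ring)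
    (syzSeq Q.cochainComplex k (k + 1 : ℕ)) (syzSeq Q'.cochainComplex k (k + 1 : ℕ))
    (syzSeq_shortExact Q (by push_cast; ring) (by positivity))
    (syzSeq_shortExact Q' (by push_cast; ring) (by positivity))
    { τ₁ := syzMap g (k + 1 : ℕ), τ₂ := g.f (-k), τ₃ := syzMap g k
      comm₁₂ := syzMap_syzIncl g k (k + 1 : ℕ)
      comm₂₃ := (syzProj_syzMap g k).symm }
  rw [← cancel_mono (satelliteι T Q'.cochainComplex (k + 1) i), Category.assoc, satelliteMap_ι,
    ← Category.assoc, satelliteTrans_ι, Category.assoc, Category.assoc, satelliteTrans_ι,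
    ← Category.assoc (satelliteMap T g k i), satelliteMap_ι, Category.assoc]
  exact congrArg _ h

/-- The direct system of the left satellites `Sₖ Tᵏ⁺ⁱ (N)`, for `k ≥ 0`. -/
def satelliteSystem {N : C} (Q : ProjectiveResolution N) (i : ℤ) : ℕ ⥤ ModuleCat.{v} 𝕜 :=
  Functor.ofSequence (X := fun k : ℕ => satellite T Q.cochainComplex k i)
    fun k => satelliteTrans hT Q k i

/-- The map of direct systems of left satellites induced by a chain map. -/
def satelliteSystemMap {N N' : C} {Q : ProjectiveResolution N} {Q' : ProjectiveResolution N'}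
    (g : Q.cochainComplex ⟶ Q'.cochainComplex) (i : ℤ) :
    satelliteSystem hT Q i ⟶ satelliteSystem hT Q' i :=
  NatTrans.ofSequence (F := satelliteSystem hT Q i) (G := satelliteSystem hT Q' i)
    (fun k => satelliteMap T g k i) fun k => by
      rw [show (satelliteSystem hT Q i).map (homOfLE (Nat.le_add_right k 1)) = _ from
        Functor.ofSequence_map_homOfLE_succ _ k,
        show (satelliteSystem hT Q' i).map (homOfLE (Nat.le_add_right k 1)) = _ from
        Functor.ofSequence_map_homOfLE_succ _ k]
      exact satelliteTrans_naturality hT Q Q' g k i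

/-- The functor `colimₖ Sₖ Tᵏ⁺ⁱ`. -/
def satelliteColim (Q : ∀ N : C, ProjectiveResolution N) (i : ℤ) : C ⥤ ModuleCat.{v} 𝕜 :=
  resolutionFunctor Q (fun N => colimit (satelliteSystem hT (Q N) i))
    (fun g => colim.map (satelliteSystemMap hT g i))
    (fun N => by
      have h : satelliteSystemMap hT (𝟙 (Q N).cochainComplex) i = 𝟙 _ := by
        ext k : 2
        exact satelliteMap_id T _ k i
      rw [h]
      exact colim.map_id _)
    (fun g g' => by
      have h : satelliteSystemMap hT (g ≫ g') i =
          satelliteSystemMap hT g i ≫ satelliteSystemMap hT g' i := by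
        ext k : 2
        exact satelliteMap_comp T g g' k i
      rw [h]
      exact colim.map_comp _ _)
    (fun g g' hgg' => by
      have h : satelliteSystemMap hT g i = satelliteSystemMap hT g' i := by
        ext k : 2
        exact satelliteMap_eq_of_homotopy hT hgg' k i
      rw [h])

/-- The structure map from `Sₖ Tᵏ⁺ⁱ (N)` to the colimit. -/
def satelliteColimι (Q : ∀ N : C, ProjectiveResolution N) (i : ℤ) (N : C) (k : ℕ) :
    satellite T (Q N).cochainComplex k i ⟶ (satelliteColim hT Q i).obj N :=
  colimit.ι (satelliteSystem hT (Q N) i) k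

/-- The iterated connecting map `Uⁱ(N) ≅ Uⁱ(Ω⁰ N) ⟶ ⋯ ⟶ Uᵏ⁺ⁱ(Ωᵏ N)`. -/
def iterδ (U : ConnectedFamily 𝕜 C) {N : C} (Q : ProjectiveResolution N) (i : ℤ) :
    ∀ k : ℕ, (U.F i).obj N ⟶ (U.F (k + i)).obj (syz Q.cochainComplex k)
  | 0 => (U.F i).map (inv (augSyz Q)) ≫ eqToHom (by simp)
  | k + 1 => iterδ U Q i k ≫ syzδ U Q k (k + i) ((k + 1 : ℕ) + i) (by push_cast; ring)

end Satellites

end StableCohomology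

namespace StableCohomology

/-! ### Linear maps given by their graphs -/

section LinearRelations

/-! A class in stable cohomology is represented by a cochain `φ` of degree `i` that commutes with
the differentials, up to the sign `(-1)ⁱ`, in all high degrees; only its behaviour in high degrees
matters. Such a `φ` induces maps `Ωᵏ M ⟶ Ωᵏ⁻ⁱ N` for large `k`. Consecutive ones correspond under
the transition maps up to `(-1)ⁱ`, so the maps multiplied by `(-1)ⁱᵏ` define one element of the
colimit. Conversely, a map of syzygies lifts to a chain map in higher degrees, because `P` is
projective and `Q` is exact; and if the map factors through a projective, the same lifting process
yields a null-homotopy in high degrees. Hence `ComparisonRel` is the graph of a linear bijection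
(`ComparisonRel.eq_zero`, `ComparisonRel.exists_left`, `ComparisonRel.eq_zero_left`).
`ComparisonRel.connecting` matches the snake map with the Benson-Carlson connecting map.

Each theory supplies one half of the axioms. The long exact sequences come from the short exact
sequences of quotient complexes in stable cohomology. Naturality of the connecting maps is proved
for syzygies (`shift_naturality`, `bcδ_naturality`), where no compatible map between the chosen
middle resolutions is needed. The comparison carries both properties to the other side.

The third part is dimension shifting. On a cohomological functor that vanishes on projectives, the
connecting map of a sequence with projective middle term is bijective. Let `τ : T ⟶ U` be a morphism
to such a functor for which every element of `U` comes from `T` after finitely many shifts, and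
every element of the kernel dies after finitely many shifts. Then a morphism from `T` to another
such functor extends to `U` in exactly one way (`Hom.IsEventuallyBijective.isPCompletion`), and `U`
is the colimit of the left satellites of `T` (`fromSatelliteColim_bijective`).

For `T = Ext(M, -)`, each element of `Extᵏ(M, N)` is the image of the canonical class in `Extᵏ(M, Ωᵏ
M)` under a map `Ωᵏ M ⟶ N`, and a map killing this class factors through a projective. So a class in
degree `0` at `M`, compatible with scalars, defines a morphism out of `Ext(M, -)`
(`exists_hom_extFamily`); the class of the identity is used. A Benson-Carlson class given by `Ωᵏ M ⟶
Ωⁿ N` loses one syzygy of its target per shift, so it comes from `Ext` after `n` shifts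
(`bcExt_eventually_spanRel`). -/

lemma exists_linearMap_of_relation {𝕜 A B : Type*} [CommRing 𝕜] [AddCommGroup A] [Module 𝕜 A]
    [AddCommGroup B] [Module 𝕜 B] (R : A → B → Prop) (total : ∀ x, ∃ y, R x y)
    (add : ∀ x x' y y', R x y → R x' y' → R (x + x') (y + y'))
    (smul : ∀ (c : 𝕜) x y, R x y → R (c • x) (c • y)) (zero : ∀ y, R 0 y → y = 0) :
    ∃ f : A →ₗ[𝕜] B, ∀ x y, R x y → f x = y := by
  -- Two values of `x` differ by a value of `0`, so single-valuedness only has to be assumed at `0`.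
  have uniq : ∀ x y y', R x y → R x y' → y = y' := fun x y y' h h' => by
    have h1 := add _ _ _ _ h (smul (-1) _ _ h')
    rw [neg_one_smul, neg_one_smul, add_neg_cancel] at h1
    exact add_neg_eq_zero.1 (zero _ h1)
  choose f hf using total
  exact ⟨{ toFun := f
           map_add' := fun x x' => uniq _ _ _ (hf _) (add _ _ _ _ (hf x) (hf x'))
           map_smul' := fun c x => uniq _ _ _ (hf _) (smul c _ _ (hf x)) },
    fun x y h => uniq _ _ _ (hf x) h⟩

end LinearRelations

namespace ConnectedFamily

variable {𝕜 : Type t} [CommRing 𝕜] {C : Type u} [Category.{v} C] [Abelian C]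

/-! ### Relations that hold after finitely many dimension shifts -/

section Eventually

/-- A family of relations between the values of two families of functors. -/
abbrev Relation (U V : ConnectedFamily 𝕜 C) :=
  ∀ (i : ℤ) (N : C), (U.F i).obj N → (V.F i).obj N → Prop

/-- The relation that holds between `x` and `y` if `B` holds for all their `n`-fold
dimension shifts. -/
def Eventually {U V : ConnectedFamily 𝕜 C} (B : Relation U V) : ℕ → Relation U V
  | 0, i, N, x, y => B i N x y
  | n + 1, i, N, x, y => ∀ (j : ℤ) (hij : i + 1 = j) (K L : C) (f : K ⟶ L) (g : L ⟶ N)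
      (w : f ≫ g = 0) (hS : (ShortComplex.mk f g w).ShortExact), Projective L →
      Eventually B n j K (U.δ i j hij _ hS x) (V.δ i j hij _ hS y)

/-- A family of relations that is stable under induced maps and connecting maps. -/
structure Relation.IsStable {U V : ConnectedFamily 𝕜 C} (B : Relation U V) : Prop where
  map : ∀ {i : ℤ} {N N' : C} (f : N ⟶ N') {x : (U.F i).obj N} {y : (V.F i).obj N},
    B i N x y → B i N' ((U.F i).map f x) ((V.F i).map f y)
  δ : ∀ {i j : ℤ} (hij : i + 1 = j) {S : ShortComplex C} (hS : S.ShortExact)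
    {x : (U.F i).obj S.X₃} {y : (V.F i).obj S.X₃},
    B i S.X₃ x y → B j S.X₁ (U.δ i j hij S hS x) (V.δ i j hij S hS y)

lemma exists_projective_cover [EnoughProjectives C] (N : C) :
    ∃ (K L : C) (f : K ⟶ L) (g : L ⟶ N) (w : f ≫ g = 0),
      (ShortComplex.mk f g w).ShortExact ∧ Projective L :=
  ⟨_, _, kernel.ι (Projective.π N), Projective.π N, kernel.condition _,
    { exact := ShortComplex.exact_of_f_is_kernel _ (kernelIsKernel _)
      mono_f := inferInstanceAs (Mono (kernel.ι (Projective.π N)))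
      epi_g := inferInstanceAs (Epi (Projective.π N)) }, inferInstance⟩

lemma exists_hom_of_projective {S S' : ShortComplex C} (hS' : S'.ShortExact) (h : Projective S.X₂)
    (f : S.X₃ ⟶ S'.X₃) : ∃ φ : S ⟶ S', φ.τ₃ = f := by
  obtain ⟨g, h, hg, hh⟩ := exists_connecting S S' hS' f
  exact ⟨{ τ₁ := h, τ₂ := g, τ₃ := f, comm₁₂ := hh.symm, comm₂₃ := hg }, rfl⟩

lemma IsCohomological.δ_map_apply {U : ConnectedFamily 𝕜 C} (hU : U.IsCohomological) {i j : ℤ}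
    (hij : i + 1 = j) {S S' : ShortComplex C} (hS : S.ShortExact) (hS' : S'.ShortExact)
    (φ : S ⟶ S') (x : (U.F i).obj S.X₃) :
    U.δ i j hij S' hS' ((U.F i).map φ.τ₃ x) = (U.F j).map φ.τ₁ (U.δ i j hij S hS x) :=
  (congr($(hU.δ_naturality i j hij S S' hS hS' φ) x)).symm

variable {U V : ConnectedFamily 𝕜 C} (hU : U.IsCohomological) (hV : V.IsCohomological)
  {B : Relation U V} (hB : B.IsStable)

include hU hV hB

/-- By induction: `f` extends to a morphism from a projective cover sequence of `N` to the given
sequence over `N'`, and naturality turns a shift of the image into the image of a shift. -/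
lemma Eventually.map [EnoughProjectives C] {n : ℕ} {i : ℤ} {N N' : C} (f : N ⟶ N')
    {x : (U.F i).obj N} {y : (V.F i).obj N} (h : Eventually B n i N x y) :
    Eventually B n i N' ((U.F i).map f x) ((V.F i).map f y) := by
  induction n generalizing i N N' with
  | zero => exact hB.map f h
  | succ n ih =>
    intro j hij K' L' a' b' w' hS' hL'
    obtain ⟨K, L, a, b, w, hS, hL⟩ := exists_projective_cover N
    obtain ⟨φ, hφ⟩ := exists_hom_of_projective (S := ShortComplex.mk a b w) hS' hL f
    subst hφ
    rw [hU.δ_map_apply hij hS hS' φ, hV.δ_map_apply hij hS hS' φ]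
    exact ih φ.τ₁ (h j hij K L a b w hS hL)

/-- The definition quantifies over all sequences with projective middle term, but one suffices: it
maps to every other one over the identity of the right end. -/
lemma Eventually.of_projective_cover [EnoughProjectives C] {n : ℕ} {i j : ℤ} (hij : i + 1 = j)
    {S : ShortComplex C} (hS : S.ShortExact) (hL : Projective S.X₂)
    {x : (U.F i).obj S.X₃} {y : (V.F i).obj S.X₃}
    (h : Eventually B n j S.X₁ (U.δ i j hij S hS x) (V.δ i j hij S hS y)) :
    Eventually B (n + 1) i S.X₃ x y := by
  intro j' hij' K' L' a' b' w' hS' hL'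
  obtain rfl : j = j' := hij.symm.trans hij'
  obtain ⟨φ, hφ⟩ := exists_hom_of_projective (S := S) hS' hL (𝟙 _)
  have h1 := hU.δ_map_apply hij hS hS' φ x
  have h2 := hV.δ_map_apply hij hS hS' φ y
  rw [hφ, CategoryTheory.Functor.map_id, ConcreteCategory.id_apply] at h1 h2
  rw [h1, h2]
  exact h.map hU hV hB φ.τ₁

omit hU hV in
lemma Eventually.succ {n : ℕ} {i : ℤ} {N : C} {x : (U.F i).obj N}
    {y : (V.F i).obj N} (h : Eventually B n i N x y) : Eventually B (n + 1) i N x y := by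
  induction n generalizing i N with
  | zero => exact fun j hij K L f g w hS _ => hB.δ hij hS h
  | succ n ih => exact fun j hij K L f g w hS hL => ih (h j hij K L f g w hS hL)

omit hU hV in
lemma Eventually.mono {n m : ℕ} (hnm : n ≤ m) {i : ℤ} {N : C} {x : (U.F i).obj N}
    {y : (V.F i).obj N} (h : Eventually B n i N x y) : Eventually B m i N x y := by
  induction hnm with
  | refl => exact h
  | step _ ih => exact ih.succ hB

lemma Eventually.δ [EnoughProjectives C] {n : ℕ} {i j : ℤ} (hij : i + 1 = j)
    {S : ShortComplex C} (hS : S.ShortExact) {x : (U.F i).obj S.X₃} {y : (V.F i).obj S.X₃}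
    (h : Eventually B n i S.X₃ x y) :
    Eventually B n j S.X₁ (U.δ i j hij S hS x) (V.δ i j hij S hS y) := by
  cases n with
  | zero => exact hB.δ hij hS h
  | succ n =>
    obtain ⟨K, L, a, b, w, hS', hL⟩ := exists_projective_cover S.X₃
    obtain ⟨φ, hφ⟩ := exists_hom_of_projective (S := ShortComplex.mk a b w) hS hL (𝟙 _)
    have h1 := hU.δ_map_apply hij hS' hS φ x
    have h2 := hV.δ_map_apply hij hS' hS φ y
    rw [hφ, CategoryTheory.Functor.map_id, ConcreteCategory.id_apply] at h1 h2
    rw [h1, h2]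
    -- The middle term of `S` need not be projective, so the shift along a projective cover is
    -- pushed to `S.X₁`. This uses up one shift, which `succ` restores.
    exact ((h j hij K L a b w hS' hL).map hU hV hB φ.τ₁).succ hB

omit hU hV hB

lemma Eventually.add (hadd : ∀ {i N x x' y y'}, B i N x y → B i N x' y' → B i N (x + x') (y + y'))
    {n : ℕ} {i : ℤ} {N : C} {x x' : (U.F i).obj N} {y y' : (V.F i).obj N}
    (h : Eventually B n i N x y) (h' : Eventually B n i N x' y') :
    Eventually B n i N (x + x') (y + y') := by
  induction n generalizing i N with
  | zero => exact hadd h h'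
  | succ n ih =>
    intro j hij K L f g w hS hL
    rw [map_add, map_add]
    exact ih (h j hij K L f g w hS hL) (h' j hij K L f g w hS hL)

lemma Eventually.smul (hsmul : ∀ {i N x y} (c : 𝕜), B i N x y → B i N (c • x) (c • y))
    {n : ℕ} {i : ℤ} {N : C} {x : (U.F i).obj N} {y : (V.F i).obj N} (c : 𝕜)
    (h : Eventually B n i N x y) : Eventually B n i N (c • x) (c • y) := by
  induction n generalizing i N with
  | zero => exact hsmul c h
  | succ n ih =>
    intro j hij K L f g w hS hL
    rw [map_smul, map_smul]
    exact ih (h j hij K L f g w hS hL)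

end Eventually

/-! ### A criterion for P-completions -/

section Completion

lemma IsCohomological.δ_injective {V : ConnectedFamily 𝕜 C} (hV : V.IsCohomological)
    (hP : V.VanishesOnProjectives) {i j : ℤ} (hij : i + 1 = j) {S : ShortComplex C}
    (hS : S.ShortExact) (hL : Projective S.X₂) : Function.Injective (V.δ i j hij S hS) := by
  rw [injective_iff_map_eq_zero]
  intro x hx
  obtain ⟨y, rfl⟩ := (hV.exact₃ i j hij S hS x).1 hx
  have := ModuleCat.subsingleton_of_isZero (hP i S.X₂ hL)
  rw [Subsingleton.elim y 0, map_zero]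

lemma IsCohomological.δ_surjective {V : ConnectedFamily 𝕜 C} (hV : V.IsCohomological)
    (hP : V.VanishesOnProjectives) {i j : ℤ} (hij : i + 1 = j) {S : ShortComplex C}
    (hS : S.ShortExact) (hL : Projective S.X₂) : Function.Surjective (V.δ i j hij S hS) := by
  intro x
  have := ModuleCat.subsingleton_of_isZero (hP j S.X₂ hL)
  exact (hV.exact₁ i j hij S hS x).1 (Subsingleton.elim _ _)

lemma Hom.comm_apply {T U : ConnectedFamily 𝕜 C} (τ : T.Hom U) {i j : ℤ} (hij : i + 1 = j)
    {S : ShortComplex C} (hS : S.ShortExact) (x : (T.F i).obj S.X₃) :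
    (τ.app j).app S.X₁ (T.δ i j hij S hS x) = U.δ i j hij S hS ((τ.app i).app S.X₃ x) :=
  congr($(τ.comm i j hij S hS) x)

lemma Hom.naturality_apply {T U : ConnectedFamily 𝕜 C} (τ : T.Hom U) (i : ℤ) {N N' : C}
    (f : N ⟶ N') (x : (T.F i).obj N) :
    (τ.app i).app N' ((T.F i).map f x) = (U.F i).map f ((τ.app i).app N x) :=
  congr($((τ.app i).naturality f) x)

variable {T U : ConnectedFamily 𝕜 C}

/-- The relation expressing that the first component vanishes. -/
def vanishRel (T : ConnectedFamily 𝕜 C) : Relation T T := fun _ _ x _ => x = 0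

lemma vanishRel_isStable (T : ConnectedFamily 𝕜 C) : (vanishRel T).IsStable where
  map f x _ h := by rw [vanishRel, show x = 0 from h, map_zero]
  δ _ _ _ x _ h := by rw [vanishRel, show x = 0 from h, map_zero]

/-- The relation between two families consisting of the pairs of images of the elements of a third
family. -/
def Hom.spanRel {V : ConnectedFamily 𝕜 C} (τ : T.Hom U) (υ : T.Hom V) : Relation U V :=
  fun i N x y => ∃ s : (T.F i).obj N, (τ.app i).app N s = x ∧ (υ.app i).app N s = y

lemma Hom.spanRel_isStable {V : ConnectedFamily 𝕜 C} (τ : T.Hom U) (υ : T.Hom V) :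
    (τ.spanRel υ).IsStable where
  map f := by
    rintro _ _ ⟨s, rfl, rfl⟩
    exact ⟨_, τ.naturality_apply _ f s, υ.naturality_apply _ f s⟩
  δ hij S hS := by
    rintro _ _ ⟨s, rfl, rfl⟩
    exact ⟨_, τ.comm_apply hij hS s, υ.comm_apply hij hS s⟩

/-- Every element of the target of `τ` comes from the source after sufficiently many dimension
shifts, and every element of the kernel is annihilated by sufficiently many dimension shifts. -/
structure Hom.IsEventuallyBijective (τ : T.Hom U) : Prop where
  surjective : ∀ (i : ℤ) (N : C) (x : (U.F i).obj N), ∃ n, Eventually (τ.spanRel τ) n i N x x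
  injective : ∀ (i : ℤ) (N : C) (s : (T.F i).obj N), (τ.app i).app N s = 0 →
    ∃ n, Eventually (vanishRel T) n i N s s

/-- The value of the extension at `x` is forced: some shift of `x` is `τ s`, the same shift of the
value must be `υ s`, and shifts are bijective on `V`. The relation `Eventually (τ.spanRel υ)`
records this and is shown to be the graph of a linear map. -/
theorem Hom.IsEventuallyBijective.isPCompletion [EnoughProjectives C] {τ : T.Hom U}
    (hτ : τ.IsEventuallyBijective) (hU : U.IsCohomological) (hUP : U.VanishesOnProjectives) :
    IsPCompletion τ := by
  refine ⟨hU, hUP, fun V hV hVP υ => ?_⟩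
  have hB := τ.spanRel_isStable υ
  -- Shifts are injective on `V`, so `υ` annihilates whatever dies after shifting in `T`.
  have kill : ∀ n i N (s : (T.F i).obj N), Eventually (vanishRel T) n i N s s →
      (υ.app i).app N s = 0 := by
    intro n
    induction n with
    | zero =>
      intro i N s h
      rw [show s = 0 from h, map_zero]
    | succ n ih =>
      intro i N s h
      obtain ⟨K, L, a, b, w, hS, hL⟩ := exists_projective_cover N
      refine hV.δ_injective hVP rfl hS hL ?_
      rw [map_zero]
      exact (υ.comm_apply rfl hS s).symm.trans (ih _ _ _ (h _ rfl K L a b w hS hL))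
  -- Single-valuedness: after `n` shifts, `y` becomes `υ s` with `τ s = 0`, which is zero by `kill`.
  have zero : ∀ n i N (y : (V.F i).obj N), Eventually (τ.spanRel υ) n i N 0 y → y = 0 := by
    intro n
    induction n with
    | zero =>
      rintro i N y ⟨s, hs, rfl⟩
      obtain ⟨m, hm⟩ := hτ.injective i N s hs
      exact kill m i N s hm
    | succ n ih =>
      intro i N y h
      obtain ⟨K, L, a, b, w, hS, hL⟩ := exists_projective_cover N
      refine hV.δ_injective hVP rfl hS hL ?_
      have h1 := h _ rfl K L a b w hS hL
      rw [map_zero] at h1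
      rw [map_zero]
      exact ih _ _ _ h1
  -- Existence of a value: surjectivity of the shifts on `V` undoes the shifts one at a time.
  have total : ∀ n i N (x : (U.F i).obj N), Eventually (τ.spanRel τ) n i N x x →
      ∃ y m, Eventually (τ.spanRel υ) m i N x y := by
    intro n
    induction n with
    | zero =>
      rintro i N x ⟨s, rfl, -⟩
      exact ⟨_, 0, s, rfl, rfl⟩
    | succ n ih =>
      intro i N x h
      obtain ⟨K, L, a, b, w, hS, hL⟩ := exists_projective_cover N
      obtain ⟨y', m, hy'⟩ := ih _ _ _ (h _ rfl K L a b w hS hL)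
      obtain ⟨y, rfl⟩ := hV.δ_surjective hVP rfl hS hL y'
      exact ⟨y, m + 1, Eventually.of_projective_cover (S := ShortComplex.mk a b w) hU hV hB rfl
        hS hL hy'⟩
  have ex : ∀ i N, ∃ f : (U.F i).obj N →ₗ[𝕜] (V.F i).obj N,
      ∀ x y, (∃ n, Eventually (τ.spanRel υ) n i N x y) → f x = y := by
    intro i N
    refine exists_linearMap_of_relation _ (fun x => ?_) ?_ ?_ ?_
    · obtain ⟨n, hn⟩ := hτ.surjective i N x
      exact total n i N x hn
    · rintro x x' y y' ⟨n, hn⟩ ⟨n', hn'⟩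
      refine ⟨max n n', Eventually.add ?_ (hn.mono hB (le_max_left _ _))
        (hn'.mono hB (le_max_right _ _))⟩
      rintro i N _ _ _ _ ⟨s, rfl, rfl⟩ ⟨s', rfl, rfl⟩
      exact ⟨s + s', map_add _ _ _, map_add _ _ _⟩
    · rintro c x y ⟨n, hn⟩
      refine ⟨n, Eventually.smul ?_ c hn⟩
      rintro i N _ _ c ⟨s, rfl, rfl⟩
      exact ⟨c • s, map_smul _ _ _, map_smul _ _ _⟩
    · rintro y ⟨n, hn⟩
      exact zero n i N y hn
  have rel : ∀ i N (x : (U.F i).obj N), ∃ y n, Eventually (τ.spanRel υ) n i N x y := by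
    intro i N x
    obtain ⟨n, hn⟩ := hτ.surjective i N x
    exact total n i N x hn
  choose f hf using ex
  let σ : U.Hom V :=
    { app := fun i =>
        { app := fun N => ModuleCat.ofHom (f i N)
          naturality := fun N N' g => by
            ext x
            obtain ⟨y, n, h⟩ := rel i N x
            have h1 : f i N x = y := hf i N x y ⟨n, h⟩
            have h2 := hf i N' _ _ ⟨n, h.map hU hV hB g⟩
            change f i N' ((U.F i).map g x) = (V.F i).map g (f i N x)
            rw [h1, h2] }
      comm := fun i j hij S hS => by
        ext x
        obtain ⟨y, n, h⟩ := rel i S.X₃ x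
        have h1 : f i S.X₃ x = y := hf i S.X₃ x y ⟨n, h⟩
        have h2 := hf j S.X₁ _ _ ⟨n, h.δ hU hV hB hij hS⟩
        change f j S.X₁ (U.δ i j hij S hS x) = V.δ i j hij S hS (f i S.X₃ x)
        rw [h1, h2] }
  refine ⟨σ, ?_, ?_⟩
  · ext i N s
    exact hf i N _ _ ⟨0, s, rfl, rfl⟩
  · intro σ' hσ'
    -- Any other factorization respects the relation, because it commutes with shifts and these are
    -- injective on `V`.
    have key : ∀ n i N x y, Eventually (τ.spanRel υ) n i N x y → (σ'.app i).app N x = y := by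
      intro n
      induction n with
      | zero =>
        rintro i N _ _ ⟨s, rfl, rfl⟩
        rw [← hσ']
        rfl
      | succ n ih =>
        intro i N x y h
        obtain ⟨K, L, a, b, w, hS, hL⟩ := exists_projective_cover N
        refine hV.δ_injective hVP rfl hS hL ?_
        exact (σ'.comm_apply rfl hS x).symm.trans (ih _ _ _ _ (h _ rfl K L a b w hS hL))
    ext i N x
    obtain ⟨y, n, h⟩ := rel i N x
    exact (key n i N x y h).trans (hf i N x y ⟨n, h⟩).symm

end Completion

/-! ### The colimit of the left satellites -/

section SatelliteColimit

lemma isIso_δ {U : ConnectedFamily 𝕜 C} (hU : U.IsCohomological) (hP : U.VanishesOnProjectives)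
    {i j : ℤ} (hij : i + 1 = j) {S : ShortComplex C} (hS : S.ShortExact)
    (hL : Projective S.X₂) : IsIso (U.δ i j hij S hS) :=
  (ConcreteCategory.isIso_iff_bijective _).2
    ⟨hU.δ_injective hP hij hS hL, hU.δ_surjective hP hij hS hL⟩

lemma isIso_iterδ {U : ConnectedFamily 𝕜 C} (hU : U.IsCohomological)
    (hP : U.VanishesOnProjectives) {N : C} (Q : ProjectiveResolution N) (i : ℤ) (k : ℕ) :
    IsIso (iterδ U Q i k) := by
  induction k with
  | zero =>
    rw [iterδ]
    infer_instance
  | succ k ih =>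
    rw [iterδ]
    have : IsIso (syzδ U Q k (k + i) ((k + 1 : ℕ) + i) (by push_cast; ring)) :=
      isIso_δ hU hP _ _ (inferInstanceAs (Projective (Q.cochainComplex.X (-k))))
    infer_instance

lemma syzMap_extendMap_augSyz {N N' : C} {Q : ProjectiveResolution N}
    {Q' : ProjectiveResolution N'} (g : Q.complex ⟶ Q'.complex) (f : N ⟶ N')
    (h : g.f 0 ≫ aug Q' = aug Q ≫ f) :
    syzMap (K := Q.cochainComplex) (L := Q'.cochainComplex)
      (HomologicalComplex.extendMap g ComplexShape.embeddingDownNat) 0 ≫ augSyz Q' =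
        augSyz Q ≫ f := by
  let G : Q.cochainComplex ⟶ Q'.cochainComplex :=
    HomologicalComplex.extendMap g ComplexShape.embeddingDownNat
  have h1 : G.f (-0) = (Q.cochainComplexXIso (-0) 0).hom ≫ g.f 0 ≫
      (Q'.cochainComplexXIso (-0) 0).inv :=
    HomologicalComplex.extendMap_f _ _ (show ComplexShape.embeddingDownNat.f 0 = -0 from rfl)
  change syzMap G 0 ≫ _ = _
  rw [← cancel_epi (syzProj _ 0), syzProj_syzMap_assoc, syzProj_augSyz, h1, Category.assoc,
    Category.assoc, Iso.inv_hom_id_assoc, h, ← Category.assoc, ← Category.assoc,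
    syzProj_augSyz]

lemma syzMap_liftRes_augSyz (Q : ∀ N : C, ProjectiveResolution N) {N N' : C} (f : N ⟶ N') :
    syzMap (liftRes Q f) 0 ≫ augSyz (Q N') = augSyz (Q N) ≫ f :=
  syzMap_extendMap_augSyz _ _ (ProjectiveResolution.lift_commutes_zero _ _ _)

lemma inv_augSyz_syzMap_liftRes (Q : ∀ N : C, ProjectiveResolution N) {N N' : C} (f : N ⟶ N') :
    inv (augSyz (Q N)) ≫ syzMap (liftRes Q f) 0 = f ≫ inv (augSyz (Q N')) := by
  rw [IsIso.inv_comp_eq, ← Category.assoc, ← syzMap_liftRes_augSyz, Category.assoc,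
    IsIso.hom_inv_id, Category.comp_id]

lemma syzδ_naturality {U : ConnectedFamily 𝕜 C} (hU : U.IsCohomological) {N N' : C}
    (Q : ProjectiveResolution N) (Q' : ProjectiveResolution N')
    (g : Q.cochainComplex ⟶ Q'.cochainComplex) (k : ℕ) (i j : ℤ) (hij : i + 1 = j) :
    syzδ U Q k i j hij ≫ (U.F j).map (syzMap g (k + 1 : ℕ)) =
      (U.F i).map (syzMap g k) ≫ syzδ U Q' k i j hij :=
  hU.δ_naturality i j hij (syzSeq Q.cochainComplex k (k + 1 : ℕ))
    (syzSeq Q'.cochainComplex k (k + 1 : ℕ))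
    (syzSeq_shortExact Q (by push_cast; ring) (by positivity))
    (syzSeq_shortExact Q' (by push_cast; ring) (by positivity))
    { τ₁ := syzMap g (k + 1 : ℕ), τ₂ := g.f (-k), τ₃ := syzMap g k
      comm₁₂ := syzMap_syzIncl g k (k + 1 : ℕ)
      comm₂₃ := (syzProj_syzMap g k).symm }

lemma iterδ_naturality {U : ConnectedFamily 𝕜 C} (hU : U.IsCohomological)
    (Q : ∀ N : C, ProjectiveResolution N) {N N' : C} (f : N ⟶ N') (i : ℤ) (k : ℕ) :
    (U.F i).map f ≫ iterδ U (Q N') i k =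
      iterδ U (Q N) i k ≫ (U.F (k + i)).map (syzMap (liftRes Q f) k) := by
  induction k with
  | zero =>
    -- The degrees `0 + i` and `0` are replaced by variables, so that the transports become
    -- identities by substitution.
    have key : ∀ j l (h1 : i = j) (h2 : 0 = l), (U.F i).map (syzMap (liftRes Q f) 0) ≫
        eqToHom (by rw [h1, h2]) = eqToHom (by rw [h1, h2]) ≫
          (U.F j).map (syzMap (liftRes Q f) l) := by
      rintro _ _ rfl rfl
      simp
    rw [iterδ, iterδ, Category.assoc, ← key _ _ (by simp) (by simp), ← Category.assoc,
      ← Functor.map_comp, ← inv_augSyz_syzMap_liftRes, Functor.map_comp, Category.assoc]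
  | succ k ih =>
    rw [iterδ, iterδ, Category.assoc, syzδ_naturality hU (Q N) (Q N') (liftRes Q f),
      ← Category.assoc, ih, Category.assoc]

lemma satelliteTrans_satelliteColimι {T : ConnectedFamily 𝕜 C} (hT : T.IsCohomological)
    (Q : ∀ N : C, ProjectiveResolution N) (i : ℤ) (N : C) (k : ℕ) :
    satelliteTrans hT (Q N) k i ≫ satelliteColimι hT Q i N (k + 1) =
      satelliteColimι hT Q i N k := by
  have h := colimit.w (satelliteSystem hT (Q N) i) (homOfLE (Nat.le_add_right k 1))
  rw [show (satelliteSystem hT (Q N) i).map (homOfLE (Nat.le_add_right k 1)) = _ from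
    Functor.ofSequence_map_homOfLE_succ _ k] at h
  exact h

lemma satelliteColimι_map {T : ConnectedFamily 𝕜 C} (hT : T.IsCohomological)
    (Q : ∀ N : C, ProjectiveResolution N) (i : ℤ) {N N' : C} (f : N ⟶ N') (k : ℕ) :
    satelliteColimι hT Q i N k ≫ (satelliteColim hT Q i).map f =
      satelliteMap T (liftRes Q f) k i ≫ satelliteColimι hT Q i N' k :=
  ι_colimMap _ _

/-- This gives elements of sequential colimits representatives at finite levels. The index category
lies in universe `0` and the modules in universe `v`, hence the shrinking. -/
instance preservesColimit_forget_of_nat (F : ℕ ⥤ ModuleCat.{v} 𝕜) :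
    PreservesColimit F (forget (ModuleCat.{v} 𝕜)) := by
  have : PreservesFilteredColimitsOfSize.{0, 0} (forget AddCommGrpCat.{v}) :=
    preservesFilteredColimitsOfSize_shrink.{0, v, 0, v} _
  have h : PreservesColimit F (forget₂ (ModuleCat.{v} 𝕜) AddCommGrpCat.{v} ⋙ forget _) :=
    inferInstance
  exact h

lemma exists_satelliteColimι_eq {T : ConnectedFamily 𝕜 C} (hT : T.IsCohomological)
    (Q : ∀ N : C, ProjectiveResolution N) (i : ℤ) (N : C)
    (z : (satelliteColim hT Q i).obj N) : ∃ k s, satelliteColimι hT Q i N k s = z :=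
  Concrete.colimit_exists_rep (satelliteSystem hT (Q N) i) z

variable {T U : ConnectedFamily 𝕜 C} (hT : T.IsCohomological) (hU : U.IsCohomological)
  (hP : U.VanishesOnProjectives) (τ : T.Hom U) (Q : ∀ N : C, ProjectiveResolution N)

/-- `τ` carries the last connecting map of `T` to that of `U`, which is the last factor of `iterδ`
at `k + 1` and cancels against its inverse. -/
lemma satelliteTrans_comp_inv_iterδ (i : ℤ) (N : C) (k : ℕ) [IsIso (iterδ U (Q N) i k)]
    [IsIso (iterδ U (Q N) i (k + 1))] :
    satelliteTrans hT (Q N) k i ≫ satelliteι T (Q N).cochainComplex (k + 1) i ≫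
      (τ.app ((k + 1 : ℕ) + i)).app (syz (Q N).cochainComplex (k + 1 : ℕ)) ≫
        inv (iterδ U (Q N) i (k + 1)) =
    satelliteι T (Q N).cochainComplex k i ≫
      (τ.app (k + i)).app (syz (Q N).cochainComplex k) ≫ inv (iterδ U (Q N) i k) := by
  have h : syzδ T (Q N) k (k + i) ((k + 1 : ℕ) + i) (by push_cast; ring) ≫
      (τ.app ((k + 1 : ℕ) + i)).app (syz (Q N).cochainComplex (k + 1 : ℕ)) =
      (τ.app (k + i)).app (syz (Q N).cochainComplex k) ≫
      syzδ U (Q N) k (k + i) ((k + 1 : ℕ) + i) (by push_cast; ring) :=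
    τ.comm _ _ _ (syzSeq (Q N).cochainComplex k (k + 1 : ℕ)) _
  have h' := satelliteTrans_ι hT (Q N) k i
  rw [← Category.assoc, ← Category.assoc, IsIso.comp_inv_eq, h', Category.assoc, h, iterδ]
  simp

/-- The comparison map from the colimit of the left satellites of `T` to a cohomological functor
that vanishes on projective objects. -/
noncomputable def fromSatelliteColim (i : ℤ) (N : C) :
    (satelliteColim hT Q i).obj N ⟶ (U.F i).obj N :=
  have (k : ℕ) := isIso_iterδ hU hP (Q N) i k
  colimit.desc (satelliteSystem hT (Q N) i) (Cocone.mk _ (NatTrans.ofSequence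
    (F := satelliteSystem hT (Q N) i) (G := (Functor.const ℕ).obj ((U.F i).obj N))
    (fun k => satelliteι T (Q N).cochainComplex k i ≫
      (τ.app (k + i)).app (syz (Q N).cochainComplex k) ≫ inv (iterδ U (Q N) i k)) fun k => by
      rw [show (satelliteSystem hT (Q N) i).map (homOfLE (Nat.le_add_right k 1)) = _ from
        Functor.ofSequence_map_homOfLE_succ _ k]
      exact (satelliteTrans_comp_inv_iterδ hT τ Q i N k).trans (Category.comp_id _).symm))

lemma satelliteColimι_fromSatelliteColim_iterδ (i : ℤ) (N : C) (k : ℕ) :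
    satelliteColimι hT Q i N k ≫ fromSatelliteColim hT hU hP τ Q i N ≫ iterδ U (Q N) i k =
      satelliteι T (Q N).cochainComplex k i ≫
        (τ.app (k + i)).app (syz (Q N).cochainComplex k) := by
  have := isIso_iterδ hU hP (Q N) i k
  rw [← Category.assoc, ← IsIso.eq_comp_inv, Category.assoc]
  exact colimit.ι_desc _ _

lemma fromSatelliteColim_naturality (i : ℤ) {N N' : C} (f : N ⟶ N') :
    (satelliteColim hT Q i).map f ≫ fromSatelliteColim hT hU hP τ Q i N' =
      fromSatelliteColim hT hU hP τ Q i N ≫ (U.F i).map f := by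
  refine colimit.hom_ext fun k => ?_
  have := isIso_iterδ hU hP (Q N') i k
  have h := satelliteColimι_fromSatelliteColim_iterδ hT hU hP τ Q i N' k
  have h' := satelliteColimι_fromSatelliteColim_iterδ hT hU hP τ Q i N k
  change satelliteColimι hT Q i N k ≫ _ = satelliteColimι hT Q i N k ≫ _
  rw [← cancel_mono (iterδ U (Q N') i k)]
  simp only [Category.assoc]
  rw [iterδ_naturality hU Q f, ← Category.assoc _ _ ((U.F (k + i)).map _),
    ← Category.assoc _ _ ((U.F (k + i)).map _), h', ← Category.assoc, satelliteColimι_map,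
    Category.assoc, h, ← Category.assoc, satelliteMap_ι, Category.assoc, Category.assoc,
    (τ.app (k + i)).naturality]

include hT in
/-- The iterated connecting map lifts to the next satellite. -/
lemma exists_satelliteι_eq {N : C} (P : ProjectiveResolution N) (k : ℕ) (i : ℤ)
    (s : (T.F (k + i)).obj (syz P.cochainComplex k)) :
    ∃ s' : satellite T P.cochainComplex (k + 1) i,
      satelliteι T P.cochainComplex (k + 1) i s' =
        syzδ T P k (k + i) ((k + 1 : ℕ) + i) (by push_cast; ring) s :=
  ⟨satelliteLift T P.cochainComplex (k + 1) i
    (syzδ T P k (k + i) ((k + 1 : ℕ) + i) (by push_cast; ring))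
    (comp_syzIncl_eq_zero_of_eq T _ _ k _ _ (by push_cast; ring) _
      (hT.δ_comp _ _ _ (syzSeq P.cochainComplex k (k + 1 : ℕ)) _)) s,
    congr($(satelliteLift_ι T P.cochainComplex (k + 1) i _ _) s)⟩

variable {τ}

/-- The syzygy sequences of the resolution have projective middle terms, so they serve as the test
sequences in `Eventually`. An element of the kernel dies after finitely many transition maps; an
element of the target comes from `T` after finitely many shifts. -/
lemma fromSatelliteColim_bijective (hτ : τ.IsEventuallyBijective) (i : ℤ) (N : C) :
    Function.Bijective (fromSatelliteColim hT hU hP τ Q i N) := by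
  have key k s : iterδ U (Q N) i k (fromSatelliteColim hT hU hP τ Q i N
      (satelliteColimι hT Q i N k s)) = (τ.app (k + i)).app _
        (satelliteι T (Q N).cochainComplex k i s) :=
    congr($(satelliteColimι_fromSatelliteColim_iterδ hT hU hP τ Q i N k) s)
  have proj (k : ℕ) : Projective (syzSeq (Q N).cochainComplex k (k + 1 : ℕ)).X₂ :=
    inferInstanceAs (Projective ((Q N).cochainComplex.X (-k)))
  constructor
  · rw [injective_iff_map_eq_zero]
    intro z hz
    obtain ⟨k, s, rfl⟩ := exists_satelliteColimι_eq hT Q i N z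
    have h := key k s
    rw [hz, map_zero] at h
    obtain ⟨n, hn⟩ := hτ.injective _ _ _ h.symm
    clear h hz
    induction n generalizing k with
    | zero =>
      have h0 : satelliteι T (Q N).cochainComplex k i s = 0 := hn
      rw [(injective_iff_map_eq_zero _).1 ((ModuleCat.mono_iff_injective _).1
        (inferInstanceAs (Mono (satelliteι T (Q N).cochainComplex k i)))) s h0, map_zero]
    | succ n ih =>
      have h1 : satelliteColimι hT Q i N (k + 1) (satelliteTrans hT (Q N) k i s) =
        satelliteColimι hT Q i N k s := congr($(satelliteTrans_satelliteColimι hT Q i N k) s)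
      have h2 : satelliteι T (Q N).cochainComplex (k + 1) i (satelliteTrans hT (Q N) k i s) =
        syzδ T (Q N) k (k + i) ((k + 1 : ℕ) + i) (by push_cast; ring)
          (satelliteι T (Q N).cochainComplex k i s) := congr($(satelliteTrans_ι hT (Q N) k i) s)
      rw [← h1]
      refine ih _ _ ?_
      rw [h2]
      exact hn _ _ _ _ _ _ _ _ (proj k)
  · intro x
    suffices ∀ n (k : ℕ), Eventually (τ.spanRel τ) n _ _ (iterδ U (Q N) i k x)
        (iterδ U (Q N) i k x) → ∃ z, fromSatelliteColim hT hU hP τ Q i N z = x by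
      obtain ⟨n, hn⟩ := hτ.surjective _ _ (iterδ U (Q N) i 0 x)
      exact this n 0 hn
    intro n
    induction n with
    | zero =>
      rintro k ⟨s, hs, -⟩
      -- The element `s` need not lie in the satellite, but its image under the next connecting map
      -- always does; hence level `k + 1`.
      obtain ⟨s', hs'⟩ := exists_satelliteι_eq hT (Q N) k i s
      refine ⟨satelliteColimι hT Q i N (k + 1) s', ?_⟩
      have := isIso_iterδ hU hP (Q N) i (k + 1)
      refine ((ConcreteCategory.isIso_iff_bijective (iterδ U (Q N) i (k + 1))).1
        inferInstance).1 ?_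
      rw [key, hs', iterδ]
      change _ = syzδ U (Q N) k (k + i) _ _ (iterδ U (Q N) i k x)
      rw [← hs]
      exact τ.comm_apply (S := syzSeq (Q N).cochainComplex k (k + 1 : ℕ)) _ _ s
    | succ n ih =>
      intro k hn
      refine ih (k + 1) ?_
      exact hn _ (by push_cast; ring) _ _ _ _ _
        (syzSeq_shortExact (Q N) (by push_cast; ring) (by positivity)) (proj k)

include hU hP in
theorem Hom.IsEventuallyBijective.exists_iso_satelliteColim (hτ : τ.IsEventuallyBijective)
    (i : ℤ) : ∃ θ : U.F i ≅ satelliteColim hT Q i, ∀ (N : C) (k : ℕ),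
      satelliteColimι hT Q i N k ≫ θ.inv.app N ≫ iterδ U (Q N) i k =
        satelliteι T (Q N).cochainComplex k i ≫
          (τ.app (k + i)).app (syz (Q N).cochainComplex k) := by
  have (N : C) : IsIso (fromSatelliteColim hT hU hP τ Q i N) :=
    (ConcreteCategory.isIso_iff_bijective _).2 (fromSatelliteColim_bijective hT hU hP Q hτ i N)
  exact ⟨(NatIso.ofComponents (fun N => asIso (fromSatelliteColim hT hU hP τ Q i N))
    fun f => fromSatelliteColim_naturality hT hU hP τ Q i f).symm, fun N k =>
      satelliteColimι_fromSatelliteColim_iterδ hT hU hP τ Q i N k⟩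

end SatelliteColimit

end ConnectedFamily

open ConnectedFamily

/-! ### Representatives of Benson-Carlson classes -/

section BensonCarlsonClasses

variable {𝕜 : Type t} [CommRing 𝕜] {C : Type u} [Category.{v} C] [Abelian C] [Linear 𝕜 C]

lemma connecting_hom {S T : ShortComplex C} [Projective S.X₂] (hT : T.ShortExact) (φ : S ⟶ T) :
    connecting 𝕜 hT (StableHom.mk 𝕜 φ.τ₃) = StableHom.mk 𝕜 φ.τ₁ :=
  connecting_mk 𝕜 hT φ.comm₂₃ φ.comm₁₂.symm

lemma sub_τ₁_mem_projFactor {S T : ShortComplex C} [Projective S.X₂] (hT : T.ShortExact)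
    {φ ψ : S ⟶ T} (h : φ.τ₃ - ψ.τ₃ ∈ projFactor 𝕜 S.X₃ T.X₃) :
    φ.τ₁ - ψ.τ₁ ∈ projFactor 𝕜 S.X₁ T.X₁ := by
  rw [← StableHom.mk_eq_iff] at h ⊢
  rw [← connecting_hom hT, ← connecting_hom hT, h]

lemma precomp_mem_projFactor {A A' B : C} {f : A ⟶ B} (hf : f ∈ projFactor 𝕜 A B) (g : A' ⟶ A) :
    g ≫ f ∈ projFactor 𝕜 A' B := by
  obtain ⟨L, hL, a, b, rfl⟩ := hf
  exact ⟨L, hL, g ≫ a, b, Category.assoc _ _ _⟩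

variable (𝕜) {M : C} (P : ProjectiveResolution M)

section

variable {N : C} (Q : ProjectiveResolution N)

/-- The class in Benson-Carlson cohomology of a morphism `Ωᵏ M ⟶ Ωⁿ N`. -/
noncomputable def bcClass (k : ℕ) (n i : ℤ) (h : k - i = n)
    (f : syz P.cochainComplex k ⟶ syz Q.cochainComplex n) : bcColim 𝕜 P Q i :=
  bcι 𝕜 P Q i k (StableHom.mk 𝕜 (f ≫ eqToHom (by rw [h])))

lemma bcClass_rfl (k : ℕ) (i : ℤ) (f : syz P.cochainComplex k ⟶ syz Q.cochainComplex (k - i)) :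
    bcClass 𝕜 P Q k _ i rfl f = bcι 𝕜 P Q i k (StableHom.mk 𝕜 f) := by
  rw [bcClass, eqToHom_refl, Category.comp_id]

lemma bcClass_add (k : ℕ) (n i : ℤ) (h : k - i = n)
    (f g : syz P.cochainComplex k ⟶ syz Q.cochainComplex n) :
    bcClass 𝕜 P Q k n i h (f + g) = bcClass 𝕜 P Q k n i h f + bcClass 𝕜 P Q k n i h g := by
  subst h
  simp only [bcClass_rfl, map_add]

lemma bcClass_smul (k : ℕ) (n i : ℤ) (h : k - i = n) (c : 𝕜)
    (f : syz P.cochainComplex k ⟶ syz Q.cochainComplex n) :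
    bcClass 𝕜 P Q k n i h (c • f) = c • bcClass 𝕜 P Q k n i h f := by
  subst h
  simp only [bcClass_rfl, map_smul]

lemma bcClass_zsmul (k : ℕ) (n i : ℤ) (h : k - i = n) (c : ℤ)
    (f : syz P.cochainComplex k ⟶ syz Q.cochainComplex n) :
    bcClass 𝕜 P Q k n i h (c • f) = c • bcClass 𝕜 P Q k n i h f := by
  subst h
  simp only [bcClass_rfl, map_zsmul]

lemma bcClass_eq_of_sub_mem {k : ℕ} {n i : ℤ} {h : k - i = n}
    {f g : syz P.cochainComplex k ⟶ syz Q.cochainComplex n} (hfg : f - g ∈ projFactor 𝕜 _ _) :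
    bcClass 𝕜 P Q k n i h f = bcClass 𝕜 P Q k n i h g := by
  subst h
  rw [bcClass_rfl, bcClass_rfl, StableHom.mk_eq_iff.2 hfg]

/-- Any morphism of syzygy sequences computes the transition map, whatever middle component it has.
-/
lemma bcClass_eq_of_hom {k : ℕ} {n m i : ℤ} (h : k - i = n) (h' : (k + 1 : ℕ) - i = m)
    (hn : 0 ≤ n) (φ : syzSeq P.cochainComplex k (k + 1 : ℕ) ⟶ syzSeq Q.cochainComplex n m)
    {f : syz P.cochainComplex k ⟶ syz Q.cochainComplex n} (hf : φ.τ₃ = f)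
    {g : syz P.cochainComplex (k + 1 : ℕ) ⟶ syz Q.cochainComplex m} (hg : φ.τ₁ = g) :
    bcClass 𝕜 P Q (k + 1) m i h' g = bcClass 𝕜 P Q k n i h f := by
  subst h h'
  rw [bcClass_rfl, bcClass_rfl]
  have h1 := bcTrans_bcι 𝕜 P Q i k
  rw [bcTrans_of_nonneg _ _ _ _ _ _ _ hn] at h1
  subst hf hg
  exact (congrArg (bcι 𝕜 P Q i (k + 1)) (connecting_hom
    (S := syzSeq P.cochainComplex k (k + 1 : ℕ)) (syzSeq_shortExact Q (by push_cast; ring) hn)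
    φ)).symm.trans congr($h1 (StableHom.mk 𝕜 φ.τ₃))

lemma bcColimMap_bcClass {N' : C} (Q' : ProjectiveResolution N')
    (g : Q.cochainComplex ⟶ Q'.cochainComplex) {k : ℕ} {n i : ℤ} (h : k - i = n)
    (f : syz P.cochainComplex k ⟶ syz Q.cochainComplex n) :
    bcColimMap 𝕜 P Q Q' g i (bcClass 𝕜 P Q k n i h f) =
      bcClass 𝕜 P Q' k n i h (f ≫ syzMap g n) := by
  subst h
  rw [bcClass_rfl, bcClass_rfl]
  exact congr($(bcι_bcColimMap 𝕜 P Q Q' g i k) (StableHom.mk 𝕜 f))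

lemma bcδ_bcClass {S : ShortComplex C} (hS : S.ShortExact) {Q₁ : ProjectiveResolution S.X₁}
    {Q₃ : ProjectiveResolution S.X₃} (H : Horseshoe S Q₁ Q₃) {i j : ℤ} (hij : i + 1 = j) {k : ℕ}
    {n : ℤ} (h : k - i = n) (h' : (k + 1 : ℕ) - j = n) (hn : 0 ≤ n)
    (φ : syzSeq P.cochainComplex k (k + 1 : ℕ) ⟶ syzShortComplex H.shortComplex n)
    {f : syz P.cochainComplex k ⟶ syz Q₃.cochainComplex n} (hf : φ.τ₃ = f)
    {g : syz P.cochainComplex (k + 1 : ℕ) ⟶ syz Q₁.cochainComplex n} (hg : φ.τ₁ = g) :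
    bcδ 𝕜 P hS H i j hij (bcClass 𝕜 P Q₃ k n i h f) =
      ((-1) ^ k : ℤ) • bcClass 𝕜 P Q₁ (k + 1) n j h' g := by
  subst h
  rw [bcClass_rfl]
  refine (congr($(bcι_bcDesc 𝕜 P Q₃ i _ _ k) (StableHom.mk 𝕜 f))).trans ?_
  have h1 : ∀ n' (hn' : (k : ℤ) - i = n'), bcδLevel 𝕜 P hS H k (k - i) n' hn'
      (StableHom.mk 𝕜 f) = ((-1) ^ k : ℤ) • StableHom.mk 𝕜 (g ≫ eqToHom (by rw [hn'])) := by
    rintro _ rfl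
    rw [bcδLevel, dif_pos hn, eqToHom_refl, eqToHom_refl, Category.comp_id, Category.comp_id]
    subst hf hg
    exact congrArg (fun x : bcObj 𝕜 P Q₁.cochainComplex (k + 1) (k - i) => ((-1) ^ k : ℤ) • x)
      (connecting_hom
      (S := syzSeq P.cochainComplex k (k + 1 : ℕ)) (H.syzShortComplex_shortExact hS hn) φ)
  refine (congrArg (bcι 𝕜 P Q₁ j (k + 1)) (h1 _ h'.symm)).trans ?_
  exact map_zsmul (bcι 𝕜 P Q₁ j (k + 1)).hom _ _

lemma exists_bcClass_eq {i : ℤ} (x : bcColim 𝕜 P Q i) :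
    ∃ (k : ℕ) (n : ℕ) (h : k - i = n) (f : syz P.cochainComplex k ⟶ syz Q.cochainComplex n),
      bcClass 𝕜 P Q k n i h f = x := by
  obtain ⟨k, y, rfl⟩ : ∃ k y, bcι 𝕜 P Q i k y = x :=
    Concrete.colimit_exists_rep (bcSystem 𝕜 P Q i) x
  have key : ∀ m : ℕ, ∃ y', bcι 𝕜 P Q i (k + m) y' = bcι 𝕜 P Q i k y := by
    intro m
    induction m with
    | zero => exact ⟨y, rfl⟩
    | succ m ih =>
      obtain ⟨y', hy'⟩ := ih
      exact ⟨_, (congr($(bcTrans_bcι 𝕜 P Q i (k + m)) y')).trans hy'⟩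
  -- At level `k + i.toNat` the degree of the target syzygy is nonnegative.
  obtain ⟨y', hy'⟩ := key i.toNat
  obtain ⟨f, rfl⟩ := StableHom.mk_surjective y'
  have h : ((k + i.toNat : ℕ) : ℤ) - i = (k + i.toNat - i : ℤ).toNat := by push_cast; lia
  refine ⟨k + i.toNat, (k + i.toNat - i : ℤ).toNat, h, f ≫ eqToHom (by rw [h]), ?_⟩
  rw [← hy', bcClass, Category.assoc, eqToHom_trans, eqToHom_refl, Category.comp_id]

/-- The morphism `Ωᵏ M ⟶ Ωⁿ N` is mapped to a morphism that factors through a projective object by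
the `m`-fold transition map. -/
def Dies : ℕ → ∀ (k n : ℕ), (syz P.cochainComplex k ⟶ syz Q.cochainComplex n) → Prop
  | 0, _, _, f => f ∈ projFactor 𝕜 _ _
  | m + 1, k, n, f => ∃ φ : syzSeq P.cochainComplex k (k + 1 : ℕ) ⟶
      syzSeq Q.cochainComplex n (n + 1 : ℕ), φ.τ₃ = f ∧
      ∃ g : syz P.cochainComplex (k + 1 : ℕ) ⟶ syz Q.cochainComplex (n + 1 : ℕ),
        φ.τ₁ = g ∧ Dies m (k + 1) (n + 1) g

/-- An element that vanishes in a sequential colimit vanishes at a finite level. `Dies` unwinds this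
one transition map at a time, so that later inductions can follow explicit morphisms. -/
lemma exists_dies_of_bcClass_eq_zero {k n : ℕ} {i : ℤ} {h : k - i = n}
    {f : syz P.cochainComplex k ⟶ syz Q.cochainComplex n} (hf : bcClass 𝕜 P Q k n i h f = 0) :
    ∃ m, Dies 𝕜 P Q m k n f := by
  obtain ⟨k', hk', h0⟩ := Concrete.colimit_rep_eq_zero 𝕜 (bcSystem 𝕜 P Q i) k _ hf
  obtain ⟨m, hm⟩ := Nat.exists_eq_add_of_le (leOfHom hk')
  refine ⟨m, ?_⟩
  clear hf
  induction m generalizing k n with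
  | zero =>
    obtain rfl : k' = k := hm
    obtain rfl : hk' = 𝟙 _ := Subsingleton.elim _ _
    rw [CategoryTheory.Functor.map_id] at h0
    have h1 := (Submodule.Quotient.mk_eq_zero _).1 h0
    have h2 := comp_mem_projFactor h1 (eqToHom (by rw [h]) :
      syz Q.cochainComplex (k' - i) ⟶ syz Q.cochainComplex n)
    rwa [Category.assoc, eqToHom_trans, eqToHom_refl, Category.comp_id] at h2
  | succ m ih =>
    obtain ⟨φ, hφ⟩ := exists_hom_of_projective (S := syzSeq P.cochainComplex k (k + 1 : ℕ))
      (S' := syzSeq Q.cochainComplex n (n + 1 : ℕ))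
      (syzSeq_shortExact Q (by push_cast; ring) (by positivity)) inferInstance f
    obtain ⟨g, hg⟩ : ∃ g : syz P.cochainComplex (k + 1 : ℕ) ⟶ syz Q.cochainComplex (n + 1 : ℕ),
      φ.τ₁ = g := ⟨_, rfl⟩
    refine ⟨φ, hφ, g, hg, ih (h := by push_cast; lia) (homOfLE (by lia)) ?_ (by lia)⟩
    have h1 : ∀ y : bcObj 𝕜 P Q.cochainComplex k (k - i), (bcSystem 𝕜 P Q i).map hk' y =
        (bcSystem 𝕜 P Q i).map (homOfLE (by lia) : k + 1 ⟶ k')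
          (bcTrans 𝕜 P Q k (k - i) ((k + 1 : ℕ) - i) (by push_cast; ring) y) := by
      intro y
      rw [show hk' = homOfLE (Nat.le_add_right k 1) ≫ homOfLE (by lia) from Subsingleton.elim _ _,
        Functor.map_comp, show (bcSystem 𝕜 P Q i).map (homOfLE (Nat.le_add_right k 1)) = _ from
        Functor.ofSequence_map_homOfLE_succ _ k]
      rfl
    refine Eq.trans (congrArg _ ?_) ((h1 _).symm.trans h0)
    rw [bcTrans_of_nonneg _ _ _ _ _ _ _ (by lia)]
    -- Stated for free degrees, so that the transports between `k - i` and `n` disappear by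
    -- substitution.
    have key : ∀ n' m' (h : (n : ℤ) = n') (h' : ((n + 1 : ℕ) : ℤ) = m') (h'' : n' + 1 = m')
        (hn : 0 ≤ n'), (StableHom.mk 𝕜 (g ≫ eqToHom (by rw [h'])) :
          StableHom 𝕜 _ (syz Q.cochainComplex m')) =
        connecting 𝕜 (S := syzSeq P.cochainComplex k (k + 1 : ℕ)) (syzSeq_shortExact Q h'' hn)
          (StableHom.mk 𝕜 (f ≫ eqToHom (by rw [h])) :
            StableHom 𝕜 _ (syz Q.cochainComplex n')) := by
      rintro _ _ rfl rfl h'' hn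
      rw [eqToHom_refl, eqToHom_refl, Category.comp_id, Category.comp_id]
      subst hφ hg
      exact (connecting_hom (S := syzSeq P.cochainComplex k (k + 1 : ℕ))
        (syzSeq_shortExact Q h'' hn) φ).symm
    exact key _ _ h.symm (by push_cast; lia) (by push_cast; lia) (by lia)

end

end BensonCarlsonClasses

lemma inv_comp_eq_comp_inv {C : Type*} [Category* C] {A A' B B' : C} {a : A ⟶ A'} {b : B ⟶ B'}
    [IsIso a] [IsIso b] {f : A ⟶ B} {g : A' ⟶ B'} (h : f ≫ b = a ≫ g) :
    inv a ≫ f = g ≫ inv b := by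
  rw [IsIso.inv_comp_eq, ← Category.assoc, IsIso.eq_comp_inv, h]

/-! ### Naturality of the Benson-Carlson connecting maps -/

section BensonCarlsonConnecting

variable (𝕜 : Type t) [CommRing 𝕜] {C : Type u} [Category.{v} C] [Abelian C] [Linear 𝕜 C]

section

variable {S : ShortComplex C} (hS : S.ShortExact) {Q₁ : ProjectiveResolution S.X₁}
  {Q₃ : ProjectiveResolution S.X₃} (H : Horseshoe S Q₁ Q₃)

include hS in
/-- The morphisms `Ωⁿ⁺¹ N₃ ⟶ Ωⁿ N₁` over the identity of `Ωⁿ N₃` are compatible up to the sign `-1`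
with shifting syzygies. -/
lemma shift_add_mem_projFactor {n m l : ℤ} (hn : 0 ≤ n) (hm : 0 ≤ m) (h : n + 1 = m)
    {ψ : syzSeq Q₃.cochainComplex n m ⟶ syzShortComplex H.shortComplex n} (hψ : ψ.τ₃ = 𝟙 _)
    {ω : syz Q₃.cochainComplex m ⟶ syz Q₁.cochainComplex n} (hω : ψ.τ₁ = ω)
    {ψ' : syzSeq Q₃.cochainComplex m l ⟶ syzShortComplex H.shortComplex m} (hψ' : ψ'.τ₃ = 𝟙 _)
    {ω' : syz Q₃.cochainComplex l ⟶ syz Q₁.cochainComplex m} (hω' : ψ'.τ₁ = ω')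
    {χ : syzSeq Q₃.cochainComplex m l ⟶ syzSeq Q₁.cochainComplex n m} (hχ : χ.τ₃ = ω)
    {ω'' : syz Q₃.cochainComplex l ⟶ syz Q₁.cochainComplex m} (hω'' : χ.τ₁ = ω'') :
    ω'' + ω' ∈ projFactor 𝕜 (syz Q₃.cochainComplex l) (syz Q₁.cochainComplex m) := by
  -- Anticommutation is applied to the identity of `Ωⁿ N₃`, with `Q₃` itself as the source
  -- resolution. One order of the two connecting maps yields `ω'`, the other yields `ω''`.
  have key := connecting_anticomm 𝕜 Q₃ hS H n m l n m hn hm h (𝟙 _)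
  have h1 := connecting_hom (𝕜 := 𝕜) (S := syzSeq Q₃.cochainComplex n m)
    (syzSeq_shortExact Q₃ h hn) (𝟙 _)
  have h2 := connecting_hom (𝕜 := 𝕜) (S := syzSeq Q₃.cochainComplex n m)
    (H.syzShortComplex_shortExact hS hn) ψ
  have h3 := connecting_hom (𝕜 := 𝕜) (S := syzSeq Q₃.cochainComplex m l)
    (H.syzShortComplex_shortExact hS hm) ψ'
  have h4 := connecting_hom (𝕜 := 𝕜) (S := syzSeq Q₃.cochainComplex m l)
    (syzSeq_shortExact Q₁ h hn) χ
  rw [hψ] at h2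
  rw [hψ'] at h3
  rw [hχ, ← hω] at h4
  have key' := ((congrArg _ h1).trans h3).symm.trans (key.trans
    (congrArg Neg.neg ((congrArg _ h2).trans h4)))
  rw [hω', hω''] at key'
  rw [← sub_neg_eq_add, ← StableHom.mk_eq_iff, map_neg]
  exact (neg_eq_iff_eq_neg.2 key').symm

/-- The augmentations identify the short exact sequence of `0`-th syzygies with `S`. -/
noncomputable def Horseshoe.augHom :
    syzShortComplex H.shortComplex 0 ⟶ S where
  τ₁ := augSyz Q₁
  τ₂ := augSyz H.mid
  τ₃ := augSyz Q₃
  comm₁₂ := (syzMap_extendMap_augSyz _ _ H.f_aug).symm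
  comm₂₃ := (syzMap_extendMap_augSyz _ _ H.g_aug).symm

/-- The inverse of `Horseshoe.augHom`. -/
noncomputable def Horseshoe.augInv :
    S ⟶ syzShortComplex H.shortComplex 0 where
  τ₁ := (inv (augSyz Q₁) : S.X₁ ⟶ syz Q₁.cochainComplex 0)
  τ₂ := (inv (augSyz H.mid) : S.X₂ ⟶ syz H.mid.cochainComplex 0)
  τ₃ := (inv (augSyz Q₃) : S.X₃ ⟶ syz Q₃.cochainComplex 0)
  comm₁₂ := inv_comp_eq_comp_inv (a := augSyz Q₁) (b := augSyz H.mid) (syzMap_extendMap_augSyz _ _ H.f_aug)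
  comm₂₃ := inv_comp_eq_comp_inv (a := augSyz H.mid) (b := augSyz Q₃) (syzMap_extendMap_augSyz _ _ H.g_aug)

variable {S' : ShortComplex C} (hS' : S'.ShortExact) {Q₁' : ProjectiveResolution S'.X₁}
  {Q₃' : ProjectiveResolution S'.X₃} (H' : Horseshoe S' Q₁' Q₃') (γ : S ⟶ S')
  (a : Q₁.cochainComplex ⟶ Q₁'.cochainComplex) (c : Q₃.cochainComplex ⟶ Q₃'.cochainComplex)
  (ha : syzMap a 0 ≫ augSyz Q₁' = augSyz Q₁ ≫ γ.τ₁)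
  (hc : syzMap c 0 ≫ augSyz Q₃' = augSyz Q₃ ≫ γ.τ₃)

/-- The morphism of short exact sequences of syzygies induced by a chain map. -/
noncomputable def syzSeqMap {K L : CochainComplex C ℤ} (g : K ⟶ L) (n m : ℤ) :
    syzSeq K n m ⟶ syzSeq L n m where
  τ₁ := syzMap g m
  τ₂ := g.f (-n)
  τ₃ := syzMap g n
  comm₁₂ := syzMap_syzIncl g n m
  comm₂₃ := (syzProj_syzMap g n).symm

-- The two horseshoes are unrelated, so no chain map between their middle terms is available. For `n
-- = 0` the augmentations identify the syzygy sequences with `S` and `S'`, and `γ` takes the place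
-- of such a map. The induction step uses that, up to sign and maps through projectives, the next
-- `ω` is the shift of the previous one, and that shifting respects chain maps.
include hS hS' ha hc in
lemma shift_naturality (n : ℕ)
    {ψ : syzSeq Q₃.cochainComplex n (n + 1 : ℕ) ⟶ syzShortComplex H.shortComplex n}
    (hψ : ψ.τ₃ = 𝟙 _)
    {ω : syz Q₃.cochainComplex (n + 1 : ℕ) ⟶ syz Q₁.cochainComplex n} (hω : ψ.τ₁ = ω)
    {ψ' : syzSeq Q₃'.cochainComplex n (n + 1 : ℕ) ⟶ syzShortComplex H'.shortComplex n}
    (hψ' : ψ'.τ₃ = 𝟙 _)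
    {ω' : syz Q₃'.cochainComplex (n + 1 : ℕ) ⟶ syz Q₁'.cochainComplex n} (hω' : ψ'.τ₁ = ω') :
    ω ≫ syzMap a n - syzMap c (n + 1 : ℕ) ≫ ω' ∈ projFactor 𝕜 _ _ := by
  induction n with
  | zero =>
    have h := sub_τ₁_mem_projFactor (𝕜 := 𝕜) (S := syzSeq Q₃.cochainComplex (0 : ℕ) (0 + 1 : ℕ))
      hS' (φ := ψ ≫ H.augHom ≫ γ) (ψ := syzSeqMap c (0 : ℕ) (0 + 1 : ℕ) ≫ ψ' ≫ H'.augHom) (by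
        have : (ψ ≫ H.augHom ≫ γ).τ₃ =
            (syzSeqMap c (0 : ℕ) (0 + 1 : ℕ) ≫ ψ' ≫ H'.augHom).τ₃ := by
          change ψ.τ₃ ≫ augSyz Q₃ ≫ γ.τ₃ = syzMap c 0 ≫ ψ'.τ₃ ≫ augSyz Q₃'
          rw [hψ, hψ']
          refine (Category.id_comp _).trans (hc.symm.trans ?_)
          exact congrArg _ (Category.id_comp _).symm
        rw [this, sub_self]
        exact zero_mem _)
    have h' : (ω ≫ augSyz Q₁ ≫ γ.τ₁ - syzMap c (0 + 1 : ℕ) ≫ ω' ≫ augSyz Q₁') ∈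
        projFactor 𝕜 _ _ := by
      subst hω hω'
      exact h
    have h'' := comp_mem_projFactor h' (inv (augSyz Q₁'))
    rw [← ha] at h''
    simp only [Preadditive.sub_comp, Category.assoc, IsIso.hom_inv_id, Category.comp_id] at h''
    exact h''
  | succ n ih =>
    have hn : (0 : ℤ) ≤ n := by positivity
    have hn1 : (0 : ℤ) ≤ (n + 1 : ℕ) := by positivity
    have hnm : (n : ℤ) + 1 = (n + 1 : ℕ) := by push_cast; ring
    have hml : ((n + 1 : ℕ) : ℤ) + 1 = (n + 1 + 1 : ℕ) := by push_cast; ring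
    obtain ⟨ψ₀, hψ₀⟩ := exists_hom_of_projective
      (S := syzSeq Q₃.cochainComplex n (n + 1 : ℕ)) (H.syzShortComplex_shortExact hS hn)
      inferInstance (𝟙 _)
    obtain ⟨ψ₀', hψ₀'⟩ := exists_hom_of_projective
      (S := syzSeq Q₃'.cochainComplex n (n + 1 : ℕ)) (H'.syzShortComplex_shortExact hS' hn)
      inferInstance (𝟙 _)
    obtain ⟨ω₀, hω₀⟩ : ∃ ω₀ : syz Q₃.cochainComplex (n + 1 : ℕ) ⟶ syz Q₁.cochainComplex n,
      ψ₀.τ₁ = ω₀ := ⟨_, rfl⟩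
    obtain ⟨ω₀', hω₀'⟩ : ∃ ω₀' : syz Q₃'.cochainComplex (n + 1 : ℕ) ⟶ syz Q₁'.cochainComplex n,
      ψ₀'.τ₁ = ω₀' := ⟨_, rfl⟩
    obtain ⟨χ, hχ⟩ := exists_hom_of_projective
      (S := syzSeq Q₃.cochainComplex (n + 1 : ℕ) (n + 1 + 1 : ℕ))
      (syzSeq_shortExact Q₁ hnm hn) inferInstance ω₀
    obtain ⟨χ', hχ'⟩ := exists_hom_of_projective
      (S := syzSeq Q₃'.cochainComplex (n + 1 : ℕ) (n + 1 + 1 : ℕ))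
      (syzSeq_shortExact Q₁' hnm hn) inferInstance ω₀'
    obtain ⟨ω₁, hω₁⟩ : ∃ ω₁ : syz Q₃.cochainComplex (n + 1 + 1 : ℕ) ⟶
      syz Q₁.cochainComplex (n + 1 : ℕ), χ.τ₁ = ω₁ := ⟨_, rfl⟩
    obtain ⟨ω₁', hω₁'⟩ : ∃ ω₁' : syz Q₃'.cochainComplex (n + 1 + 1 : ℕ) ⟶
      syz Q₁'.cochainComplex (n + 1 : ℕ), χ'.τ₁ = ω₁' := ⟨_, rfl⟩
    have e := shift_add_mem_projFactor 𝕜 hS H hn hn1 hnm hψ₀ hω₀ hψ hω hχ hω₁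
    have e' := shift_add_mem_projFactor 𝕜 hS' H' hn hn1 hnm hψ₀' hω₀' hψ' hω' hχ' hω₁'
    have h := sub_τ₁_mem_projFactor (𝕜 := 𝕜)
      (S := syzSeq Q₃.cochainComplex (n + 1 : ℕ) (n + 1 + 1 : ℕ))
      (syzSeq_shortExact Q₁' hnm hn)
      (φ := χ ≫ syzSeqMap a n (n + 1 : ℕ))
      (ψ := syzSeqMap c (n + 1 : ℕ) (n + 1 + 1 : ℕ) ≫ χ') (by
        rw [ShortComplex.comp_τ₃, ShortComplex.comp_τ₃, hχ, hχ']
        exact ih hψ₀ hω₀ hψ₀' hω₀')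
    rw [ShortComplex.comp_τ₁, ShortComplex.comp_τ₁, hω₁, hω₁'] at h
    have h' : ω₁ ≫ syzMap a (n + 1 : ℕ) - syzMap c (n + 1 + 1 : ℕ) ≫ ω₁' ∈ projFactor 𝕜 _ _ := h
    -- In this combination of the two sign relations and the shifted induction hypothesis the terms
    -- with `ω₁` and `ω₁'` cancel.
    have := sub_mem (sub_mem (comp_mem_projFactor e (syzMap a (n + 1 : ℕ)))
      (precomp_mem_projFactor e' (syzMap c (n + 1 + 1 : ℕ)))) h'
    convert this using 1
    simp only [Preadditive.add_comp, Preadditive.comp_add]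
    abel

end

variable {M : C} (P : ProjectiveResolution M)

/-- The morphism defining the connecting map may be taken through the syzygy sequence of `Q₃`. The
connecting map is then, up to sign, the transition `f ↦ g` followed by composition with the fixed
map `ω`, which does not depend on `M`. -/
lemma bcδ_bcClass_eq_shift {S : ShortComplex C} (hS : S.ShortExact)
    {Q₁ : ProjectiveResolution S.X₁} {Q₃ : ProjectiveResolution S.X₃} (H : Horseshoe S Q₁ Q₃)
    {i j : ℤ} (hij : i + 1 = j) {k n : ℕ} (h : k - i = n) (h' : (k + 1 : ℕ) - j = n)
    {ψ : syzSeq Q₃.cochainComplex n (n + 1 : ℕ) ⟶ syzShortComplex H.shortComplex n}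
    (hψ : ψ.τ₃ = 𝟙 _)
    {ω : syz Q₃.cochainComplex (n + 1 : ℕ) ⟶ syz Q₁.cochainComplex n} (hω : ψ.τ₁ = ω)
    (φ : syzSeq P.cochainComplex k (k + 1 : ℕ) ⟶ syzSeq Q₃.cochainComplex n (n + 1 : ℕ))
    {f : syz P.cochainComplex k ⟶ syz Q₃.cochainComplex n} (hf : φ.τ₃ = f)
    {g : syz P.cochainComplex (k + 1 : ℕ) ⟶ syz Q₃.cochainComplex (n + 1 : ℕ)} (hg : φ.τ₁ = g) :
    bcδ 𝕜 P hS H i j hij (bcClass 𝕜 P Q₃ k n i h f) =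
      ((-1) ^ k : ℤ) • bcClass 𝕜 P Q₁ (k + 1) n j h' (g ≫ ω) := by
  refine bcδ_bcClass 𝕜 P hS H hij h h' (by positivity) (φ ≫ ψ) ?_ ?_
  · rw [ShortComplex.comp_τ₃, hψ, hf]
    exact Category.comp_id _
  · rw [ShortComplex.comp_τ₁, hω, hg]
    rfl

/-- Both sides are compositions of `g` with maps `Ωⁿ⁺¹ N₃ ⟶ Ωⁿ N₁'`, which agree modulo projectives
by `shift_naturality`. No relation between `H` and `H'` is assumed, so independently chosen
horseshoes are covered. -/
lemma bcδ_naturality {S S' : ShortComplex C} (hS : S.ShortExact) (hS' : S'.ShortExact)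
    (γ : S ⟶ S') {Q₁ : ProjectiveResolution S.X₁} {Q₃ : ProjectiveResolution S.X₃}
    (H : Horseshoe S Q₁ Q₃) {Q₁' : ProjectiveResolution S'.X₁} {Q₃' : ProjectiveResolution S'.X₃}
    (H' : Horseshoe S' Q₁' Q₃')
    (a : Q₁.cochainComplex ⟶ Q₁'.cochainComplex) (c : Q₃.cochainComplex ⟶ Q₃'.cochainComplex)
    (ha : syzMap a 0 ≫ augSyz Q₁' = augSyz Q₁ ≫ γ.τ₁)
    (hc : syzMap c 0 ≫ augSyz Q₃' = augSyz Q₃ ≫ γ.τ₃) (i j : ℤ) (hij : i + 1 = j) :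
    bcδ 𝕜 P hS H i j hij ≫ bcColimMap 𝕜 P Q₁ Q₁' a j =
      bcColimMap 𝕜 P Q₃ Q₃' c i ≫ bcδ 𝕜 P hS' H' i j hij := by
  ext x
  obtain ⟨k, n, h, f, rfl⟩ := exists_bcClass_eq 𝕜 P Q₃ x
  have hn : (0 : ℤ) ≤ n := by positivity
  have hnm : (n : ℤ) + 1 = (n + 1 : ℕ) := by push_cast; ring
  have h' : (k + 1 : ℕ) - j = (n : ℤ) := by push_cast; lia
  obtain ⟨ψ, hψ⟩ := exists_hom_of_projective
    (S := syzSeq Q₃.cochainComplex n (n + 1 : ℕ)) (H.syzShortComplex_shortExact hS hn)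
    inferInstance (𝟙 _)
  obtain ⟨ψ', hψ'⟩ := exists_hom_of_projective
    (S := syzSeq Q₃'.cochainComplex n (n + 1 : ℕ)) (H'.syzShortComplex_shortExact hS' hn)
    inferInstance (𝟙 _)
  obtain ⟨ω, hω⟩ : ∃ ω : syz Q₃.cochainComplex (n + 1 : ℕ) ⟶ syz Q₁.cochainComplex n,
    ψ.τ₁ = ω := ⟨_, rfl⟩
  obtain ⟨ω', hω'⟩ : ∃ ω' : syz Q₃'.cochainComplex (n + 1 : ℕ) ⟶ syz Q₁'.cochainComplex n,
    ψ'.τ₁ = ω' := ⟨_, rfl⟩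
  obtain ⟨φ, hφ⟩ := exists_hom_of_projective
    (S := syzSeq P.cochainComplex k (k + 1 : ℕ)) (syzSeq_shortExact Q₃ hnm hn) inferInstance f
  obtain ⟨g, hg⟩ : ∃ g : syz P.cochainComplex (k + 1 : ℕ) ⟶ syz Q₃.cochainComplex (n + 1 : ℕ),
    φ.τ₁ = g := ⟨_, rfl⟩
  have h1 := bcδ_bcClass_eq_shift 𝕜 P hS H hij h h' hψ hω φ hφ hg
  have h2 := bcδ_bcClass_eq_shift 𝕜 P hS' H' hij h h' hψ' hω'
    (φ ≫ syzSeqMap c n (n + 1 : ℕ)) (f := f ≫ syzMap c n) (g := g ≫ syzMap c (n + 1 : ℕ))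
    (by rw [ShortComplex.comp_τ₃, hφ]; rfl) (by rw [ShortComplex.comp_τ₁, hg]; rfl)
  rw [ConcreteCategory.comp_apply, ConcreteCategory.comp_apply, h1, map_zsmul,
    bcColimMap_bcClass, bcColimMap_bcClass, h2]
  congr 1
  refine bcClass_eq_of_sub_mem 𝕜 P Q₁' ?_
  have key := precomp_mem_projFactor
    (shift_naturality 𝕜 hS H hS' H' γ a c ha hc n hψ hω hψ' hω') g
  rwa [Preadditive.comp_sub, ← Category.assoc, ← Category.assoc] at key

end BensonCarlsonConnecting

/-! ### Iterated connecting maps along the resolution of `M` -/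

section SyzygyClasses

variable {𝕜 : Type t} [CommRing 𝕜] {C : Type u} [Category.{v} C] [Abelian C]
  (U : ConnectedFamily 𝕜 C) {M : C} (P : ProjectiveResolution M)

/-- The image in `Uᵏ(Ωᵏ M)` of an element of `U⁰(M)` under the iterated connecting map. -/
noncomputable def syzClass (x : (U.F (0 : ℕ)).obj M) :
    ∀ k : ℕ, (U.F k).obj (syz P.cochainComplex k)
  | 0 => (U.F (0 : ℕ)).map (inv (augSyz P)) x
  | k + 1 => syzδ U P k k (k + 1 : ℕ) (by push_cast; ring) (syzClass x k)

variable {U P}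

/-- Naturality of the connecting map for `φ`. On elements of the form `f_* xₖ`, the connecting map
is thus computed by passing from `f` to `g`, in every cohomological functor alike. -/
lemma δ_map_syzClass (hU : U.IsCohomological) (x : (U.F (0 : ℕ)).obj M) {k l : ℕ}
    (hkl : (k : ℤ) + 1 = l) (h : l = k + 1) {S : ShortComplex C} (hS : S.ShortExact)
    (φ : syzSeq P.cochainComplex k l ⟶ S)
    {f : syz P.cochainComplex k ⟶ S.X₃} (hf : φ.τ₃ = f)
    {g : syz P.cochainComplex l ⟶ S.X₁} (hg : φ.τ₁ = g) :
    U.δ k l hkl S hS ((U.F k).map f (syzClass U P x k)) =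
      (U.F l).map g (syzClass U P x l) := by
  subst h hf hg
  exact hU.δ_map_apply hkl (S := syzSeq P.cochainComplex k (k + 1 : ℕ))
    (syzSeq_shortExact P hkl (by positivity)) hS φ _

lemma map_eq_zero_of_mem_projFactor [Linear 𝕜 C] (hU : U.VanishesOnProjectives) {i : ℤ} {A B : C}
    {f : A ⟶ B} (hf : f ∈ projFactor 𝕜 A B) (x : (U.F i).obj A) : (U.F i).map f x = 0 := by
  obtain ⟨L, hL, a, b, rfl⟩ := hf
  have := ModuleCat.subsingleton_of_isZero (hU i L hL)
  rw [Functor.map_comp, ConcreteCategory.comp_apply, Subsingleton.elim ((U.F i).map a x) 0,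
    map_zero]

end SyzygyClasses

/-! ### Universal classes in `Ext` and morphisms out of `Ext(M, -)` -/

section ExtClasses

open Abelian

/-- The identity of `M`, as an element of `Ext⁰(M, M)`. -/
noncomputable def extUnit (𝕜 : Type t) [CommRing 𝕜] {C : Type u} [Category.{v} C] [Abelian C]
    [Linear 𝕜 C] [HasExt.{v} C] (M : C) : ((extFamily 𝕜 M).F (0 : ℕ)).obj M :=
  (Ext.mk₀ (𝟙 M) : Ext M M 0)

variable {C : Type u} [Category.{v} C] [Abelian C] [HasExt.{v} C] {M : C}
  (P : ProjectiveResolution M)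

/-- The class in `Extᵏ(M, Ωᵏ M)` of the truncated resolution. -/
noncomputable def extSyz : ∀ k : ℕ, Ext M (syz P.cochainComplex k) k
  | 0 => Ext.mk₀ (inv (augSyz P))
  | k + 1 => (extSyz k).comp (syzSeq_shortExact P (show (k : ℤ) + 1 = (k + 1 : ℕ) by
      push_cast; ring) (by positivity)).extClass rfl

variable {N : C}

/-- Dimension shifting in the first variable: `Ext` out of the projective `Pₖ` vanishes in positive
degrees, so each class factors through the extension class of the syzygy sequence. -/
lemma exists_extSyz_comp_eq (k j l : ℕ) (h : k + j = l) (x : Ext M N l) :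
    ∃ y : Ext (syz P.cochainComplex k) N j, (extSyz P k).comp y h = x := by
  induction k generalizing j with
  | zero =>
    obtain rfl : j = l := by lia
    refine ⟨(Ext.mk₀ (augSyz P)).comp x (zero_add _), ?_⟩
    change (Ext.mk₀ (inv (augSyz P))).comp ((Ext.mk₀ (augSyz P)).comp x (zero_add _)) _ = x
    rw [← Ext.comp_assoc_of_second_deg_zero, Ext.mk₀_comp_mk₀, IsIso.inv_hom_id,
      Ext.mk₀_id_comp]
  | succ k ih =>
    obtain ⟨y, rfl⟩ := ih (j + 1) (by lia)
    have hS := syzSeq_shortExact P (show (k : ℤ) + 1 = (k + 1 : ℕ) by push_cast; ring)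
      (by positivity)
    obtain ⟨z, rfl⟩ := Ext.contravariant_sequence_exact₃ hS N y
      (Ext.eq_zero_of_projective _) (add_comm 1 j)
    exact ⟨z, Ext.comp_assoc _ _ _ _ _ (by lia)⟩

/-- The degree `j + 1` is positive because the argument needs `Ext` out of `Pₖ` to vanish. In degree
`0` there is a genuine kernel, treated in `mem_projFactor_of_extSyz_comp_eq_zero`. -/
lemma eq_zero_of_extSyz_comp_eq_zero (k j l : ℕ) (h : k + (j + 1) = l)
    (y : Ext (syz P.cochainComplex k) N (j + 1)) (hy : (extSyz P k).comp y h = 0) : y = 0 := by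
  induction k generalizing j with
  | zero =>
    have h1 : (Ext.mk₀ (augSyz P)).comp ((Ext.mk₀ (inv (augSyz P))).comp y (zero_add _))
        (zero_add _) = y := by
      rw [← Ext.comp_assoc_of_second_deg_zero, Ext.mk₀_comp_mk₀, IsIso.hom_inv_id,
        Ext.mk₀_id_comp]
    obtain rfl : l = j + 1 := by lia
    rw [← h1, show (Ext.mk₀ (inv (augSyz P))).comp y (zero_add _) = 0 from hy, Ext.comp_zero]
  | succ k ih =>
    have hS := syzSeq_shortExact P (show (k : ℤ) + 1 = (k + 1 : ℕ) by push_cast; ring)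
      (by positivity)
    have h1 : hS.extClass.comp y (add_comm 1 (j + 1)) = 0 :=
      ih (j + 1) (by lia) _ ((Ext.comp_assoc _ _ _ _ _ (by lia)).symm.trans hy)
    obtain ⟨z, rfl⟩ := Ext.contravariant_sequence_exact₁ hS N y _ h1
    have : Projective (syzSeq P.cochainComplex k (k + 1 : ℕ)).X₂ := inferInstance
    rw [Ext.eq_zero_of_projective z]
    exact Ext.comp_zero _ _ _ _ _

/-- For `k = 0` the map itself vanishes. For `k + 1`, the previous lemma leaves only the last
extension class, and annihilating it means extending over the projective `Pₖ`. -/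
lemma mem_projFactor_of_extSyz_comp_eq_zero (𝕜 : Type t) [CommRing 𝕜] [Linear 𝕜 C] (k : ℕ)
    (f : syz P.cochainComplex k ⟶ N)
    (hf : (extSyz P k).comp (Ext.mk₀ f) (add_zero k) = 0) : f ∈ projFactor 𝕜 _ _ := by
  cases k with
  | zero =>
    have h1 : Ext.mk₀ (inv (augSyz P) ≫ f) = 0 := (Ext.mk₀_comp_mk₀ _ _).symm.trans hf
    rw [Ext.mk₀_eq_zero_iff, IsIso.inv_comp_eq, comp_zero] at h1
    rw [show f = 0 from h1]
    exact zero_mem _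
  | succ k =>
    have hS := syzSeq_shortExact P (show (k : ℤ) + 1 = (k + 1 : ℕ) by push_cast; ring)
      (by positivity)
    have h1 : hS.extClass.comp (Ext.mk₀ f) (add_zero 1) = 0 :=
      eq_zero_of_extSyz_comp_eq_zero P k 0 (k + 1) rfl _
        ((Ext.comp_assoc _ _ _ _ _ (by lia)).symm.trans hf)
    obtain ⟨z, hz⟩ := Ext.contravariant_sequence_exact₁ hS N (Ext.mk₀ f) _ h1
    obtain ⟨z, rfl⟩ := (Ext.mk₀_bijective _ _).2 z
    rw [Ext.mk₀_comp_mk₀] at hz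
    exact ⟨_, inferInstance, _, z, (Ext.mk₀_bijective _ _).1 hz⟩

variable (𝕜 : Type t) [CommRing 𝕜] [Linear 𝕜 C]

lemma syzClass_extFamily (k : ℕ) :
    syzClass (extFamily 𝕜 M) P (extUnit 𝕜 M) k = extSyz P k := by
  induction k with
  | zero =>
    change (Ext.mk₀ (𝟙 M)).comp (Ext.mk₀ (inv (augSyz P))) (add_zero 0) = Ext.mk₀ _
    rw [Ext.mk₀_id_comp]
  | succ k ih =>
    change syzδ (extFamily 𝕜 M) P k k (k + 1 : ℕ) (by push_cast; ring)
      (syzClass (extFamily 𝕜 M) P (extUnit 𝕜 M) k) = _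
    rw [ih]
    rfl

lemma exists_map_syzClass_extFamily_eq (k : ℕ) (x : ((extFamily 𝕜 M).F k).obj N) :
    ∃ f, ((extFamily 𝕜 M).F k).map f
      (syzClass (extFamily 𝕜 M) P (extUnit 𝕜 M) k) = x := by
  obtain ⟨y, hy⟩ := exists_extSyz_comp_eq P k 0 k (add_zero k) x
  obtain ⟨f, rfl⟩ := (Ext.mk₀_bijective _ _).2 y
  refine ⟨f, ?_⟩
  rw [syzClass_extFamily]
  exact hy

lemma mem_projFactor_of_map_syzClass_eq_zero {k : ℕ} {f : syz P.cochainComplex k ⟶ N}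
    (hf : ((extFamily 𝕜 M).F k).map f
      (syzClass (extFamily 𝕜 M) P (extUnit 𝕜 M) k) = 0) :
    f ∈ projFactor 𝕜 _ _ := by
  rw [syzClass_extFamily] at hf
  exact mem_projFactor_of_extSyz_comp_eq_zero P 𝕜 k f hf

variable {𝕜}

/-- An element of `U⁰(M)` defines a morphism from `Ext(M, -)` to a cohomological functor `U` that
vanishes on projective objects. -/
theorem exists_hom_extFamily {U : ConnectedFamily 𝕜 C} (hU : U.IsCohomological)
    (hP : U.VanishesOnProjectives) (x : (U.F (0 : ℕ)).obj M)
    (hlin : ∀ (k : ℕ) (N : C) (f : syz P.cochainComplex k ⟶ N) (c : 𝕜),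
      (U.F k).map (c • f) (syzClass U P x k) = c • (U.F k).map f (syzClass U P x k)) :
    ∃ τ : (extFamily 𝕜 M).Hom U, ∀ (k : ℕ) (N : C) (f : syz P.cochainComplex k ⟶ N),
      (τ.app k).app N (((extFamily 𝕜 M).F k).map f
        (syzClass (extFamily 𝕜 M) P (extUnit 𝕜 M) k)) =
          (U.F k).map f (syzClass U P x k) := by
  have hT := extFamily_isCohomological 𝕜 M
  let e := syzClass (extFamily 𝕜 M) P (extUnit 𝕜 M)
  -- The element `f_* eₖ` is sent to `f_* xₖ`. The choice of `f` does not matter: a map killing `eₖ`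
  -- factors through a projective, and `U` vanishes there.
  have ex (k : ℕ) (N : C) : ∃ α : ((extFamily 𝕜 M).F k).obj N →ₗ[𝕜] (U.F k).obj N,
      ∀ z y, (∃ f, ((extFamily 𝕜 M).F k).map f (e k) = z ∧
        (U.F k).map f (syzClass U P x k) = y) → α z = y := by
    have hTadd := hT.additive k
    have hUadd := hU.additive k
    refine exists_linearMap_of_relation _ (fun z => ?_) ?_ ?_ ?_
    · obtain ⟨f, hf⟩ := exists_map_syzClass_extFamily_eq P 𝕜 k z
      exact ⟨_, f, hf, rfl⟩
    · rintro _ _ _ _ ⟨f, rfl, rfl⟩ ⟨g, rfl, rfl⟩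
      refine ⟨f + g, ?_, ?_⟩ <;> rw [Functor.map_add] <;> rfl
    · rintro c _ _ ⟨f, rfl, rfl⟩
      -- The functors of `U` are only known to be additive, so compatibility with scalars is taken
      -- from `hlin`.
      refine ⟨c • f, ?_, hlin k N f c⟩
      change (e k).comp (Ext.mk₀ (c • f)) (add_zero k) = c • (e k).comp (Ext.mk₀ f) (add_zero k)
      rw [Ext.mk₀_smul]
      exact Ext.comp_smul _ _ _ _
    · rintro _ ⟨f, hf, rfl⟩
      exact map_eq_zero_of_mem_projFactor hP (mem_projFactor_of_map_syzClass_eq_zero P 𝕜 hf) _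
  choose α hα using ex
  let app : ∀ i : ℤ, (extFamily 𝕜 M).F i ⟶ U.F i
    | .ofNat k =>
      { app := fun N => ModuleCat.ofHom (α k N)
        naturality := fun N N' g => by
          ext z
          obtain ⟨f, rfl⟩ := exists_map_syzClass_extFamily_eq P 𝕜 k z
          have h1 := hα k N _ _ ⟨f, rfl, rfl⟩
          have h2 := hα k N' _ _ ⟨f ≫ g, rfl, rfl⟩
          rw [Functor.map_comp, Functor.map_comp] at h2
          exact h2.trans (congrArg ((U.F k).map g) h1).symm }
    | .negSucc _ => 0
  refine ⟨{ app := app, comm := ?_ }, fun k N f => hα k N _ _ ⟨f, rfl, rfl⟩⟩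
  intro i j hij S hS
  match i, j, hij with
  | .ofNat n, .ofNat m, h =>
    have h' : m = n + 1 := (Int.ofNat.inj h).symm
    ext z
    obtain ⟨f, rfl⟩ := exists_map_syzClass_extFamily_eq P 𝕜 n z
    -- Once `f` is extended to a morphism of sequences, both connecting maps are given by its left
    -- component `g`.
    obtain ⟨φ, hφ⟩ := exists_hom_of_projective (S := syzSeq P.cochainComplex n m) hS
      inferInstance f
    obtain ⟨g, hg⟩ : ∃ g : syz P.cochainComplex m ⟶ S.X₁, φ.τ₁ = g := ⟨_, rfl⟩
    have h1 := δ_map_syzClass hT (P := P) (extUnit 𝕜 M) h h' hS φ hφ hg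
    have h2 := δ_map_syzClass hU (P := P) x h h' hS φ hφ hg
    have h3 := hα n S.X₃ _ _ ⟨f, rfl, rfl⟩
    have h4 := hα m S.X₁ _ _ ⟨g, rfl, rfl⟩
    exact (congrArg (α m S.X₁) h1).trans (h4.trans (h2.symm.trans
      (congrArg (U.δ n m h S hS) h3.symm)))
  | .negSucc n, j, h => exact (isZero_extFunctor_negSucc 𝕜 M n S.X₃).eq_of_src _ _
  | .ofNat n, .negSucc m, h => exact absurd h (by simp; lia)

end ExtClasses

/-! ### The morphism from `Ext` to Benson-Carlson cohomology -/

section BensonCarlsonVanishing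

variable {𝕜 : Type t} [CommRing 𝕜] {C : Type u} [Category.{v} C] [Abelian C] [Linear 𝕜 C]
  {M : C} (P : ProjectiveResolution M) (Q : ∀ N : C, ProjectiveResolution N)

/-- Inductively the syzygy sequences split, so each syzygy is a retract of a term of the resolution.
-/
lemma projective_syz {N : C} [Projective N] (Q : ProjectiveResolution N) (n : ℕ) :
    Projective (syz Q.cochainComplex n) := by
  induction n with
  | zero =>
    exact Projective.of_iso (asIso (augSyz Q)).symm inferInstance
  | succ n ih =>
    have hS := syzSeq_shortExact Q (show (n : ℤ) + 1 = (n + 1 : ℕ) by push_cast; ring)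
      (by positivity)
    have : Projective (syzSeq Q.cochainComplex n (n + 1 : ℕ)).X₃ := ih
    let σ := hS.splittingOfProjective
    exact Retract.projective { i := _, r := σ.r, retract := σ.f_r }

/-- The class of a morphism `Ωᵏ M ⟶ Ωⁿ N`, as an element of the value of the functor `bcExt`. -/
noncomputable def bcExtClass {N : C} (k : ℕ) (n i : ℤ) (h : k - i = n)
    (f : syz P.cochainComplex k ⟶ syz (Q N).cochainComplex n) : ((bcExt 𝕜 P Q).F i).obj N :=
  bcClass 𝕜 P (Q N) k n i h f

lemma exists_bcExtClass_eq {i : ℤ} {N : C} (x : ((bcExt 𝕜 P Q).F i).obj N) :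
    ∃ (k : ℕ) (n : ℕ) (h : k - i = n) (f : syz P.cochainComplex k ⟶ syz (Q N).cochainComplex n),
      bcExtClass P Q k n i h f = x :=
  exists_bcClass_eq 𝕜 P (Q N) x

section

variable {N : C} {k : ℕ} {n i : ℤ} (h : k - i = n)
  (f g : syz P.cochainComplex k ⟶ syz (Q N).cochainComplex n)

lemma bcExtClass_smul (c : 𝕜) :
    bcExtClass (𝕜 := 𝕜) P Q k n i h (c • f) = c • bcExtClass (𝕜 := 𝕜) P Q k n i h f :=
  bcClass_smul 𝕜 P (Q N) k n i h c f

lemma bcExtClass_zsmul (c : ℤ) :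
    bcExtClass (𝕜 := 𝕜) P Q k n i h (c • f) = c • bcExtClass (𝕜 := 𝕜) P Q k n i h f :=
  bcClass_zsmul 𝕜 P (Q N) k n i h c f

variable {f g} in
lemma bcExtClass_eq_of_sub_mem (hfg : f - g ∈ projFactor 𝕜 _ _) :
    bcExtClass (𝕜 := 𝕜) P Q k n i h f = bcExtClass (𝕜 := 𝕜) P Q k n i h g :=
  bcClass_eq_of_sub_mem 𝕜 P (Q N) hfg

lemma bcExt_map_bcExtClass {N' : C} (u : N ⟶ N') :
    ((bcExt 𝕜 P Q).F i).map u (bcExtClass P Q k n i h f) =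
      bcExtClass P Q k n i h (f ≫ syzMap (liftRes Q u) n) :=
  bcColimMap_bcClass 𝕜 P (Q N) (Q N') (liftRes Q u) h f

end

lemma bcExt_vanishesOnProjectives : (bcExt 𝕜 P Q).VanishesOnProjectives := by
  intro i N hN
  have : Subsingleton (((bcExt 𝕜 P Q).F i).obj N) := by
    refine subsingleton_of_forall_eq 0 fun x => ?_
    obtain ⟨k, n, h, f, rfl⟩ := exists_bcExtClass_eq P Q x
    -- The zero morphism is written as `0 • f`, so that `bcExtClass_smul` identifies its class as
    -- zero.
    have h0 : f - (0 : 𝕜) • f ∈ projFactor 𝕜 _ _ := by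
      rw [zero_smul, sub_zero]
      exact ⟨_, projective_syz (Q N) n, f, 𝟙 _, Category.comp_id _⟩
    rw [bcExtClass_eq_of_sub_mem P Q h h0, bcExtClass_smul, zero_smul]
  exact ModuleCat.isZero_of_subsingleton _

variable (𝕜) in
/-- The class in degree `0` of the identity of `M`. -/
noncomputable def bcUnit : ((bcExt 𝕜 P Q).F (0 : ℕ)).obj M :=
  bcExtClass P Q 0 (0 : ℕ) (0 : ℕ) (by simp) (augSyz P ≫ inv (augSyz (Q M)))

/-- The connecting map at level `k` contributes the sign `(-1)ᵏ`. Only the fact that the accumulated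
sign squares to one is used later. -/
lemma syzClass_bcExt (k : ℕ) : ∃ ε : ℤ, ε * ε = 1 ∧
    syzClass (bcExt 𝕜 P Q) P (bcUnit 𝕜 P Q) k =
      ε • bcExtClass P Q k (0 : ℕ) k (by simp) (inv (augSyz (Q (syz P.cochainComplex k)))) := by
  induction k with
  | zero =>
    refine ⟨1, rfl, ?_⟩
    rw [one_smul]
    refine (bcExt_map_bcExtClass P Q (i := (0 : ℕ)) (k := 0) (n := (0 : ℕ))
      (by simp) (augSyz P ≫ inv (augSyz (Q M))) (inv (augSyz P))).trans ?_
    congr 1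
    refine (Category.assoc _ _ _).trans ((congrArg _ (inv_augSyz_syzMap_liftRes Q
      (inv (augSyz P)))).trans ?_)
    exact IsIso.hom_inv_id_assoc _ _
  | succ k ih =>
    obtain ⟨ε, hε, h⟩ := ih
    refine ⟨ε * (-1) ^ k, ?_, ?_⟩
    · rw [mul_mul_mul_comm, hε, ← pow_add, one_mul, Even.neg_one_pow ⟨k, rfl⟩]
    · change syzδ (bcExt 𝕜 P Q) P k k (k + 1 : ℕ) (by push_cast; ring)
        (syzClass (bcExt 𝕜 P Q) P (bcUnit 𝕜 P Q) k) = _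
      rw [h, map_zsmul, mul_smul]
      congr 1
      have hS := syzSeq_shortExact P (show (k : ℤ) + 1 = (k + 1 : ℕ) by push_cast; ring)
        (by positivity)
      -- This is the horseshoe used in the definition of `bcExt`. Its zeroth syzygies form a copy of
      -- the given sequence, so `H.augInv` is the morphism that computes the connecting map.
      let H := Classical.choice (nonempty_horseshoe hS
        (Q (syz P.cochainComplex (k + 1 : ℕ))) (Q (syz P.cochainComplex k)))
      exact bcδ_bcClass 𝕜 P hS H (i := k) (j := (k + 1 : ℕ)) (by push_cast; ring) (n := (0 : ℕ))
        (by simp) (by simp) (by simp) H.augInv rfl rfl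

lemma map_syzClass_bcExt (k : ℕ) : ∃ ε : ℤ, ε * ε = 1 ∧
    ∀ (N : C) (f : syz P.cochainComplex k ⟶ N),
      ((bcExt 𝕜 P Q).F k).map f (syzClass (bcExt 𝕜 P Q) P (bcUnit 𝕜 P Q) k) =
      ε • bcExtClass P Q k (0 : ℕ) k (by simp) (f ≫ inv (augSyz (Q N))) := by
  obtain ⟨ε, hε, h⟩ := syzClass_bcExt (𝕜 := 𝕜) P Q k
  refine ⟨ε, hε, fun N f => ?_⟩
  rw [h, map_zsmul, bcExt_map_bcExtClass]
  congr 2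
  exact inv_augSyz_syzMap_liftRes Q f

lemma bcExt_map_smul_syzClass (k : ℕ) (N : C) (f : syz P.cochainComplex k ⟶ N) (c : 𝕜) :
    ((bcExt 𝕜 P Q).F k).map (c • f) (syzClass (bcExt 𝕜 P Q) P (bcUnit 𝕜 P Q) k) =
      c • ((bcExt 𝕜 P Q).F k).map f (syzClass (bcExt 𝕜 P Q) P (bcUnit 𝕜 P Q) k) := by
  obtain ⟨ε, -, h⟩ := map_syzClass_bcExt (𝕜 := 𝕜) P Q k
  rw [h, h, smul_comm, ← bcExtClass_smul]
  congr 2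
  exact Linear.smul_comp _ _ _ _ _ _

variable [HasExt.{v} C]

/-- If the class of `f : Ωᵏ M ⟶ Ωⁿ N` vanishes in Benson-Carlson cohomology, then the
corresponding element of `Extᵏ(M, Ωⁿ N)` is annihilated by sufficiently many dimension shifts. -/
lemma eventually_vanishRel_of_dies [EnoughProjectives C] {N : C} (Q : ProjectiveResolution N)
    (m k n : ℕ) (f : syz P.cochainComplex k ⟶ syz Q.cochainComplex n) (hf : Dies 𝕜 P Q m k n f)
    (x : ((extFamily 𝕜 M).F (0 : ℕ)).obj M) :
    Eventually (vanishRel (extFamily 𝕜 M)) (m + 1) k _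
      (((extFamily 𝕜 M).F k).map f (syzClass (extFamily 𝕜 M) P x k))
      (((extFamily 𝕜 M).F k).map f (syzClass (extFamily 𝕜 M) P x k)) := by
  have hT := extFamily_isCohomological 𝕜 M
  have hS := syzSeq_shortExact Q (show (n : ℤ) + 1 = (n + 1 : ℕ) by push_cast; ring)
    (by positivity)
  have hkl : (k : ℤ) + 1 = (k + 1 : ℕ) := by push_cast; ring
  refine Eventually.of_projective_cover (S := syzSeq Q.cochainComplex n (n + 1 : ℕ)) hT hT
    (vanishRel_isStable _) hkl hS inferInstance ?_
  induction m generalizing k n with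
  | zero =>
    -- The factorization through `L` lifts to the middle term of the syzygy sequence of `N`, so one
    -- connecting map kills the element. This is the extra shift in `m + 1`.
    obtain ⟨L, hL, a, b, rfl⟩ := hf
    have hb : Projective.factorThru b (syzProj Q.cochainComplex n) ≫ syzProj Q.cochainComplex n =
      b := Projective.factorThru_comp _ _
    rw [← hb, ← Category.assoc, Functor.map_comp]
    exact (hT.exact₃ k (k + 1 : ℕ) hkl (syzSeq Q.cochainComplex n (n + 1 : ℕ)) hS _).2 ⟨_, rfl⟩
  | succ m ih =>
    obtain ⟨φ, hφ, g, hg, h⟩ := hf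
    have h1 := δ_map_syzClass hT (P := P) x hkl rfl hS φ hφ hg
    have hS' := syzSeq_shortExact Q (show ((n + 1 : ℕ) : ℤ) + 1 = (n + 1 + 1 : ℕ) by
      push_cast; ring) (by positivity)
    have h2 := Eventually.of_projective_cover
      (S := syzSeq Q.cochainComplex (n + 1 : ℕ) (n + 1 + 1 : ℕ)) hT hT
      (vanishRel_isStable _) _ hS' inferInstance (ih (k + 1) (n + 1) g h hS'
        (by push_cast; ring))
    exact (congrArg (fun z => Eventually (vanishRel (extFamily 𝕜 M)) (m + 1) (k + 1 : ℕ)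
      (syz Q.cochainComplex (n + 1 : ℕ)) z z) h1).mpr h2

/-- One shift turns the class of `f : Ωᵏ M ⟶ Ωⁿ⁺¹ N` into plus or minus the class of `f ≫ ω : Ωᵏ M ⟶
Ωⁿ K`, so `n` drops by one. At `n = 0` the target is `N` itself and the class is an image of the
universal one. -/
lemma bcExt_eventually_spanRel {τ : (extFamily 𝕜 M).Hom (bcExt 𝕜 P Q)}
    (hτ : ∀ (k : ℕ) (N : C) (f : syz P.cochainComplex k ⟶ N), (τ.app k).app N
      (((extFamily 𝕜 M).F k).map f (syzClass (extFamily 𝕜 M) P (extUnit 𝕜 M) k)) =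
        ((bcExt 𝕜 P Q).F k).map f (syzClass (bcExt 𝕜 P Q) P (bcUnit 𝕜 P Q) k))
    (n k : ℕ) (i : ℤ) (h : k - i = n) (N : C)
    (f : syz P.cochainComplex k ⟶ syz (Q N).cochainComplex n) :
    Eventually (τ.spanRel τ) n i N (bcExtClass P Q k n i h f) (bcExtClass P Q k n i h f) := by
  have hadd : ∀ {i : ℤ} {N : C} {x y : ((bcExt 𝕜 P Q).F i).obj N} (c : 𝕜),
      τ.spanRel τ i N x y → τ.spanRel τ i N (c • x) (c • y) := by
    rintro i N _ _ c ⟨s, rfl, rfl⟩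
    exact ⟨c • s, map_smul _ _ _, map_smul _ _ _⟩
  induction n generalizing i k N with
  | zero =>
    obtain rfl : i = k := by simpa [sub_eq_zero, eq_comm] using h
    obtain ⟨ε, hε, hmap⟩ := map_syzClass_bcExt (𝕜 := 𝕜) P Q k
    have h1 := hτ k N (f ≫ augSyz (Q N))
    rw [hmap] at h1
    have h2 : (τ.app k).app N (ε • ((extFamily 𝕜 M).F k).map (f ≫ augSyz (Q N))
        (syzClass (extFamily 𝕜 M) P (extUnit 𝕜 M) k)) =
        bcExtClass P Q k (0 : ℕ) k h f := by
      rw [map_zsmul, h1, smul_smul, hε, one_smul]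
      congr 1
      exact (Category.assoc _ _ _).trans ((congrArg _ (IsIso.hom_inv_id (augSyz (Q N)))).trans
        (Category.comp_id _))
    exact ⟨_, h2, h2⟩
  | succ n ih =>
    intro j hij K L a b w hS hL
    have hn : (0 : ℤ) ≤ n := by positivity
    have hn1 : (0 : ℤ) ≤ (n + 1 : ℕ) := by positivity
    have hnm : (n : ℤ) + 1 = (n + 1 : ℕ) := by push_cast; ring
    have hml : ((n + 1 : ℕ) : ℤ) + 1 = (n + 1 + 1 : ℕ) := by push_cast; ring
    let H := Classical.choice (nonempty_horseshoe hS (Q K) (Q N))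
    obtain ⟨ψ, hψ⟩ := exists_hom_of_projective
      (S := syzSeq (Q N).cochainComplex n (n + 1 : ℕ)) (H.syzShortComplex_shortExact hS hn)
      inferInstance (𝟙 _)
    obtain ⟨ψ', hψ'⟩ := exists_hom_of_projective
      (S := syzSeq (Q N).cochainComplex (n + 1 : ℕ) (n + 1 + 1 : ℕ))
      (H.syzShortComplex_shortExact hS hn1) inferInstance (𝟙 _)
    obtain ⟨ω, hω⟩ : ∃ ω : syz (Q N).cochainComplex (n + 1 : ℕ) ⟶ syz (Q K).cochainComplex n,
      ψ.τ₁ = ω := ⟨_, rfl⟩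
    obtain ⟨ω', hω'⟩ : ∃ ω' : syz (Q N).cochainComplex (n + 1 + 1 : ℕ) ⟶
      syz (Q K).cochainComplex (n + 1 : ℕ), ψ'.τ₁ = ω' := ⟨_, rfl⟩
    obtain ⟨χ, hχ⟩ := exists_hom_of_projective
      (S := syzSeq (Q N).cochainComplex (n + 1 : ℕ) (n + 1 + 1 : ℕ))
      (syzSeq_shortExact (Q K) hnm hn) inferInstance ω
    obtain ⟨ω'', hω''⟩ : ∃ ω'' : syz (Q N).cochainComplex (n + 1 + 1 : ℕ) ⟶
      syz (Q K).cochainComplex (n + 1 : ℕ), χ.τ₁ = ω'' := ⟨_, rfl⟩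
    obtain ⟨φ, hφ⟩ := exists_hom_of_projective (S := syzSeq P.cochainComplex k (k + 1 : ℕ))
      (syzSeq_shortExact (Q N) hml hn1) inferInstance f
    obtain ⟨g, hg⟩ : ∃ g : syz P.cochainComplex (k + 1 : ℕ) ⟶
      syz (Q N).cochainComplex (n + 1 + 1 : ℕ), φ.τ₁ = g := ⟨_, rfl⟩
    have e := shift_add_mem_projFactor 𝕜 hS H hn hn1 hnm hψ hω hψ' hω' hχ hω''
    -- The connecting map produces `g ≫ ω'` at level `k + 1`. Modulo projectives this is `-(g ≫
    -- ω'')` (`h3`), and `g ≫ ω''` is the transition of `f ≫ ω` from level `k` (`h2`).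
    have h1 : (bcExt 𝕜 P Q).δ i j hij _ hS (bcExtClass P Q k (n + 1 : ℕ) i h f) =
        ((-1) ^ k : ℤ) • bcExtClass P Q (k + 1) (n + 1 : ℕ) j (by push_cast at h ⊢; lia)
          (g ≫ ω') :=
      bcδ_bcClass_eq_shift 𝕜 P hS H hij h _ hψ' hω' φ hφ hg
    have h2 : bcExtClass (𝕜 := 𝕜) P Q (k + 1) (n + 1 : ℕ) j (by push_cast at h ⊢; lia) (g ≫ ω'') =
        bcExtClass P Q k n j (by push_cast at h; lia) (f ≫ ω) :=
      bcClass_eq_of_hom 𝕜 P (Q K) _ _ hn (φ ≫ χ)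
        (by rw [ShortComplex.comp_τ₃, hφ, hχ]; rfl) (by rw [ShortComplex.comp_τ₁, hg, hω'']; rfl)
    have h3 : bcExtClass (𝕜 := 𝕜) P Q (k + 1) (n + 1 : ℕ) j (by push_cast at h ⊢; lia) (g ≫ ω') =
        bcExtClass P Q (k + 1) (n + 1 : ℕ) j (by push_cast at h ⊢; lia)
          ((-1 : ℤ) • (g ≫ ω'')) := by
      refine bcExtClass_eq_of_sub_mem P Q _ ?_
      have := precomp_mem_projFactor e g
      rwa [neg_one_zsmul, sub_neg_eq_add, ← Preadditive.comp_add, add_comm ω']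
    rw [h3, bcExtClass_zsmul, h2, smul_smul, ← Int.cast_smul_eq_zsmul 𝕜] at h1
    change Eventually _ _ _ _ ((bcExt 𝕜 P Q).δ i j hij _ hS
      (bcExtClass P Q k (n + 1 : ℕ) i h f)) ((bcExt 𝕜 P Q).δ i j hij _ hS
      (bcExtClass P Q k (n + 1 : ℕ) i h f))
    rw [h1]
    exact Eventually.smul hadd _ (ih k j _ K (f ≫ ω))

theorem exists_isEventuallyBijective_bcExt [EnoughProjectives C]
    (hQ : (bcExt 𝕜 P Q).IsCohomological) :
    ∃ τ : (extFamily 𝕜 M).Hom (bcExt 𝕜 P Q), τ.IsEventuallyBijective := by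
  have hT := extFamily_isCohomological 𝕜 M
  obtain ⟨τ, hτ⟩ := exists_hom_extFamily P hQ (bcExt_vanishesOnProjectives P Q) (bcUnit 𝕜 P Q)
    (bcExt_map_smul_syzClass P Q)
  refine ⟨τ, ⟨fun i N x => ?_, fun i N s hs => ?_⟩⟩
  · obtain ⟨k, n, h, f, rfl⟩ := exists_bcExtClass_eq P Q x
    exact ⟨n, bcExt_eventually_spanRel P Q hτ n k i h N f⟩
  · match i, s, hs with
    | .negSucc n, s, hs =>
      exact ⟨0, Subsingleton.elim (α := (extFunctor 𝕜 M (.negSucc n)).obj N) s 0⟩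
    | .ofNat k, s, hs =>
      obtain ⟨f, rfl⟩ := exists_map_syzClass_extFamily_eq P 𝕜 k s
      obtain ⟨ε, hε, hmap⟩ := map_syzClass_bcExt (𝕜 := 𝕜) P Q k
      have h1 := (hmap N f).symm.trans ((hτ k N f).symm.trans hs)
      have h2 : bcExtClass P Q k (0 : ℕ) k (by simp) (f ≫ inv (augSyz (Q N))) =
          (0 : ((bcExt 𝕜 P Q).F k).obj N) := by
        have h3 := congrArg (fun x : ((bcExt 𝕜 P Q).F k).obj N => ε • x) h1
        rwa [smul_smul, hε, one_smul, smul_zero] at h3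
      obtain ⟨m, hm⟩ := exists_dies_of_bcClass_eq_zero 𝕜 P (Q N) h2
      refine ⟨m + 1, ?_⟩
      -- The vanishing is known for the element over `Ω⁰ N`; the augmentation carries it back to
      -- `N`.
      have h4 := Eventually.map hT hT (vanishRel_isStable _) (augSyz (Q N))
        (eventually_vanishRel_of_dies P (Q N) m k 0 _ hm (extUnit 𝕜 M))
      have h5 : ((extFamily 𝕜 M).F k).map (augSyz (Q N)) (((extFamily 𝕜 M).F k).map
          (f ≫ inv (augSyz (Q N))) (syzClass (extFamily 𝕜 M) P (extUnit 𝕜 M) k)) =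
          ((extFamily 𝕜 M).F k).map f
            (syzClass (extFamily 𝕜 M) P (extUnit 𝕜 M) k) := by
        rw [← ConcreteCategory.comp_apply, ← Functor.map_comp, Category.assoc,
          IsIso.inv_hom_id, Category.comp_id]
      have h6 := h5 ▸ h4
      exact h6

end BensonCarlsonVanishing

/-! ### Extending cochains towards higher homological degrees -/

section Lifting

variable {C : Type u} [Category.{v} C] [Abelian C] {K L : CochainComplex C ℤ}

lemma exists_comp_d_eq {A : C} [Projective A] {q q' : ℤ} (h : q' + 1 = q) (x : A ⟶ L.X q)
    (hx : x ≫ L.pOpcycles q = 0) : ∃ y : A ⟶ L.X q', y ≫ L.d q' q = x := by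
  have hex : (ShortComplex.mk _ _ (L.d_pOpcycles q' q)).Exact :=
    ShortComplex.exact_of_g_is_cokernel _ (L.opcyclesIsCokernel q' q (by simp; lia))
  exact ⟨hex.liftFromProjective x hx, hex.liftFromProjective_comp x hx⟩

lemma mono_fromOpcycles_of_exactAt {q q' : ℤ} (h : q + 1 = q') (hq : L.ExactAt q) :
    Mono (L.fromOpcycles q q') := by
  rw [HomologicalComplex.exactAt_iff_isZero_homology] at hq
  exact Preadditive.mono_of_isZero_kernel' _ (L.homologyIsKernel q q' (by simp; lia)) hq

lemma comp_pOpcycles_eq_zero {A : C} {q q' : ℤ} (h : q + 1 = q') (hq : L.ExactAt q)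
    (x : A ⟶ L.X q) (hx : x ≫ L.d q q' = 0) : x ≫ L.pOpcycles q = 0 := by
  have := mono_fromOpcycles_of_exactAt h hq
  rw [← cancel_mono (L.fromOpcycles q q'), Category.assoc, L.p_fromOpcycles, hx, zero_comp]

/-- A component of a cochain whose differential is prescribed in low degrees can be extended
towards lower degrees, if the source is degreewise projective and the target is exact there. -/
theorem exists_cochain_δ_eq {n m : ℤ} (hnm : n + 1 = m) (α : Cochain K L m) {p₀ q₀ : ℤ}
    (h₀ : p₀ + n = q₀) (hK : ∀ p < p₀, Projective (K.X p)) (hL : ∀ q < q₀, L.ExactAt q)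
    (hα : ∀ (p q : ℤ) (hpq : p + (m + 1) = q), p + 1 < p₀ → (δ m (m + 1) α).v p q hpq = 0)
    (s : K.X p₀ ⟶ L.X q₀)
    (hs : ∀ (p : ℤ) (hp : p + 1 = p₀),
      (α.v p q₀ (by lia) - m.negOnePow • K.d p p₀ ≫ s) ≫ L.pOpcycles q₀ = 0) :
    ∃ z : Cochain K L n, z.v p₀ q₀ h₀ = s ∧
      ∀ (p q : ℤ) (hpq : p + m = q), p < p₀ → (δ n m z).v p q hpq = α.v p q hpq := by
  -- Only the component in degree `p₀ - J` of a stage `J` cochain matters; the condition says that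
  -- the equation for the next lower component is solvable.
  let T (J : ℕ) := {z : Cochain K L n // ∀ (p p' q : ℤ) (hp : p + 1 = p') (hq : p' + n = q),
    p' = p₀ - J → (α.v p q (by lia) - m.negOnePow • K.d p p' ≫ z.v p' q hq) ≫ L.pOpcycles q = 0}
  have step (J : ℕ) (z : T J) : ∃ z' : T (J + 1), ∀ (p p' q q' : ℤ) (hp : p + 1 = p')
      (hq : p + n = q) (hq' : p' + n = q'), p' = p₀ - J →
      z'.1.v p q hq ≫ L.d q q' = α.v p q' (by lia) - m.negOnePow • K.d p p' ≫ z.1.v p' q' hq' := by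
    obtain ⟨z, hz⟩ := z
    have := hK (p₀ - J - 1) (by lia)
    obtain ⟨y, hy⟩ := exists_comp_d_eq (q' := p₀ - J - 1 + n) (q := p₀ - J + n) (by lia) _
      (hz (p₀ - J - 1) (p₀ - J) (p₀ - J + n) (by lia) rfl rfl)
    refine ⟨⟨Cochain.single y n, ?_⟩, ?_⟩
    · rintro p p' q hp hq hp'
      obtain rfl : p' = p₀ - J - 1 := by push_cast at hp'; lia
      obtain rfl : q = p₀ - J - 1 + n := by lia
      refine comp_pOpcycles_eq_zero (q' := p₀ - J + n) (by lia) (hL _ (by lia)) _ ?_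
      -- Since `δ α` vanishes here, the next obstruction is a cycle; exactness of `L` makes it zero
      -- in the opcycles.
      have h1 := hα p (p₀ - J + n) (by lia) (by lia)
      rw [δ_v m (m + 1) rfl α p _ _ (p₀ - J - 1 + n) (p₀ - J - 1) (by lia) hp] at h1
      rw [Cochain.single_v, Preadditive.sub_comp, Linear.units_smul_comp, Category.assoc, hy,
        Preadditive.comp_sub, Linear.comp_units_smul, ← Category.assoc, K.d_comp_d, zero_comp,
        smul_zero, sub_zero, ← h1, Int.negOnePow_succ, Units.neg_smul, ← sub_eq_add_neg]
    · rintro p p' q q' hp hq hq' rfl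
      obtain rfl : p = p₀ - J - 1 := by lia
      subst hq hq'
      rw [Cochain.single_v]
      exact hy
  choose next hnext using step
  let t : ∀ J, T J := fun J => Nat.rec ⟨Cochain.single s n, by
    rintro p p' q hp hq hp'
    obtain rfl : p' = p₀ := by simpa using hp'
    obtain rfl : q = q₀ := by lia
    rw [Cochain.single_v]
    exact hs p hp⟩ next J
  -- Diagonal gluing: the component in degree `p` is taken from stage `p₀ - p`. In degrees above
  -- `p₀` stage `0` contributes zero.
  refine ⟨Cochain.mk fun p q hpq => (t (p₀ - p).toNat).1.v p q hpq, ?_, ?_⟩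
  · rw [Cochain.mk_v, sub_self]
    exact Cochain.single_v _ _ _
  · intro p q hpq hp
    rw [δ_v n m hnm _ p q hpq (q - 1) (p + 1) rfl rfl, Cochain.mk_v, Cochain.mk_v]
    obtain ⟨J, hJ⟩ : ∃ J : ℕ, p₀ - (p + 1) = J := Int.eq_ofNat_of_zero_le (by lia)
    have h1 : (p₀ - (p + 1)).toNat = J := by lia
    have h2 : (p₀ - p).toNat = J + 1 := by lia
    rw [h1, h2, hnext J (t J) p (p + 1) (q - 1) q rfl (by lia) (by lia) (by lia)]
    simp

end Lifting

/-! ### Maps of syzygies induced by cochains -/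

section Induces

variable {C : Type u} [Category.{v} C] [Abelian C] {K L : CochainComplex C ℤ}

/-- The cochain `φ` commutes with the differentials, up to sign, in degrees `≥ k`, and induces `f`
on the `k`-th syzygies. -/
structure Induces {i : ℤ} (φ : Cochain K L i) (k n : ℤ) (h : k - i = n)
    (f : syz K k ⟶ syz L n) : Prop where
  δ_v_eq_zero : ∀ (p q : ℤ) (hpq : p + (i + 1) = q), p < -k → (δ i (i + 1) φ).v p q hpq = 0
  syzProj_comp : syzProj K k ≫ f = φ.v (-k) (-n) (by lia) ≫ syzProj L n

variable {i : ℤ} {φ ψ : Cochain K L i} {k n : ℤ} {h : k - i = n}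

lemma exists_induces (k n : ℤ) (h : k - i = n)
    (hφ : ∀ (p q : ℤ) (hpq : p + (i + 1) = q), p < -k → (δ i (i + 1) φ).v p q hpq = 0) :
    ∃ f, Induces φ k n h f := by
  have h0 : K.d (-k - 1) (-k) ≫ φ.v (-k) (-n) (by lia) ≫ syzProj L n = 0 := by
    have h1 := hφ (-k - 1) (-n) (by lia) (by lia)
    rw [δ_v i (i + 1) rfl φ _ _ _ (-(n + 1)) (-k) (by lia) (by lia)] at h1
    have h2 := congr($h1 ≫ syzProj L n)
    rw [Preadditive.add_comp, Category.assoc, d_syzProj, comp_zero, zero_add, zero_comp,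
      Linear.units_smul_comp, Category.assoc] at h2
    exact (smul_eq_zero_iff_eq _).1 h2
  exact ⟨K.descOpcycles _ (-k - 1) (by simp) h0, hφ, K.p_descOpcycles _ _ _ _⟩

lemma Induces.add {f g : syz K k ⟶ syz L n} (hf : Induces φ k n h f) (hg : Induces ψ k n h g) :
    Induces (φ + ψ) k n h (f + g) where
  δ_v_eq_zero p q hpq hp := by
    rw [δ_add, Cochain.add_v, hf.δ_v_eq_zero p q hpq hp, hg.δ_v_eq_zero p q hpq hp, add_zero]
  syzProj_comp := by
    rw [Preadditive.comp_add, hf.syzProj_comp, hg.syzProj_comp, Cochain.add_v,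
      Preadditive.add_comp]

lemma Induces.smul {𝕜 : Type t} [CommRing 𝕜] [Linear 𝕜 C] (c : 𝕜) {f : syz K k ⟶ syz L n}
    (hf : Induces φ k n h f) : Induces (c • φ) k n h (c • f) where
  δ_v_eq_zero p q hpq hp := by
    rw [δ_smul, Cochain.smul_v, hf.δ_v_eq_zero p q hpq hp, smul_zero]
  syzProj_comp := by
    rw [Linear.comp_smul, hf.syzProj_comp, Cochain.smul_v, Linear.smul_comp]

lemma Induces.comp_ofHom {L' : CochainComplex C ℤ} (g : L ⟶ L') {f : syz K k ⟶ syz L n}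
    (hf : Induces φ k n h f) :
    Induces (φ.comp (Cochain.ofHom g) (add_zero i)) k n h (f ≫ syzMap g n) where
  δ_v_eq_zero p q hpq hp := by
    rw [δ_comp_ofHom, Cochain.comp_zero_cochain_v, hf.δ_v_eq_zero p q hpq hp, zero_comp]
  syzProj_comp := by
    rw [← Category.assoc, hf.syzProj_comp, Category.assoc, syzProj_syzMap,
      Cochain.comp_zero_cochain_v, Cochain.ofHom_v, Category.assoc]

lemma Induces.exists_succ {f : syz K k ⟶ syz L n} (hf : Induces φ k n h f) (k' n' : ℤ)
    (hk : k + 1 = k') (h' : k' - i = n') : ∃ f', Induces φ k' n' h' f' :=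
  exists_induces k' n' h' fun p q hpq hp => hf.δ_v_eq_zero p q hpq (by lia)

/-- Since `φ` commutes with the differentials only up to `(-1)ⁱ`, the left square commutes after
rescaling `f'`. This is where the sign `(-1)ⁱᵏ` of the comparison comes from. -/
lemma Induces.exists_hom {f : syz K k ⟶ syz L n} (hf : Induces φ k n h f) {k' n' : ℤ}
    (hk : k + 1 = k') {h' : k' - i = n'} {f' : syz K k' ⟶ syz L n'}
    (hf' : Induces φ k' n' h' f') :
    ∃ Φ : syzSeq K k k' ⟶ syzSeq L n n', Φ.τ₁ = (i.negOnePow • f' : syz K k' ⟶ syz L n') ∧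
      Φ.τ₃ = f := by
  refine ⟨{ τ₁ := (i.negOnePow • f' : syz K k' ⟶ syz L n')
            τ₂ := φ.v (-k) (-n) (by lia)
            τ₃ := f
            comm₁₂ := ?_
            comm₂₃ := hf.syzProj_comp.symm }, rfl, rfl⟩
  change (i.negOnePow • f') ≫ syzIncl L n n' = syzIncl K k k' ≫ φ.v (-k) (-n) (by lia)
  have h1 := hf.δ_v_eq_zero (-k') (-n) (by lia) (by lia)
  rw [δ_v i (i + 1) rfl φ _ _ _ (-n') (-k) (by lia) (by lia), Int.negOnePow_succ, Units.neg_smul,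
    add_neg_eq_zero] at h1
  rw [← cancel_epi (syzProj K k'), ← Category.assoc, Linear.comp_units_smul, hf'.syzProj_comp,
    syzProj_syzIncl_assoc, Linear.units_smul_comp, Category.assoc, syzProj_syzIncl, h1,
    smul_smul, ← Int.negOnePow_add, Int.negOnePow_even _ ⟨i, rfl⟩, one_smul]

end Induces

/-! ### Elements of cycles and homology -/

section Homology

variable {𝕜 : Type t} [CommRing 𝕜] (X : CochainComplex (ModuleCat.{v} 𝕜) ℤ)

lemma homologyπ_surjective (i : ℤ) : Function.Surjective (X.homologyπ i) :=
  (ModuleCat.epi_iff_surjective _).1 inferInstance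

lemma iCycles_injective (i : ℤ) : Function.Injective (X.iCycles i) :=
  (ModuleCat.mono_iff_injective _).1 inferInstance

lemma exists_iCycles_eq {i j : ℤ} (hij : i + 1 = j) {x : X.X i} (hx : X.d i j x = 0) :
    ∃ c : X.cycles i, X.iCycles i c = x := by
  have hex : (ShortComplex.mk _ _ (X.iCycles_d i j)).Exact :=
    ShortComplex.exact_of_f_is_kernel _ (X.cyclesIsKernel i j (by simpa using hij))
  exact (ShortComplex.moduleCat_exact_iff _).1 hex x hx

lemma homologyπ_eq_zero_iff {i j : ℤ} (hij : j + 1 = i) (c : X.cycles i) :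
    X.homologyπ i c = 0 ↔ ∃ w : X.X j, X.d j i w = X.iCycles i c := by
  have hex : (ShortComplex.mk _ _ (X.toCycles_comp_homologyπ j i)).Exact :=
    ShortComplex.exact_of_g_is_cokernel _ (X.homologyIsCokernel j i (by simp; lia))
  rw [ShortComplex.moduleCat_exact_iff] at hex
  have h1 (w : X.X j) : X.iCycles i (X.toCycles j i w) = X.d j i w :=
    congr($(X.toCycles_i j i) w)
  constructor
  · intro hc
    obtain ⟨w, hw⟩ := hex c hc
    exact ⟨w, (h1 w).symm.trans (congrArg _ hw)⟩
  · rintro ⟨w, hw⟩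
    rw [← iCycles_injective X i ((h1 w).trans hw)]
    exact congr($(X.toCycles_comp_homologyπ j i) w)

end Homology

/-! ### Finite support of cochains -/

section Bounded

variable {𝕜 : Type t} [CommRing 𝕜] {C : Type u} [Category.{v} C] [Preadditive C] [Linear 𝕜 C]
  {F G : CochainComplex C ℤ} {n : ℤ}

lemma exists_v_eq_zero_of_mem_boundedCochain {z : Cochain F G n}
    (hz : z ∈ boundedCochain 𝕜 F G n) :
    ∃ k₀ : ℕ, ∀ k : ℕ, k₀ ≤ k → ∀ (p q : ℤ) (hpq : p + n = q), p < -k → z.v p q hpq = 0 := by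
  obtain ⟨b, hb⟩ := (mem_boundedCochain.1 hz).bddBelow
  refine ⟨(-b).toNat, fun k hk p q hpq hp => ?_⟩
  by_contra h
  have := hb ⟨q, hpq, h⟩
  lia

/-- The source vanishes in positive degrees, so only the finitely many degrees from `-k` to `0` can
support `z`. -/
lemma mem_boundedCochain_of_v_eq_zero {z : Cochain F G n} (k : ℤ)
    (h0 : ∀ p : ℤ, 0 < p → IsZero (F.X p))
    (hz : ∀ (p q : ℤ) (hpq : p + n = q), p < -k → z.v p q hpq = 0) :
    z ∈ boundedCochain 𝕜 F G n := by
  rw [mem_boundedCochain]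
  refine (Set.finite_Icc (-k) 0).subset ?_
  rintro p ⟨q, hpq, h⟩
  refine ⟨?_, ?_⟩ <;> by_contra hp
  · exact h (hz p q hpq (by lia))
  · exact h ((h0 p (by lia)).eq_of_src _ _)

end Bounded

/-! ### The comparison relation is single-valued and linear -/

section Comparison

variable {𝕜 : Type t} [CommRing 𝕜] {C : Type u} [Category.{v} C] [Abelian C] [Linear 𝕜 C]
  {M : C} (P : ProjectiveResolution M) {N : C} (Q : ProjectiveResolution N)

variable (𝕜) in
/-- The quotient complex `Hom(P, Q) / Hom̄(P, Q)` of two projective resolutions. -/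
noncomputable abbrev stableHomRes : CochainComplex (ModuleCat.{v} 𝕜) ℤ :=
  stableHomComplex 𝕜 P.cochainComplex Q.cochainComplex

lemma isZero_cochainComplex_X {p : ℤ} (hp : 0 < p) : IsZero (P.cochainComplex.X p) :=
  CochainComplex.isZero_of_isStrictlyLE _ 0 _

lemma exactAt_cochainComplex {p : ℤ} (hp : p < 0) : P.cochainComplex.ExactAt p :=
  CochainComplex.exactAt_of_isGE _ 0 _

lemma bcClass_units_smul (k : ℕ) (n i : ℤ) (h : k - i = n) (c : ℤˣ)
    (f : syz P.cochainComplex k ⟶ syz Q.cochainComplex n) :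
    bcClass 𝕜 P Q k n i h (c • f) = (c : ℤ) • bcClass 𝕜 P Q k n i h f := by
  rw [Units.smul_def, bcClass_zsmul]

lemma negOnePow_mul_succ (i k : ℤ) :
    ((i * (k + 1)).negOnePow : ℤ) = (i * k).negOnePow * i.negOnePow := by
  rw [mul_add, mul_one, Int.negOnePow_add, Units.val_mul]

variable {P Q}

/-- Raising the level by one costs a factor `(-1)ⁱ`, which is the quotient of the signs at
consecutive levels. The signed class is therefore independent of the level. -/
lemma Induces.exists_bcClass_eq {i : ℤ} {φ : Cochain P.cochainComplex Q.cochainComplex i}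
    {k n : ℕ} {h : (k : ℤ) - i = n} {f : syz P.cochainComplex k ⟶ syz Q.cochainComplex n}
    (hf : Induces φ k n h f) (m : ℕ) :
    ∃ f', Induces φ (k + m : ℕ) (n + m : ℕ) (by push_cast; lia) f' ∧
      bcClass 𝕜 P Q (k + m) (n + m : ℕ) i (by push_cast; lia)
        ((i * (k + m : ℕ)).negOnePow • f') = bcClass 𝕜 P Q k n i h ((i * k).negOnePow • f) := by
  induction m with
  | zero => exact ⟨f, hf, rfl⟩
  | succ m ih =>
    obtain ⟨f', hf', h1⟩ := ih
    obtain ⟨f'', hf''⟩ := hf'.exists_succ (k + (m + 1) : ℕ) (n + (m + 1) : ℕ)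
      (by push_cast; ring) (by push_cast; lia)
    obtain ⟨Φ, hΦ, hΦ'⟩ := hf'.exists_hom (by push_cast; ring) hf''
    refine ⟨f'', hf'', Eq.trans ?_ h1⟩
    have h2 : bcClass 𝕜 P Q (k + (m + 1)) (n + (m + 1) : ℕ) i (by push_cast; lia)
        (i.negOnePow • f'') = bcClass 𝕜 P Q (k + m) (n + m : ℕ) i (by push_cast; lia) f' :=
      bcClass_eq_of_hom 𝕜 P Q _ _ (by positivity) Φ hΦ' hΦ
    rw [bcClass_units_smul] at h2
    rw [bcClass_units_smul, bcClass_units_smul, ← h2, smul_smul, ← negOnePow_mul_succ]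
    push_cast
    ring_nf

lemma Induces.exists_bcClass_eq_of_le {i : ℤ}
    {φ : Cochain P.cochainComplex Q.cochainComplex i}
    {k n : ℕ} {h : (k : ℤ) - i = n} {f : syz P.cochainComplex k ⟶ syz Q.cochainComplex n}
    (hf : Induces φ k n h f) {k' n' : ℕ} (hk : k ≤ k') (h' : (k' : ℤ) - i = n') :
    ∃ f', Induces φ k' n' h' f' ∧ bcClass 𝕜 P Q k' n' i h' ((i * k').negOnePow • f') =
      bcClass 𝕜 P Q k n i h ((i * k).negOnePow • f) := by
  obtain ⟨m, rfl⟩ := Nat.exists_eq_add_of_le hk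
  obtain rfl : n' = n + m := by push_cast at h'; lia
  exact hf.exists_bcClass_eq m

variable (𝕜 P Q)

/-- The correspondence between classes in stable cohomology and in Benson-Carlson cohomology given
by a cochain which is a chain map in high degrees. -/
def ComparisonRel (i : ℤ)
    (x : (stableHomRes 𝕜 P Q).homology i)
    (y : bcColim 𝕜 P Q i) : Prop :=
  ∃ (c : (stableHomRes 𝕜 P Q).cycles i)
    (φ : Cochain P.cochainComplex Q.cochainComplex i) (k n : ℕ) (h : (k : ℤ) - i = n)
    (f : syz P.cochainComplex k ⟶ syz Q.cochainComplex n),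
    (stableHomRes 𝕜 P Q).homologyπ i c = x ∧
    (stableHomRes 𝕜 P Q).iCycles i c = stableHomMk 𝕜 φ ∧ Induces φ k n h f ∧
    bcClass 𝕜 P Q k n i h ((i * k).negOnePow • f) = y

variable {𝕜 P Q}

/-- A cocycle of the quotient complex is a cochain whose differential has finite support, hence a
chain map up to sign in high degrees. Adding `i.toNat` to the level makes `k - i` nonnegative. -/
lemma exists_induces_of_iCycles_eq {i : ℤ}
    {c : (stableHomRes 𝕜 P Q).cycles i}
    {φ : Cochain P.cochainComplex Q.cochainComplex i}
    (hφ : (stableHomRes 𝕜 P Q).iCycles i c = stableHomMk 𝕜 φ) :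
    ∃ (k n : ℕ) (h : (k : ℤ) - i = n) (f : syz P.cochainComplex k ⟶ syz Q.cochainComplex n),
      Induces φ k n h f := by
  have h1 : stableHomMk 𝕜 (δ i (i + 1) φ) = 0 := by
    rw [← stableHomComplex_d_mk, ← hφ]
    exact congr($((stableHomRes 𝕜 P Q).iCycles_d i (i + 1)) c)
  obtain ⟨k₀, hk₀⟩ := exists_v_eq_zero_of_mem_boundedCochain ((stableHomMk_eq_zero_iff 𝕜 _).1 h1)
  have h2 : ((k₀ + i.toNat : ℕ) : ℤ) - i = (k₀ + i.toNat - i : ℤ).toNat := by push_cast; lia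
  obtain ⟨f, hf⟩ := exists_induces (φ := φ) _ _ h2 (hk₀ _ (by lia))
  exact ⟨_, _, h2, f, hf⟩

lemma ComparisonRel.exists (i : ℤ)
    (x : (stableHomRes 𝕜 P Q).homology i) :
    ∃ y, ComparisonRel 𝕜 P Q i x y := by
  obtain ⟨c, rfl⟩ := homologyπ_surjective _ i x
  obtain ⟨φ, hφ⟩ := stableHomMk_surjective 𝕜 ((stableHomRes 𝕜 P Q).iCycles i c)
  obtain ⟨k, n, h, f, hf⟩ := exists_induces_of_iCycles_eq hφ.symm
  exact ⟨_, c, φ, k, n, h, f, rfl, hφ.symm, hf, rfl⟩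

lemma ComparisonRel.add {i : ℤ}
    {x x' : (stableHomRes 𝕜 P Q).homology i}
    {y y' : bcColim 𝕜 P Q i} (h : ComparisonRel 𝕜 P Q i x y) (h' : ComparisonRel 𝕜 P Q i x' y') :
    ComparisonRel 𝕜 P Q i (x + x') (y + y') := by
  obtain ⟨c, φ, k, n, h, f, rfl, hφ, hf, rfl⟩ := h
  obtain ⟨c', φ', k', n', h', f', rfl, hφ', hf', rfl⟩ := h'
  -- Both representatives are moved to the common level `k + k'`.
  have hl : ((k + k' : ℕ) : ℤ) - i = (n + k' : ℕ) := by push_cast; lia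
  obtain ⟨g, hg, hy⟩ := hf.exists_bcClass_eq_of_le (𝕜 := 𝕜) (Nat.le_add_right k k') hl
  obtain ⟨g', hg', hy'⟩ := hf'.exists_bcClass_eq_of_le (𝕜 := 𝕜) (Nat.le_add_left k' k) hl
  rw [← hy, ← hy']
  refine ⟨c + c', φ + φ', _, _, _, g + g', map_add _ _ _, ?_, hg.add hg', ?_⟩
  · rw [map_add, hφ, hφ', stableHomMk_add]
  · rw [smul_add, bcClass_add]

lemma ComparisonRel.smul {i : ℤ} (a : 𝕜)
    {x : (stableHomRes 𝕜 P Q).homology i}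
    {y : bcColim 𝕜 P Q i} (h : ComparisonRel 𝕜 P Q i x y) :
    ComparisonRel 𝕜 P Q i (a • x) (a • y) := by
  obtain ⟨c, φ, k, n, h, f, rfl, hφ, hf, rfl⟩ := h
  refine ⟨a • c, a • φ, k, n, h, a • f, map_smul _ _ _, ?_, hf.smul a, ?_⟩
  · rw [map_smul, hφ]
    rfl
  · rw [smul_comm, bcClass_smul]

/-- In high degrees `φ = δ ψ`. Of the two terms of `δ ψ`, one ends in a boundary and vanishes on the
syzygy; the other begins with the differential of `P`, so the induced map factors through a
projective term of `P`. -/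
lemma ComparisonRel.eq_zero {i : ℤ} {y : bcColim 𝕜 P Q i} (h : ComparisonRel 𝕜 P Q i 0 y) :
    y = 0 := by
  obtain ⟨c, φ, k, n, h, f, h0, hφ, hf, rfl⟩ := h
  obtain ⟨w, hw⟩ := (homologyπ_eq_zero_iff _ (show i - 1 + 1 = i by ring) c).1 h0
  obtain ⟨ψ, rfl⟩ := stableHomMk_surjective 𝕜 w
  have h1 : φ - δ (i - 1) i ψ ∈ boundedCochain 𝕜 _ _ _ := by
    refine (Submodule.Quotient.eq (boundedCochain 𝕜 _ _ _)).1 ?_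
    exact hφ.symm.trans hw.symm
  obtain ⟨k₀, hk₀⟩ := exists_v_eq_zero_of_mem_boundedCochain h1
  obtain ⟨f', hf', hy⟩ := hf.exists_bcClass_eq (𝕜 := 𝕜) (k₀ + 1)
  rw [← hy]
  have h2 : φ.v (-(k + (k₀ + 1) : ℕ)) (-(n + (k₀ + 1) : ℕ)) (by push_cast; lia) =
      (δ (i - 1) i ψ).v (-(k + (k₀ + 1) : ℕ)) (-(n + (k₀ + 1) : ℕ)) (by push_cast; lia) := by
    rw [← sub_eq_zero, ← Cochain.sub_v]
    exact hk₀ k₀ le_rfl _ _ _ (by push_cast; lia)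
  have h3 : f' = i.negOnePow • (syzIncl P.cochainComplex ((k + (k₀ + 1) : ℕ) - 1) _ ≫
      ψ.v (-((k + (k₀ + 1) : ℕ) - 1)) (-(n + (k₀ + 1) : ℕ)) (by push_cast; lia) ≫
      syzProj Q.cochainComplex _) := by
    rw [← cancel_epi (syzProj _ _), hf'.syzProj_comp, h2, δ_v (i - 1) i (by ring) ψ _ _ _
      (-((n + (k₀ + 1) : ℕ) + 1)) (-((k + (k₀ + 1) : ℕ) - 1)) (by push_cast; lia)
      (by push_cast; lia), Preadditive.add_comp, Category.assoc, d_syzProj, comp_zero, zero_add,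
      Linear.comp_units_smul, Linear.units_smul_comp, syzProj_syzIncl_assoc, Category.assoc]
  have h4 : f' - (0 : 𝕜) • f' ∈ projFactor 𝕜 _ _ := by
    rw [zero_smul, sub_zero, h3]
    exact ⟨P.cochainComplex.X (-((k + (k₀ + 1) : ℕ) - 1)), inferInstance, syzIncl _ _ _,
      i.negOnePow • (ψ.v _ _ _ ≫ syzProj _ _), Linear.comp_units_smul _ _ _⟩
  rw [bcClass_units_smul, bcClass_eq_of_sub_mem 𝕜 P Q h4, bcClass_smul, zero_smul, smul_zero]

end Comparison

/-! ### Bijectivity and naturality of the comparison -/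

section ComparisonBijective

variable {𝕜 : Type t} [CommRing 𝕜] {C : Type u} [Category.{v} C] [Abelian C] [Linear 𝕜 C]
  {M : C} {P : ProjectiveResolution M} {N : C} {Q : ProjectiveResolution N}

/-- The map of syzygies is lifted to `Pₖ ⟶ Qₙ` and extended to a chain map up to sign in higher
homological degrees. The differential of the resulting cochain has finite support, which is all that
a cocycle of the quotient complex requires. -/
lemma ComparisonRel.exists_left {i : ℤ} (y : bcColim 𝕜 P Q i) :
    ∃ x, ComparisonRel 𝕜 P Q i x y := by
  obtain ⟨k, n, h, f, rfl⟩ := exists_bcClass_eq 𝕜 P Q y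
  obtain ⟨s, hs⟩ : ∃ s : P.cochainComplex.X (-k) ⟶ Q.cochainComplex.X (-n),
      s ≫ syzProj Q.cochainComplex n =
        -- The sign is inserted here so that it cancels against the one in `ComparisonRel`.
        syzProj P.cochainComplex k ≫ ((i * k).negOnePow • f) :=
    ⟨_, Projective.factorThru_comp _ _⟩
  obtain ⟨z, hz, hz'⟩ := exists_cochain_δ_eq (K := P.cochainComplex) (L := Q.cochainComplex)
    (n := i) (m := i + 1) rfl 0 (p₀ := -k) (q₀ := -n) (by lia)
    (fun _ _ => inferInstance) (fun q hq => exactAt_cochainComplex Q (by lia))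
    (fun p q hpq _ => by rw [δ_zero, Cochain.zero_v]) s (fun p hp => by
      rw [Cochain.zero_v, zero_sub, Preadditive.neg_comp, Linear.units_smul_comp,
        Category.assoc]
      obtain rfl : p = -(k + 1) := by lia
      have h1 : P.cochainComplex.d (-(k + 1)) (-k) ≫ s ≫ syzProj Q.cochainComplex n = 0 := by
        rw [hs, ← Category.assoc, d_syzProj, zero_comp]
      have h2 : -((i + 1).negOnePow • P.cochainComplex.d (-(k + 1)) (-k) ≫ s ≫
          syzProj Q.cochainComplex n) = 0 := by rw [h1, smul_zero, neg_zero]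
      exact h2)
  have hzf : Induces z k n h ((i * k).negOnePow • f) :=
    ⟨fun p q hpq hp => hz' p q hpq hp, by rw [← hs, hz]⟩
  have h0 : (stableHomRes 𝕜 P Q).d i (i + 1) (stableHomMk 𝕜 z) = 0 := by
    rw [stableHomComplex_d_mk, stableHomMk_eq_zero_iff]
    exact mem_boundedCochain_of_v_eq_zero k (fun p hp => isZero_cochainComplex_X P hp) hz'
  obtain ⟨c, hc⟩ := exists_iCycles_eq _ rfl h0
  refine ⟨_, c, z, k, n, h, _, rfl, hc, hzf, ?_⟩
  rw [smul_smul, ← Int.negOnePow_add, Int.negOnePow_even _ ⟨_, rfl⟩, one_smul]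

lemma sub_zsmul_τ₁_mem_projFactor {S T : ShortComplex C} [Projective S.X₂] (hT : T.ShortExact)
    {φ ψ : S ⟶ T} {ε : ℤ} (h : φ.τ₃ - ε • ψ.τ₃ ∈ projFactor 𝕜 S.X₃ T.X₃) :
    φ.τ₁ - ε • ψ.τ₁ ∈ projFactor 𝕜 S.X₁ T.X₁ :=
  connecting_mem hT h (g := φ.τ₂ - ε • ψ.τ₂) (by
    rw [Preadditive.sub_comp, Preadditive.zsmul_comp, φ.comm₂₃, ψ.comm₂₃, Preadditive.comp_sub,
      Preadditive.comp_zsmul]) (by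
    rw [Preadditive.comp_sub, Preadditive.comp_zsmul, ← φ.comm₁₂, ← ψ.comm₁₂,
      Preadditive.sub_comp, Preadditive.zsmul_comp])

/-- The maps induced by `φ` and the successive transitions of `g` agree modulo projectives up to a
sign, which changes by `(-1)ⁱ` per level. When `g` becomes trivial, so does the map induced by `φ`.
-/
lemma Induces.exists_mem_projFactor_of_dies {i : ℤ} {m : ℕ} {k n : ℕ} {h : (k : ℤ) - i = n}
    {φ : Cochain P.cochainComplex Q.cochainComplex i}
    {f g : syz P.cochainComplex k ⟶ syz Q.cochainComplex n} (hf : Induces φ k n h f) (ε : ℤ)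
    (hg : Dies 𝕜 P Q m k n g) (hfg : f - ε • g ∈ projFactor 𝕜 _ _) :
    ∃ (k' n' : ℕ) (h' : (k' : ℤ) - i = n') (f' : _), Induces φ k' n' h' f' ∧
      f' ∈ projFactor 𝕜 _ _ := by
  induction m generalizing k n ε with
  | zero =>
    refine ⟨k, n, h, f, hf, ?_⟩
    have h1 := add_mem hfg (zsmul_mem (show g ∈ projFactor 𝕜 _ _ from hg) ε)
    rwa [sub_add_cancel] at h1
  | succ m ih =>
    obtain ⟨Ψ, hΨ, g', hg', hd⟩ := hg
    obtain ⟨f', hf'⟩ := hf.exists_succ (k + 1 : ℕ) (n + 1 : ℕ) (by push_cast; ring)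
      (by push_cast; lia)
    obtain ⟨Φ, hΦ, hΦ'⟩ := hf.exists_hom (by push_cast; ring) hf'
    refine ih hf' (i.negOnePow * ε) hd ?_
    have hS := syzSeq_shortExact Q (show (n : ℤ) + 1 = (n + 1 : ℕ) by push_cast; ring)
      (by positivity)
    have h1 : (i.negOnePow • f') - ε • g' ∈ projFactor 𝕜 _ _ := by
      subst hΨ hΦ' hg'
      rw [← hΦ]
      exact sub_zsmul_τ₁_mem_projFactor (S := syzSeq P.cochainComplex k (k + 1 : ℕ)) (φ := Φ)
        (ψ := Ψ) hS hfg
    have h2 := zsmul_mem h1 (i.negOnePow : ℤ)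
    rwa [smul_sub, smul_smul, ← Units.smul_def, smul_smul, ← Int.negOnePow_add,
      Int.negOnePow_even _ ⟨_, rfl⟩, one_smul] at h2

/-- At a high level the induced map factors through a projective and lifts to `e : Pₖ ⟶ Qₙ`. Then
`φₖ - e` takes values in boundaries, which gives the first component of a null-homotopy; the
remaining ones exist by lifting. -/
lemma ComparisonRel.eq_zero_left {i : ℤ} {x : (stableHomRes 𝕜 P Q).homology i}
    (hx : ComparisonRel 𝕜 P Q i x 0) : x = 0 := by
  obtain ⟨c, φ, k, n, h, f, rfl, hφ, hf, h0⟩ := hx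
  obtain ⟨m, hm⟩ := exists_dies_of_bcClass_eq_zero 𝕜 P Q h0
  obtain ⟨k, n, h, f, hf, L, hL, a, b, rfl⟩ := hf.exists_mem_projFactor_of_dies
    ((i * k).negOnePow : ℤ) hm (by
      rw [← Units.smul_def, smul_smul, ← Int.negOnePow_add, Int.negOnePow_even _ ⟨_, rfl⟩,
        one_smul, sub_self]
      exact zero_mem _)
  have hb : Projective.factorThru b (syzProj Q.cochainComplex n) ≫ syzProj Q.cochainComplex n =
    b := Projective.factorThru_comp _ _
  obtain ⟨e, he⟩ : ∃ e : P.cochainComplex.X (-k) ⟶ Q.cochainComplex.X (-n),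
      e = syzProj _ _ ≫ a ≫ Projective.factorThru b (syzProj Q.cochainComplex n) := ⟨_, rfl⟩
  have he' : e ≫ syzProj Q.cochainComplex n =
      φ.v (-k) (-n) (by lia) ≫ syzProj Q.cochainComplex n := by
    rw [he, Category.assoc, Category.assoc, hb, hf.syzProj_comp]
  obtain ⟨s, hs⟩ := exists_comp_d_eq (L := Q.cochainComplex) (q := -n) (q' := -n - 1) (by ring)
    (φ.v (-k) (-n) (by lia) - e) (by
      rw [Preadditive.sub_comp, sub_eq_zero]
      exact he'.symm)
  -- Since `e` factors through the syzygy, the correction by `e` does not disturb the equations in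
  -- higher homological degrees.
  have hde : P.cochainComplex.d (-(k + 1)) (-k) ≫ e = 0 := by
    rw [he, ← Category.assoc, d_syzProj, zero_comp]
  obtain ⟨ψ, -, hψ⟩ := exists_cochain_δ_eq (K := P.cochainComplex) (L := Q.cochainComplex)
    (n := i - 1) (m := i) (by ring) φ (p₀ := -k) (q₀ := -n - 1) (by lia)
    (fun _ _ => inferInstance) (fun q hq => exactAt_cochainComplex Q (by lia))
    (fun p q hpq hp => hf.δ_v_eq_zero p q hpq (by lia)) s (fun p hp => by
      obtain rfl : p = -(k + 1) := by lia
      refine comp_pOpcycles_eq_zero (q' := -n) (by ring) (exactAt_cochainComplex Q (by lia)) _ ?_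
      have h1 := hf.δ_v_eq_zero (-(k + 1)) (-n) (by lia) (by lia)
      rw [δ_v i (i + 1) rfl φ _ _ _ (-n - 1) (-k) (by lia) (by lia), Int.negOnePow_succ,
        Units.neg_smul, add_neg_eq_zero] at h1
      rw [Preadditive.sub_comp, Linear.units_smul_comp, Category.assoc, hs,
        Preadditive.comp_sub, hde, sub_zero, h1, sub_self])
  have h1 : φ - δ (i - 1) i ψ ∈ boundedCochain 𝕜 _ _ _ :=
    mem_boundedCochain_of_v_eq_zero k (fun p hp => isZero_cochainComplex_X P hp)
      fun p q hpq hp => by rw [Cochain.sub_v, hψ p q hpq hp, sub_self]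
  rw [homologyπ_eq_zero_iff _ (show i - 1 + 1 = i by ring)]
  exact ⟨stableHomMk 𝕜 ψ, ((Submodule.Quotient.eq _).2 h1).symm.trans hφ.symm⟩

lemma ComparisonRel.map {N' : C} {Q' : ProjectiveResolution N'}
    (g : Q.cochainComplex ⟶ Q'.cochainComplex) {i : ℤ} {x : (stableHomRes 𝕜 P Q).homology i}
    {y : bcColim 𝕜 P Q i} (h : ComparisonRel 𝕜 P Q i x y) :
    ComparisonRel 𝕜 P Q' i
      (HomologicalComplex.homologyMap (stableHomMap 𝕜 P.cochainComplex g) i x)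
      (bcColimMap 𝕜 P Q Q' g i y) := by
  obtain ⟨c, φ, k, n, h, f, rfl, hφ, hf, rfl⟩ := h
  refine ⟨HomologicalComplex.cyclesMap (stableHomMap 𝕜 P.cochainComplex g) i c,
    φ.comp (Cochain.ofHom g) (add_zero i), k, n, h, f ≫ syzMap g n, ?_, ?_, hf.comp_ofHom g, ?_⟩
  · exact congr($(HomologicalComplex.homologyπ_naturality
      (stableHomMap 𝕜 P.cochainComplex g) i) c).symm
  · refine congr($(HomologicalComplex.cyclesMap_i
      (stableHomMap 𝕜 P.cochainComplex g) i) c).trans ?_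
    refine (congrArg ((stableHomMap 𝕜 P.cochainComplex g).f i) hφ).trans ?_
    exact stableHomMap_f_mk 𝕜 P.cochainComplex g φ
  · rw [bcColimMap_bcClass, Linear.units_smul_comp]

end ComparisonBijective

/-! ### The comparison respects connecting maps -/

section ComparisonConnecting

variable {𝕜 : Type t} [CommRing 𝕜] {C : Type u} [Category.{v} C] [Abelian C] [Linear 𝕜 C]
  {M : C} {P : ProjectiveResolution M}

lemma shortExact_δ_homologyπ {S : ShortComplex (CochainComplex (ModuleCat.{v} 𝕜) ℤ)}
    (hS : S.ShortExact) {i j : ℤ} (hij : i + 1 = j) (c₃ : S.X₃.cycles i) (x₂ : S.X₂.X i)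
    (h₂ : S.g.f i x₂ = S.X₃.iCycles i c₃) (c₁ : S.X₁.cycles j)
    (h₁ : S.f.f j (S.X₁.iCycles j c₁) = S.X₂.d i j x₂) :
    hS.δ i j (by simpa using hij) (S.X₃.homologyπ i c₃) = S.X₁.homologyπ j c₁ := by
  refine hS.δ_apply' i j (by simpa using hij) _ (S.X₂.pOpcycles i x₂) c₁ ?_ ?_
  · refine congr($(HomologicalComplex.p_opcyclesMap S.g i) x₂).trans ?_
    refine (congrArg (S.X₃.pOpcycles i) h₂).trans ?_
    exact congr($(S.X₃.homology_π_ι (i := i)) c₃).symm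
  · refine iCycles_injective S.X₂ j ?_
    refine congr($(HomologicalComplex.cyclesMap_i S.f j) c₁).trans (h₁.trans ?_)
    have h : S.X₂.pOpcycles i ≫ S.X₂.opcyclesToCycles i j ≫ S.X₂.iCycles j = S.X₂.d i j := by
      rw [HomologicalComplex.pOpcycles_opcyclesToCycles_assoc, HomologicalComplex.toCycles_i]
    exact congr($h x₂).symm

variable {S : ShortComplex C} (hS : S.ShortExact) {Q₁ : ProjectiveResolution S.X₁}
  {Q₃ : ProjectiveResolution S.X₃} (H : Horseshoe S Q₁ Q₃)

lemma ComparisonRel.connecting {i j : ℤ} (hij : i + 1 = j)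
    {x : (stableHomRes 𝕜 P Q₃).homology i} {y : bcColim 𝕜 P Q₃ i}
    (h : ComparisonRel 𝕜 P Q₃ i x y) :
    ComparisonRel 𝕜 P Q₁ j (stableδ 𝕜 P.cochainComplex H i j hij x) (bcδ 𝕜 P hS H i j hij y) := by
  subst hij
  obtain ⟨c, φ, k, n, h, f, rfl, hφ, hf, rfl⟩ := h
  let F : Q₁.cochainComplex ⟶ H.mid.cochainComplex := H.shortComplex.f
  let G : H.mid.cochainComplex ⟶ Q₃.cochainComplex := H.shortComplex.g
  let σ (n : ℤ) : (H.shortComplex.map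
      (HomologicalComplex.eval C (ComplexShape.up ℤ) n)).Splitting :=
    have : Projective (H.shortComplex.map
          (HomologicalComplex.eval C (ComplexShape.up ℤ) n)).X₃ :=
        inferInstanceAs (Projective (Q₃.cochainComplex.X n))
    (H.shortComplex_shortExact.map_of_exact _).splittingOfProjective
  let r : Cochain H.mid.cochainComplex Q₁.cochainComplex 0 := Cochain.ofHoms fun n => (σ n).r
  let s : Cochain Q₃.cochainComplex H.mid.cochainComplex 0 := Cochain.ofHoms fun n => (σ n).s
  have hr (n : ℤ) : r.v n n (add_zero n) = (σ n).r := Cochain.ofHoms_v _ _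
  have hs (n : ℤ) : s.v n n (add_zero n) = (σ n).s := Cochain.ofHoms_v _ _
  have sg (n : ℤ) : s.v n n (add_zero n) ≫ G.f n = 𝟙 _ := by
    rw [hs]
    exact (σ n).s_g
  have idd (n : ℤ) : r.v n n (add_zero n) ≫ F.f n + G.f n ≫ s.v n n (add_zero n) = 𝟙 _ := by
    rw [hr, hs]
    exact (σ n).id
  have hF (n : ℤ) : Mono (F.f n) := (σ n).mono_f
  -- The snake map by hand: `φ` is lifted with the degreewise section `s`, and the retraction `r`
  -- brings `δ φ'` back to `Q₁`. As `δ φ` vanishes only in high degrees, so `χ` maps to `δ φ'` only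
  -- there, which suffices in the quotient complex.
  let φ' : Cochain P.cochainComplex H.mid.cochainComplex i := φ.comp s (add_zero i)
  have hφ'v (p q : ℤ) (hpq : p + i = q) : φ'.v p q hpq ≫ G.f q = φ.v p q hpq := by
    rw [Cochain.comp_zero_cochain_v, Category.assoc, sg, Category.comp_id]
  have hφ' : φ'.comp (Cochain.ofHom G) (add_zero i) = φ := by
    ext p q hpq
    rw [Cochain.comp_zero_cochain_v, Cochain.ofHom_v, hφ'v]
  let χ : Cochain P.cochainComplex Q₁.cochainComplex (i + 1) :=
    (δ i (i + 1) φ').comp r (add_zero _)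
  have hχ (p q : ℤ) (hpq : p + (i + 1) = q) (hp : p < -k) :
      χ.v p q hpq ≫ F.f q = (δ i (i + 1) φ').v p q hpq := by
    have h1 : (δ i (i + 1) φ').v p q hpq ≫ G.f q = 0 := by
      have h3 : δ i (i + 1) φ = (δ i (i + 1) φ').comp (Cochain.ofHom G) (add_zero _) := by
        rw [← δ_comp_ofHom, hφ']
      rw [← hf.δ_v_eq_zero p q hpq hp, h3, Cochain.comp_zero_cochain_v, Cochain.ofHom_v]
    have h2 := congr((δ i (i + 1) φ').v p q hpq ≫ $(idd q))
    rw [Preadditive.comp_add, ← Category.assoc _ (G.f q), h1, zero_comp, add_zero,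
      Category.comp_id] at h2
    rw [Cochain.comp_zero_cochain_v, Category.assoc, h2]
  have hδχ (p q : ℤ) (hpq : p + (i + 1 + 1) = q) (hp : p < -(k + 1 : ℕ)) :
      (δ (i + 1) (i + 1 + 1) χ).v p q hpq = 0 := by
    push_cast at hp
    rw [← cancel_mono (F.f q), zero_comp, δ_v (i + 1) (i + 1 + 1) rfl χ p q hpq (q - 1) (p + 1) rfl rfl,
      Preadditive.add_comp, Category.assoc, ← F.comm, Linear.units_smul_comp, Category.assoc,
      hχ _ _ _ (by lia), ← Category.assoc, hχ _ _ _ (by lia)]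
    have h1 : (δ (i + 1) (i + 1 + 1) (δ i (i + 1) φ')).v p q hpq = 0 := by
      rw [δ_δ, Cochain.zero_v]
    rwa [δ_v (i + 1) (i + 1 + 1) rfl _ p q hpq (q - 1) (p + 1) rfl rfl] at h1
  have hk : ((k + 1 : ℕ) : ℤ) - (i + 1) = n := by push_cast; lia
  obtain ⟨g, hg⟩ := exists_induces (φ := χ) (k + 1 : ℕ) n hk hδχ
  have h0 : (stableHomRes 𝕜 P Q₁).d (i + 1) (i + 1 + 1) (stableHomMk 𝕜 χ) = 0 := by
    rw [stableHomComplex_d_mk, stableHomMk_eq_zero_iff]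
    exact mem_boundedCochain_of_v_eq_zero _ (fun p hp => isZero_cochainComplex_X P hp) hδχ
  obtain ⟨c₁, hc₁⟩ := exists_iCycles_eq _ rfl h0
  have hχF : χ.comp (Cochain.ofHom F) (add_zero _) - δ i (i + 1) φ' ∈
      boundedCochain 𝕜 P.cochainComplex H.mid.cochainComplex (i + 1) := by
    refine mem_boundedCochain_of_v_eq_zero k (fun p hp => isZero_cochainComplex_X P hp)
      fun p q hpq hp => ?_
    rw [Cochain.sub_v, sub_eq_zero, Cochain.comp_zero_cochain_v, Cochain.ofHom_v, hχ p q hpq hp]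
  have hφ'f : (φ'.v (-k) (-n) (by lia) ≫ syzProj H.mid.cochainComplex n) ≫ syzMap G n =
      syzProj P.cochainComplex k ≫ f := by
    rw [Category.assoc, syzProj_syzMap, ← Category.assoc, hφ'v, hf.syzProj_comp]
  refine ⟨c₁, χ, k + 1, n, hk, g, ?_, hc₁, hg, ?_⟩
  · refine (shortExact_δ_homologyπ (S := stableHomShortComplex 𝕜 P.cochainComplex H.shortComplex)
      _ rfl c (stableHomMk 𝕜 φ') ?_ c₁ ?_).symm
    · exact (congrArg (stableHomMk 𝕜) hφ').trans hφ.symm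
    · refine (congrArg ((stableHomMap 𝕜 P.cochainComplex F).f (i + 1)) hc₁).trans ?_
      refine (Submodule.Quotient.eq (boundedCochain 𝕜 _ _ _)).2 ?_
      exact hχF
  -- The lift `φ'` also supplies the middle component of the morphism computing the Benson-Carlson
  -- connecting map, whose left component is `g` up to `(-1)ⁱ⁺¹`.
  · have hΦ : ((i + 1).negOnePow • g) ≫ syzMap F n =
        syzIncl P.cochainComplex k (k + 1 : ℕ) ≫
          φ'.v (-k) (-n) (by lia) ≫ syzProj H.mid.cochainComplex n := by
      have h1 := hχ (-(k + 1 : ℕ)) (-n) (by push_cast; lia) (by push_cast; lia)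
      rw [δ_v i (i + 1) rfl φ' _ _ _ (-(n + 1)) (-k) (by lia) (by push_cast; lia)] at h1
      have h2 := congr($h1 ≫ syzProj _ n)
      rw [Preadditive.add_comp, Category.assoc (φ'.v _ _ _), d_syzProj, comp_zero, zero_add,
        Linear.units_smul_comp, Category.assoc, Category.assoc] at h2
      rw [← cancel_epi (syzProj _ _), syzProj_syzIncl_assoc, Linear.units_smul_comp,
        Linear.comp_units_smul, ← Category.assoc (syzProj _ _) g, hg.syzProj_comp,
        Category.assoc, syzProj_syzMap, h2, smul_smul, ← Int.negOnePow_add,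
        Int.negOnePow_even _ ⟨_, rfl⟩, one_smul]
    let Φ : syzSeq P.cochainComplex k (k + 1 : ℕ) ⟶ syzShortComplex H.shortComplex n :=
      { τ₁ := ((i + 1).negOnePow • g : syz P.cochainComplex (k + 1 : ℕ) ⟶ syz Q₁.cochainComplex n)
        τ₂ := φ'.v (-k) (-n) (by lia) ≫ syzProj H.mid.cochainComplex n
        τ₃ := f
        comm₁₂ := hΦ
        comm₂₃ := hφ'f }
    have h1 := bcδ_bcClass 𝕜 P hS H (i := i) rfl h hk (by positivity) Φ (f := f) rfl
      (g := (i + 1).negOnePow • g) rfl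
    rw [bcClass_units_smul, bcClass_units_smul, map_zsmul, h1, bcClass_units_smul, smul_smul,
      smul_smul]
    congr 1
    -- The signs agree because `ik + k + (i + 1) = (i + 1)(k + 1)`.
    rw [← Int.coe_negOnePow_natCast, ← Units.val_mul, ← Units.val_mul, ← Int.negOnePow_add,
      ← Int.negOnePow_add]
    congr 2
    push_cast
    ring

end ComparisonConnecting

/-! ### Functoriality and long exact sequences of stable cohomology -/

section StableMaps

variable (𝕜 : Type t) [CommRing 𝕜] {C : Type u} [Category.{v} C] [Abelian C] [Linear 𝕜 C]
  {M : C} (P : ProjectiveResolution M)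

/-- The map in stable cohomology induced by a chain map between projective resolutions. -/
noncomputable def stableMap {N N' : C} {Q : ProjectiveResolution N} {Q' : ProjectiveResolution N'}
    (a : Q.complex ⟶ Q'.complex) (i : ℤ) :
    (stableHomRes 𝕜 P Q).homology i ⟶ (stableHomRes 𝕜 P Q').homology i :=
  HomologicalComplex.homologyMap (stableHomMap 𝕜 P.cochainComplex
    (HomologicalComplex.extendMap a ComplexShape.embeddingDownNat)) i

variable {N N' N'' : C} {Q : ProjectiveResolution N} {Q' : ProjectiveResolution N'}
  {Q'' : ProjectiveResolution N''}

lemma stableMap_id (i : ℤ) : stableMap 𝕜 P (𝟙 Q.complex) i = 𝟙 _ := by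
  rw [stableMap, HomologicalComplex.extendMap_id]
  exact (congrArg (HomologicalComplex.homologyMap · i)
    (stableHomMap_id 𝕜 P.cochainComplex Q.cochainComplex)).trans
    (HomologicalComplex.homologyMap_id _ i)

lemma stableMap_comp (a : Q.complex ⟶ Q'.complex) (b : Q'.complex ⟶ Q''.complex) (i : ℤ) :
    stableMap 𝕜 P (a ≫ b) i = stableMap 𝕜 P a i ≫ stableMap 𝕜 P b i := by
  rw [stableMap, HomologicalComplex.extendMap_comp, stableHomMap_comp]
  exact HomologicalComplex.homologyMap_comp _ _ i

lemma stableMap_add (a b : Q.complex ⟶ Q'.complex) (i : ℤ) :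
    stableMap 𝕜 P (a + b) i = stableMap 𝕜 P a i + stableMap 𝕜 P b i := by
  have h : ∀ a b : Q.cochainComplex ⟶ Q'.cochainComplex, stableHomMap 𝕜 P.cochainComplex (a + b) =
      stableHomMap 𝕜 P.cochainComplex a + stableHomMap 𝕜 P.cochainComplex b := by
    intro a b
    ext n : 1
    refine stableHomComplex_hom_ext 𝕜 fun z => congrArg (stableHomMk 𝕜) ?_
    change z.comp (Cochain.ofHom (a + b)) (add_zero n) =
      z.comp (Cochain.ofHom a) (add_zero n) + z.comp (Cochain.ofHom b) (add_zero n)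
    rw [Cochain.ofHom_add, Cochain.comp_add]
  rw [stableMap, HomologicalComplex.extendMap_add]
  exact (congrArg (HomologicalComplex.homologyMap · i) (h _ _)).trans
    (HomologicalComplex.homologyMap_add _ _ i)

lemma stableMap_eq_of_homotopy {a b : Q.complex ⟶ Q'.complex} (h : Homotopy a b) (i : ℤ) :
    stableMap 𝕜 P a i = stableMap 𝕜 P b i :=
  (stableHomHomotopy 𝕜 P.cochainComplex (h.extend _)).homologyMap_eq i

lemma stableMap_eq_of_lift (f : N ⟶ N') {a b : Q.complex ⟶ Q'.complex}
    (ha : a ≫ Q'.π = Q.π ≫ (ChainComplex.single₀ C).map f)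
    (hb : b ≫ Q'.π = Q.π ≫ (ChainComplex.single₀ C).map f) (i : ℤ) :
    stableMap 𝕜 P a i = stableMap 𝕜 P b i :=
  stableMap_eq_of_homotopy 𝕜 P (ProjectiveResolution.liftHomotopy f a b ha hb) i

lemma comp_π_of_comp_aug {f : N ⟶ N'} {a : Q.complex ⟶ Q'.complex}
    (ha : a.f 0 ≫ aug Q' = aug Q ≫ f) :
    a ≫ Q'.π = Q.π ≫ (ChainComplex.single₀ C).map f := by
  apply HomologicalComplex.to_single_hom_ext
  rw [HomologicalComplex.comp_f, HomologicalComplex.comp_f, ChainComplex.single₀_map_f_zero]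
  exact ha

/-- The sum of lifts of `f` and `g` is a lift of `f + g`, and all lifts induce the same map. -/
lemma stableExt_additive (Q : ∀ N : C, ProjectiveResolution N) (i : ℤ) :
    ((stableExt 𝕜 P Q).F i).Additive where
  map_add {X Y f g} := by
    refine (stableMap_eq_of_lift 𝕜 P (f + g) (ProjectiveResolution.lift_commutes _ _ _) ?_ i).trans
      (stableMap_add 𝕜 P (ProjectiveResolution.lift f (Q X) (Q Y)) _ i)
    rw [Preadditive.add_comp, ProjectiveResolution.lift_commutes,
      ProjectiveResolution.lift_commutes, ← Preadditive.comp_add, ← Functor.map_add]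

/-- The middle term of a short exact sequence of projective resolutions may be replaced by any
other resolution. -/
lemma exists_iso_mid {S : ShortComplex C} {Q₁ : ProjectiveResolution S.X₁}
    {Q₃ : ProjectiveResolution S.X₃} (H : Horseshoe S Q₁ Q₃) (Q₂ : ProjectiveResolution S.X₂)
    (i : ℤ) :
    ∃ e : (stableHomRes 𝕜 P Q₂).homology i ≅ (stableHomRes 𝕜 P H.mid).homology i,
      stableMap 𝕜 P (ProjectiveResolution.lift S.f Q₁ Q₂) i ≫ e.hom = stableMap 𝕜 P H.f i ∧
      e.hom ≫ stableMap 𝕜 P H.g i = stableMap 𝕜 P (ProjectiveResolution.lift S.g Q₂ Q₃) i := by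
  let E := ProjectiveResolution.homotopyEquiv Q₂ H.mid
  refine ⟨⟨stableMap 𝕜 P E.hom i, stableMap 𝕜 P E.inv i, ?_, ?_⟩, ?_, ?_⟩
  · rw [← stableMap_comp, stableMap_eq_of_homotopy 𝕜 P E.homotopyHomInvId, stableMap_id]
  · rw [← stableMap_comp, stableMap_eq_of_homotopy 𝕜 P E.homotopyInvHomId, stableMap_id]
  · rw [← stableMap_comp]
    refine stableMap_eq_of_lift 𝕜 P S.f ?_ (comp_π_of_comp_aug H.f_aug) i
    rw [Category.assoc, ProjectiveResolution.homotopyEquiv_hom_π,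
      ProjectiveResolution.lift_commutes]
  · rw [← stableMap_comp]
    refine stableMap_eq_of_lift 𝕜 P S.g ?_ (ProjectiveResolution.lift_commutes _ _ _) i
    rw [Category.assoc, comp_π_of_comp_aug H.g_aug, ← Category.assoc,
      ProjectiveResolution.homotopyEquiv_hom_π]

lemma stableHomShortComplex_horseshoe_shortExact {S : ShortComplex C}
    {Q₁ : ProjectiveResolution S.X₁} {Q₃ : ProjectiveResolution S.X₃} (H : Horseshoe S Q₁ Q₃) :
    (stableHomShortComplex 𝕜 P.cochainComplex H.shortComplex).ShortExact :=
  stableHomShortComplex_shortExact 𝕜 P.cochainComplex H.shortComplex fun n =>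
    have : Projective (H.shortComplex.map
        (HomologicalComplex.eval C (ComplexShape.up ℤ) n)).X₃ :=
      inferInstanceAs (Projective (Q₃.cochainComplex.X n))
    (H.shortComplex_shortExact.map_of_exact _).splittingOfProjective

lemma exact_stableδ_stableMap {S : ShortComplex C}
    {Q₁ : ProjectiveResolution S.X₁} {Q₃ : ProjectiveResolution S.X₃} (H : Horseshoe S Q₁ Q₃)
    (i j : ℤ) (hij : i + 1 = j) :
    Function.Exact (stableδ 𝕜 P.cochainComplex H i j hij) (stableMap 𝕜 P H.f j) :=
  (ShortComplex.ShortExact.moduleCat_exact_iff_function_exact _).1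
    ((stableHomShortComplex_horseshoe_shortExact 𝕜 P H).homology_exact₁ i j (by simpa using hij))

lemma exact_stableMap_stableMap {S : ShortComplex C}
    {Q₁ : ProjectiveResolution S.X₁} {Q₃ : ProjectiveResolution S.X₃} (H : Horseshoe S Q₁ Q₃)
    (i : ℤ) : Function.Exact (stableMap 𝕜 P H.f i) (stableMap 𝕜 P H.g i) :=
  (ShortComplex.ShortExact.moduleCat_exact_iff_function_exact _).1
    ((stableHomShortComplex_horseshoe_shortExact 𝕜 P H).homology_exact₂ i)

lemma exact_stableMap_stableδ {S : ShortComplex C}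
    {Q₁ : ProjectiveResolution S.X₁} {Q₃ : ProjectiveResolution S.X₃} (H : Horseshoe S Q₁ Q₃)
    (i j : ℤ) (hij : i + 1 = j) :
    Function.Exact (stableMap 𝕜 P H.g i) (stableδ 𝕜 P.cochainComplex H i j hij) :=
  (ShortComplex.ShortExact.moduleCat_exact_iff_function_exact _).1
    ((stableHomShortComplex_horseshoe_shortExact 𝕜 P H).homology_exact₃ i j (by simpa using hij))

end StableMaps

/-! ### Transport along bijective morphisms of families -/

section Transport

namespace ConnectedFamily

variable {𝕜 : Type t} [CommRing 𝕜] {C : Type u} [Category.{v} C] [Abelian C]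
  {T U V : ConnectedFamily 𝕜 C}

lemma Hom.isCohomological_of_bijective (μ : T.Hom U)
    (hμ : ∀ i N, Function.Bijective ((μ.app i).app N)) (hT : T.IsCohomological) :
    U.IsCohomological where
  additive i := by
    have := hT.additive i
    refine ⟨fun {X Y f g} => ModuleCat.hom_ext (LinearMap.ext fun y => ?_)⟩
    obtain ⟨x, rfl⟩ := (hμ i X).2 y
    have h : ∀ f : X ⟶ Y, (U.F i).map f ((μ.app i).app X x) =
      (μ.app i).app Y ((T.F i).map f x) := fun f => (μ.naturality_apply i f x).symm
    refine (h _).trans (Eq.trans ?_ (congrArg₂ (· + ·) (h f) (h g)).symm)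
    rw [Functor.map_add]
    exact map_add _ _ _
  δ_naturality i j hij S S' hS hS' φ := by
    ext y
    obtain ⟨x, rfl⟩ := (hμ i S.X₃).2 y
    have h := congrArg ((μ.app j).app S'.X₁) congr($(hT.δ_naturality i j hij S S' hS hS' φ) x)
    rw [ConcreteCategory.comp_apply, ConcreteCategory.comp_apply] at h ⊢
    rwa [μ.naturality_apply, μ.comm_apply, μ.comm_apply, μ.naturality_apply] at h
  exact₁ i j hij S hS y := by
    obtain ⟨x, rfl⟩ := (hμ j S.X₁).2 y
    rw [← μ.naturality_apply, map_eq_zero_iff _ (hμ j S.X₂).1, hT.exact₁ i j hij S hS x]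
    constructor
    · rintro ⟨z, rfl⟩
      exact ⟨_, (μ.comm_apply hij hS z).symm⟩
    · rintro ⟨z, hz⟩
      obtain ⟨z, rfl⟩ := (hμ i S.X₃).2 z
      exact ⟨z, (hμ j S.X₁).1 ((μ.comm_apply hij hS z).trans hz)⟩
  exact₂ i S hS y := by
    obtain ⟨x, rfl⟩ := (hμ i S.X₂).2 y
    rw [← μ.naturality_apply, map_eq_zero_iff _ (hμ i S.X₃).1, hT.exact₂ i S hS x]
    constructor
    · rintro ⟨z, rfl⟩
      exact ⟨_, (μ.naturality_apply i S.f z).symm⟩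
    · rintro ⟨z, hz⟩
      obtain ⟨z, rfl⟩ := (hμ i S.X₁).2 z
      exact ⟨z, (hμ i S.X₂).1 ((μ.naturality_apply i S.f z).trans hz)⟩
  exact₃ i j hij S hS y := by
    obtain ⟨x, rfl⟩ := (hμ i S.X₃).2 y
    rw [← μ.comm_apply, map_eq_zero_iff _ (hμ j S.X₁).1, hT.exact₃ i j hij S hS x]
    constructor
    · rintro ⟨z, rfl⟩
      exact ⟨_, (μ.naturality_apply i S.g z).symm⟩
    · rintro ⟨z, hz⟩
      obtain ⟨z, rfl⟩ := (hμ i S.X₂).2 z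
      exact ⟨z, (hμ i S.X₃).1 ((μ.naturality_apply i S.g z).trans hz)⟩

lemma Hom.exists_inverse (μ : T.Hom U) (hμ : ∀ i N, IsIso ((μ.app i).app N)) :
    ∃ ν : U.Hom T, (∀ i N x, (ν.app i).app N ((μ.app i).app N x) = x) ∧
      ∀ i N x, (μ.app i).app N ((ν.app i).app N x) = x := by
  have (i : ℤ) : IsIso (μ.app i) := NatIso.isIso_of_isIso_app _
  refine ⟨⟨fun i => inv (μ.app i), fun i j hij S hS => ?_⟩, fun i N x => ?_, fun i N x => ?_⟩
  · rw [← cancel_mono ((μ.app j).app S.X₁), ← cancel_epi ((μ.app i).app S.X₃)]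
    simp only [Category.assoc, NatIso.isIso_inv_app, IsIso.inv_hom_id, IsIso.hom_inv_id_assoc,
      Category.comp_id]
    rw [μ.comm]
  · exact congr($(NatTrans.congr_app (IsIso.hom_inv_id (μ.app i)) N) x)
  · exact congr($(NatTrans.congr_app (IsIso.inv_hom_id (μ.app i)) N) x)

lemma Eventually.comp {τ : T.Hom U} {ν : U.Hom V} {n : ℕ} {i : ℤ} {N : C} {x y : (U.F i).obj N}
    (h : Eventually (τ.spanRel τ) n i N x y) :
    Eventually ((τ.comp ν).spanRel (τ.comp ν)) n i N ((ν.app i).app N x) ((ν.app i).app N y) := by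
  induction n generalizing i N with
  | zero =>
    obtain ⟨s, rfl, rfl⟩ := h
    exact ⟨s, rfl, rfl⟩
  | succ n ih =>
    intro j hij K L f g w hS hL
    have h1 := ih (h j hij K L f g w hS hL)
    have h2 := ν.comm_apply hij hS x
    have h3 := ν.comm_apply hij hS y
    dsimp only at h2 h3
    rwa [h2, h3] at h1

lemma Hom.IsEventuallyBijective.comp {τ : T.Hom U} (hτ : τ.IsEventuallyBijective) (ν : U.Hom V)
    (hν : ∀ i N, Function.Bijective ((ν.app i).app N)) : (τ.comp ν).IsEventuallyBijective where
  surjective i N x := by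
    obtain ⟨x, rfl⟩ := (hν i N).2 x
    obtain ⟨n, hn⟩ := hτ.surjective i N x
    exact ⟨n, hn.comp⟩
  injective i N s hs := hτ.injective i N s
    ((hν i N).1 (hs.trans (map_zero _).symm))

end ConnectedFamily

end Transport

/-! ### The comparison isomorphism and the cohomological axioms -/

section Comparison

variable {𝕜 : Type t} [CommRing 𝕜] {C : Type u} [Category.{v} C] [Abelian C] [Linear 𝕜 C]
  {M : C} (P : ProjectiveResolution M) (Q : ∀ N : C, ProjectiveResolution N)

variable (𝕜) in
/-- The comparison morphism from stable cohomology to Benson-Carlson cohomology. -/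
theorem exists_comparison : ∃ μ : (stableExt 𝕜 P Q).Hom (bcExt 𝕜 P Q),
    ∀ (i : ℤ) (N : C) (x : (stableHomRes 𝕜 P (Q N)).homology i) (y : bcColim 𝕜 P (Q N) i),
      ComparisonRel 𝕜 P (Q N) i x y → (μ.app i).app N x = y := by
  have ex (i : ℤ) (N : C) : ∃ α : (stableHomRes 𝕜 P (Q N)).homology i →ₗ[𝕜] bcColim 𝕜 P (Q N) i,
      ∀ x y, ComparisonRel 𝕜 P (Q N) i x y → α x = y :=
    exists_linearMap_of_relation _ (ComparisonRel.exists i) (fun _ _ _ _ h h' => h.add h')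
      (fun c _ _ h => h.smul c) (fun _ h => h.eq_zero)
  choose α hα using ex
  refine ⟨{ app := fun i => { app := fun N => ModuleCat.ofHom (α i N), naturality := ?_ },
            comm := ?_ }, hα⟩
  · intro N N' f
    refine ModuleCat.hom_ext (LinearMap.ext fun x => ?_)
    obtain ⟨y, hy⟩ := ComparisonRel.exists (𝕜 := 𝕜) (P := P) (Q := Q N) i x
    exact (hα i N' _ _ (hy.map (liftRes Q f))).trans
      (congrArg (bcColimMap 𝕜 P (Q N) (Q N') (liftRes Q f) i) (hα i N _ _ hy)).symm
  · intro i j hij S hS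
    refine ModuleCat.hom_ext (LinearMap.ext fun x => ?_)
    obtain ⟨y, hy⟩ := ComparisonRel.exists (𝕜 := 𝕜) (P := P) (Q := Q S.X₃) i x
    exact (hα j S.X₁ _ _ (hy.connecting hS _ hij)).trans
      (congrArg (bcδ 𝕜 P hS _ i j hij) (hα i S.X₃ _ _ hy)).symm

variable {P Q}

lemma ComparisonRel.of_induces {N : C} {Q : ProjectiveResolution N} {i : ℤ}
    {c : (stableHomRes 𝕜 P Q).cycles i} {φ : Cochain P.cochainComplex Q.cochainComplex i}
    (hφ : (stableHomRes 𝕜 P Q).iCycles i c = stableHomMk 𝕜 φ) {k n : ℕ} (hn : (k : ℤ) - i = n)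
    {m : ℤ} (hm : (k : ℤ) - i = m) {f : syz P.cochainComplex k ⟶ syz Q.cochainComplex m}
    (hf : Induces φ k m hm f) :
    ComparisonRel 𝕜 P Q i ((stableHomRes 𝕜 P Q).homologyπ i c)
      (bcClass 𝕜 P Q k m i hm ((i * k).negOnePow • f)) := by
  obtain rfl : m = n := hm.symm.trans hn
  exact ⟨c, φ, k, n, hn, f, rfl, hφ, hf, rfl⟩

lemma bijective_of_comparisonRel {μ : (stableExt 𝕜 P Q).Hom (bcExt 𝕜 P Q)}
    (hμ : ∀ (i : ℤ) (N : C) (x : (stableHomRes 𝕜 P (Q N)).homology i)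
      (y : bcColim 𝕜 P (Q N) i), ComparisonRel 𝕜 P (Q N) i x y → (μ.app i).app N x = y)
    (i : ℤ) (N : C) : Function.Bijective ((μ.app i).app N) := by
  refine ⟨(injective_iff_map_eq_zero _).2 fun x hx => ?_, fun y => ?_⟩
  · obtain ⟨y, hy⟩ := ComparisonRel.exists (𝕜 := 𝕜) (P := P) (Q := Q N) i x
    obtain rfl : y = 0 := (hμ i N x y hy).symm.trans hx
    exact hy.eq_zero_left
  · obtain ⟨x, hx⟩ := ComparisonRel.exists_left (𝕜 := 𝕜) (P := P) (Q := Q N) (i := i) y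
    exact ⟨x, hμ i N x y hx⟩

variable (𝕜 P Q)

/-- Naturality of the connecting maps is checked after applying the injective comparison, where
`bcδ_naturality` applies; the comparison was built without using the axioms. The exact sequences are
those of the horseshoe, with its middle resolution exchanged for the chosen one by `exists_iso_mid`.
-/
theorem stableExt_isCohomological : (stableExt 𝕜 P Q).IsCohomological where
  additive := stableExt_additive 𝕜 P Q
  δ_naturality i j hij S S' hS hS' φ := by
    obtain ⟨μ, hμ⟩ := exists_comparison 𝕜 P Q
    ext x
    refine (bijective_of_comparisonRel hμ j S'.X₁).1 ?_
    refine (μ.naturality_apply j φ.τ₁ _).trans ?_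
    refine (congrArg _ (μ.comm_apply hij hS x)).trans ?_
    refine Eq.trans ?_ (μ.comm_apply hij hS' _).symm
    refine Eq.trans ?_ (congrArg _ (μ.naturality_apply i φ.τ₃ x)).symm
    exact congr($(bcδ_naturality 𝕜 P hS hS' φ _ _ (liftRes Q φ.τ₁) (liftRes Q φ.τ₃)
      (ConnectedFamily.syzMap_liftRes_augSyz Q φ.τ₁) (ConnectedFamily.syzMap_liftRes_augSyz Q φ.τ₃) i j hij)
      ((μ.app i).app S.X₃ x))
  exact₁ i j hij S hS := by
    let H := Classical.choice (nonempty_horseshoe hS (Q S.X₁) (Q S.X₃))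
    obtain ⟨e, he, -⟩ := exists_iso_mid 𝕜 P H (Q S.X₂) j
    intro x
    have hx : stableMap 𝕜 P H.f j x =
      e.hom (stableMap 𝕜 P (ProjectiveResolution.lift S.f (Q S.X₁) (Q S.X₂)) j x) :=
      congr($he.symm x)
    refine Iff.trans ?_ (exact_stableδ_stableMap 𝕜 P H i j hij x)
    rw [hx]
    exact (map_eq_zero_iff _ ((ConcreteCategory.isIso_iff_bijective e.hom).1 inferInstance).1).symm
  exact₂ i S hS := by
    let H := Classical.choice (nonempty_horseshoe hS (Q S.X₁) (Q S.X₃))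
    obtain ⟨e, he, he'⟩ := exists_iso_mid 𝕜 P H (Q S.X₂) i
    have hb := (ConcreteCategory.isIso_iff_bijective e.hom).1 inferInstance
    intro x
    have hx : stableMap 𝕜 P (ProjectiveResolution.lift S.g (Q S.X₂) (Q S.X₃)) i x =
      stableMap 𝕜 P H.g i (e.hom x) := congr($he'.symm x)
    refine (Eq.congr_left hx).trans ((exact_stableMap_stableMap 𝕜 P H i (e.hom x)).trans ?_)
    rw [← he]
    constructor
    · rintro ⟨z, hz⟩
      exact ⟨z, hb.1 hz⟩
    · rintro ⟨z, hz⟩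
      exact ⟨z, congrArg e.hom hz⟩
  exact₃ i j hij S hS := by
    let H := Classical.choice (nonempty_horseshoe hS (Q S.X₁) (Q S.X₃))
    obtain ⟨e, -, he⟩ := exists_iso_mid 𝕜 P H (Q S.X₂) i
    have hb := (ConcreteCategory.isIso_iff_bijective e.hom).1 inferInstance
    intro x
    refine (exact_stableMap_stableδ 𝕜 P H i j hij x).trans ?_
    constructor
    · rintro ⟨z, rfl⟩
      obtain ⟨z, rfl⟩ := hb.2 z
      exact ⟨z, congr($he.symm z)⟩
    · rintro ⟨z, hz⟩
      exact ⟨e.hom z, congr($he z).trans hz⟩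

end Comparison

end StableCohomology

/-! ### The main theorem -/

open StableCohomology in
theorem mainTheorem9 {𝕜 : Type t} [CommRing 𝕜] {R : Type u} [Ring R] [Algebra 𝕜 R] [Small.{v} R]
    (M : ModuleCat.{v} R) (P : ProjectiveResolution M)
    (Q : ∀ N : ModuleCat.{v} R, ProjectiveResolution N) :
    -- stable cohomology and Benson-Carlson cohomology are cohomological functors,
    ((stableExt 𝕜 P Q).IsCohomological ∧ (bcExt 𝕜 P Q).IsCohomological) ∧
    -- and are isomorphic by a morphism of cohomological functors which maps the class of a cochain
    -- that is a chain map in high degrees to the class of the maps it induces on high syzygies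
    (∃ μ : (stableExt 𝕜 P Q).Hom (bcExt 𝕜 P Q),
      (∀ (i : ℤ) (N : ModuleCat.{v} R), IsIso ((μ.app i).app N)) ∧
      ∀ (i : ℤ) (N : ModuleCat.{v} R) (φ : Cochain P.cochainComplex (Q N).cochainComplex i)
        (c : (stableHomComplex 𝕜 P.cochainComplex (Q N).cochainComplex).cycles i),
        (stableHomComplex 𝕜 P.cochainComplex (Q N).cochainComplex).iCycles i c =
          stableHomMk 𝕜 φ →
        ∀ k : ℕ, i ≤ k →
        (∀ (p q : ℤ) (hpq : p + (i + 1) = q), p < -k → (δ i (i + 1) φ).v p q hpq = 0) →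
        ∀ f : syz P.cochainComplex k ⟶ syz (Q N).cochainComplex (k - i),
          syzProj P.cochainComplex k ≫ f =
            φ.v (-k) (-(k - i)) (by ring) ≫ syzProj (Q N).cochainComplex (k - i) →
          (μ.app i).app N ((stableHomComplex 𝕜 P.cochainComplex
              (Q N).cochainComplex).homologyπ i c) =
            bcι 𝕜 P (Q N) i k (StableHom.mk 𝕜 ((i * k).negOnePow • f))) ∧
    -- moreover, stable cohomology is the P-completion of `Ext(M, -)`, which is the colimit of the
    -- left satellites of `Ext(M, -)`
    ∃ τ : (extFamily 𝕜 M).Hom (stableExt 𝕜 P Q),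
      ConnectedFamily.IsPCompletion τ ∧
      ∀ i : ℤ, ∃ θ : (stableExt 𝕜 P Q).F i ≅ satelliteColim (extFamily_isCohomological 𝕜 M) Q i,
        ∀ (N : ModuleCat.{v} R) (k : ℕ),
          satelliteColimι (extFamily_isCohomological 𝕜 M) Q i N k ≫ θ.inv.app N ≫
              iterδ (stableExt 𝕜 P Q) (Q N) i k =
            satelliteι (extFamily 𝕜 M) (Q N).cochainComplex k i ≫
              (τ.app (k + i)).app (syz (Q N).cochainComplex k) := by
  obtain ⟨μ, hμ⟩ := exists_comparison 𝕜 P Q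
  have hbij := bijective_of_comparisonRel hμ
  have hiso (i : ℤ) (N : ModuleCat.{v} R) : IsIso ((μ.app i).app N) :=
    (ConcreteCategory.isIso_iff_bijective _).2 (hbij i N)
  have hS := stableExt_isCohomological 𝕜 P Q
  have hBC := μ.isCohomological_of_bijective hbij hS
  refine ⟨⟨hS, hBC⟩, ⟨μ, hiso, ?_⟩, ?_⟩
  · intro i N φ c hφ k hk hδ f hf
    obtain ⟨n, hn⟩ : ∃ n : ℕ, (k : ℤ) - i = n := Int.eq_ofNat_of_zero_le (by lia)
    refine hμ i N _ _ ?_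
    rw [← bcClass_rfl]
    exact ComparisonRel.of_induces hφ hn rfl ⟨hδ, hf⟩
  -- The augmentations of the given resolutions provide the projective covers.
  · have : EnoughProjectives (ModuleCat.{v} R) :=
      ⟨fun N => ⟨{ p := (Q N).complex.X 0, f := aug (Q N) }⟩⟩
    obtain ⟨ν, hν, hν'⟩ := μ.exists_inverse hiso
    have hνbij (i : ℤ) (N : ModuleCat.{v} R) : Function.Bijective ((ν.app i).app N) :=
      Function.bijective_iff_has_inverse.2 ⟨_, hν' i N, hν i N⟩
    -- The morphism is constructed into Benson-Carlson cohomology, where classes are explicit, and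
    -- is carried to stable cohomology by the inverse comparison `ν`.
    obtain ⟨τ, hτ⟩ := exists_isEventuallyBijective_bcExt P Q hBC
    have hP : (stableExt 𝕜 P Q).VanishesOnProjectives := fun i N hN =>
      (bcExt_vanishesOnProjectives P Q i N hN).of_iso (asIso ((μ.app i).app N))
    have hτν := hτ.comp ν hνbij
    exact ⟨τ.comp ν, hτν.isPCompletion hS hP, fun i =>
      hτν.exists_iso_satelliteColim (extFamily_isCohomological 𝕜 M) hS hP Q i⟩
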